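/- Let $K$ be a field. By a *tensor category* we mean a $K$-linear abelian rigid symmetric monoidal category with $K$-bilinear tensor product, and by a *tensor functor* a $K$-linear exact (strong) symmetric monoidal functor. Let $\mathcal A,\mathcal C,\mathcal D$ be tensor categories, where $\mathcal A\subset\mathcal C$ is a full abelian tensor subcategory (that is, a fully faithful tensor functor $\mathcal A\to\mathcal C$ is given), let $H:\mathcal C\to\mathcal D$ be a tensor functor, and let $\omega:\mathcal D\to\mathrm{Vect}(K)$ be a fiber functor (a faithful $K$-linear exact symmetric monoidal functor). For a $K$-linear symmetric monoidal functor $F$ with values in $\mathrm{Vect}(K)$ let $\underline{\mathrm{Aut}}^\otimes(F)$ be the group functor that sends a commutative $K$-algebra $R$ to the group of monoidal automorphisms of $X\mapsto R\otimes_K F(X)$. Put $$\mathrm{Gal}(\mathcal D)=\underline{\mathrm{Aut}}^\otimes(\omega),\quad \mathrm{Gal}(\mathcal C)=\underline{\mathrm{Aut}}^\otimes(\omega\circ H),\quad \mathrm{Gal}(\mathcal A)=\underline{\mathrm{Aut}}^\otimes((\omega\circ H)|_{\mathcal A}),$$ and let $I:\mathrm{Gal}(\mathcal D)\to\mathrm{Gal}(\mathcal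 C)$, $\varphi\mapsto\varphi\circ H$, and $P:\mathrm{Gal}(\mathcal C)\to\mathrm{Gal}(\mathcal A)$, $\psi\mapsto\psi|_{\mathcal A}$. "Surjective" means: every $R$-point of the target lifts after some faithfully flat extension $R\to S$ of commutative $K$-algebras (for affine group schemes over $K$: faithfully flat). "Injective" and "$\mathrm{Ker}\subseteq\mathrm{Im}$" are meant on $R$-points for all $R$. Consider the following assumptions. * (A1) For every object $X$ of $\mathcal A$ there is an integer $m\ge 0$ with $H(X)\simeq\bigoplus_{i=1}^m\mathbf 1_{\mathcal D}$. * (A2) $\mathcal D$ is semi-simple (every object is a finite direct sum of simple objects), and there is a full subcategory $\mathcal D_{\mathrm{dens}}\subset\mathcal D$ such that every object of $\mathcal D$ is a direct factor of an object of $\mathcal D_{\mathrm{dens}}$ and such that for every $Y\in\mathcal D_{\mathrm{dens}}$ there are $X\in\mathcal C$ and an epimorphism $H(X)\twoheadrightarrow Y$. * (A3) $\mathcal D$ is semi-simple; $H$ is the left adjoint of a monadic adjunction $H\dashv G$ with counit $\epsilon$; $G(\mathbf 1_{\mathcal D})$ is isomorphic to an object of $\mathcal A$; and the natural transformation $-\otimes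 G(\mathbf 1_{\mathcal D})\Rightarrow (G\circ H)(-)$ which corresponds by adjunction to $H(-\otimes G(\mathbf 1_{\mathcal D}))\simeq H(-)\otimes HG(\mathbf 1_{\mathcal D})\xrightarrow{\mathrm{id}\otimes\epsilon_{\mathbf 1}}H(-)\otimes\mathbf 1_{\mathcal D}\simeq H(-)$ is an isomorphism. * (A3') There is a filtered diagram $\{H:\mathcal C\xrightarrow{H_i}\mathcal D_i\to\mathcal D\}_{i\in I}$ of tensor categories and tensor functors (commutative up to coherent monoidal isomorphisms) such that $\mathrm{colim}_i\,\mathcal D_i\to\mathcal D$ is an equivalence and every $H_i:\mathcal C\to\mathcal D_i$ satisfies (A3) with respect to $\mathcal A\subset\mathcal C$. **Theorem.** 1. If $\mathcal A$ is closed under subobjects in $\mathcal C$, then $P$ is surjective. 2. (A1) implies that $P\circ I$ is trivial. 3. (A2) implies that $I$ is injective. 4. (A3), or more generally (A3'), implies that $\mathrm{Ker}(P)\subseteq\mathrm{Im}(I)$. If (A1), (A2) and one of (A3), (A3') hold, then there is a short exact sequence $$1\longrightarrow\mathrm{Gal}(\mathcal D)\xrightarrow{\ I\ }\mathrm{Gal}(\mathcal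 C)\xrightarrow{\ P\ }\mathrm{Gal}(\mathcal A)\longrightarrow 1,$$ that is, $I$ is injective, $\mathrm{Ker}(P)=\mathrm{Im}(I)$, and $P$ is surjective. -/

import Mathlib

open CategoryTheory MonoidalCategory Limits TensorProduct
open CategoryTheory.Functor.LaxMonoidal CategoryTheory.Functor.OplaxMonoidal

universe w w₁ w₂ v v₁ v₂ v₃ v₄ v₅ u u₁ u₂ u₃ u₄ u₅

noncomputable section

namespace TannakaSES

/-! ### Tensor categories, tensor functors and fiber functors -/

/-- A `K`-linear abelian rigid symmetric monoidal category (the tensor product is `K`-bilinear on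
morphisms). Idempotent completeness is automatic for abelian categories. -/
structure TensorCat (K : Type u) [Field K] where
  /-- The type of objects. -/
  carrier : Type u₁
  [category : Category.{v₁} carrier]
  [abelian : Abelian carrier]
  [linear : Linear K carrier]
  [monoidal : MonoidalCategory carrier]
  [symmetric : SymmetricCategory carrier]
  [monoidalPreadditive : MonoidalPreadditive carrier]
  [monoidalLinear : MonoidalLinear K carrier]
  [rigid : RigidCategory carrier]

instance (K : Type u) [Field K] : CoeSort (TensorCat.{v₁, u, u₁} K) (Type u₁) :=
  ⟨TensorCat.carrier⟩

attribute [instance] TensorCat.category TensorCat.abelian TensorCat.linear TensorCat.monoidal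
  TensorCat.symmetric TensorCat.monoidalPreadditive TensorCat.monoidalLinear TensorCat.rigid

instance (K : Type u) [Field K] (C : TensorCat.{v₁, u, u₁} K) : HasFiniteBiproducts C :=
  Abelian.hasFiniteBiproducts

section Functors

variable {K : Type u} [Field K]

/-- A `K`-linear exact (strong) symmetric monoidal functor between tensor categories. -/
structure TensorFunctor (C : TensorCat.{v₁, u, u₁} K) (D : TensorCat.{v₂, u, u₂} K) where
  /-- The underlying functor. -/
  functor : C ⥤ D
  [braided : functor.Braided]
  [additive : functor.Additive]
  [linear : functor.Linear K]
  [leftExact : PreservesFiniteLimits functor]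
  [rightExact : PreservesFiniteColimits functor]

attribute [instance] TensorFunctor.braided TensorFunctor.additive TensorFunctor.linear
  TensorFunctor.leftExact TensorFunctor.rightExact

/-- A fiber functor on `D`: a faithful `K`-linear exact symmetric monoidal functor to `K`-vector
spaces. (Since `D` is rigid, its values are automatically finite dimensional.) -/
structure FiberFunctor (D : TensorCat.{v₁, u, u₁} K) where
  /-- The underlying functor. -/
  functor : D ⥤ ModuleCat.{u} K
  [braided : functor.Braided]
  [additive : functor.Additive]
  [linear : functor.Linear K]
  [leftExact : PreservesFiniteLimits functor]
  [rightExact : PreservesFiniteColimits functor]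
  [faithful : functor.Faithful]

attribute [instance] FiberFunctor.braided FiberFunctor.additive FiberFunctor.linear
  FiberFunctor.leftExact FiberFunctor.rightExact FiberFunctor.faithful

end Functors

/-! ### The group scheme of tensor automorphisms -/

section ScalarExtension

variable {K : Type u} [Field K] {R : Type w₁} {S : Type w₂} [CommRing R] [CommRing S]
  [Algebra K R] [Algebra K S]

/-- For a `K`-algebra map `f : R → S`, the `S`-linear extension `S ⊗ M → S ⊗ M` of an `R`-linear
endomorphism of `R ⊗ M`. -/
def scalarExt (f : R →ₐ[K] S) {M : Type v} [AddCommGroup M] [Module K M]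
    (e : R ⊗[K] M →ₗ[R] R ⊗[K] M) : S ⊗[K] M →ₗ[S] S ⊗[K] M :=
  LinearMap.liftBaseChange S
    ((f.toLinearMap.rTensor M ∘ₗ e.restrictScalars K) ∘ₗ TensorProduct.mk K R M 1)

variable {M : Type v} [AddCommGroup M] [Module K M]

theorem rTensor_smul (f : R →ₐ[K] S) (r : R) (a : R ⊗[K] M) :
    f.toLinearMap.rTensor M (r • a) = f r • f.toLinearMap.rTensor M a := by
  induction a using TensorProduct.induction_on with
  | zero => simp
  | tmul s m => simp [TensorProduct.smul_tmul']
  | add a b ha hb => simp only [smul_add, map_add, ha, hb]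

theorem scalarExt_one_tmul (f : R →ₐ[K] S) (e : R ⊗[K] M →ₗ[R] R ⊗[K] M) (m : M) :
    scalarExt f e (1 ⊗ₜ m) = f.toLinearMap.rTensor M (e (1 ⊗ₜ m)) := by
  simp [scalarExt]

/-- `scalarExt f e` is the `S`-linear map that restricts to `e` along `R ⊗ M → S ⊗ M`. -/
theorem scalarExt_rTensor (f : R →ₐ[K] S) (e : R ⊗[K] M →ₗ[R] R ⊗[K] M) (a : R ⊗[K] M) :
    scalarExt f e (f.toLinearMap.rTensor M a) = f.toLinearMap.rTensor M (e a) := by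
  induction a using TensorProduct.induction_on with
  | zero => simp
  | tmul r m =>
    have h1 : r ⊗ₜ[K] m = r • ((1 : R) ⊗ₜ[K] m) := by simp [TensorProduct.smul_tmul']
    have h2 : f.toLinearMap.rTensor M (r ⊗ₜ[K] m) = f r • ((1 : S) ⊗ₜ[K] m) := by
      simp [TensorProduct.smul_tmul']
    rw [h2, map_smul, scalarExt_one_tmul, h1, map_smul, rTensor_smul]
  | add a b ha hb => simp only [map_add, ha, hb]

theorem hom_ext_one_tmul {N : Type w} [AddCommGroup N] [Module S N]
    {g h : S ⊗[K] M →ₗ[S] N} (H : ∀ m, g (1 ⊗ₜ m) = h (1 ⊗ₜ m)) : g = h := by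
  ext z
  induction z using TensorProduct.induction_on with
  | zero => simp
  | tmul s m =>
    have hs : s ⊗ₜ[K] m = s • ((1 : S) ⊗ₜ[K] m) := by simp [TensorProduct.smul_tmul']
    rw [hs, map_smul, map_smul, H]
  | add a b ha hb => simp only [map_add, ha, hb]

theorem hom_ext_tmul_tmul {M' : Type v₁} [AddCommGroup M'] [Module K M'] {N : Type w}
    [AddCommGroup N] [Module S N] {g h : (S ⊗[K] M) ⊗[S] (S ⊗[K] M') →ₗ[S] N}
    (H : ∀ m m', g ((1 ⊗ₜ m) ⊗ₜ (1 ⊗ₜ m')) = h ((1 ⊗ₜ m) ⊗ₜ (1 ⊗ₜ m'))) : g = h := by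
  apply TensorProduct.ext
  refine hom_ext_one_tmul (K := K) fun x => ?_
  refine hom_ext_one_tmul (K := K) fun y => ?_
  exact H x y

theorem scalarExt_id (f : R →ₐ[K] S) :
    scalarExt f (LinearMap.id : R ⊗[K] M →ₗ[R] R ⊗[K] M) = LinearMap.id :=
  hom_ext_one_tmul fun m => by simp [scalarExt_one_tmul]

theorem scalarExt_comp (f : R →ₐ[K] S) (e e' : R ⊗[K] M →ₗ[R] R ⊗[K] M) :
    scalarExt f (e ∘ₗ e') = scalarExt f e ∘ₗ scalarExt f e' :=
  hom_ext_one_tmul fun m => by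
    rw [LinearMap.comp_apply, scalarExt_one_tmul, scalarExt_one_tmul, scalarExt_rTensor,
      LinearMap.comp_apply]

/-- The extension of scalars of an automorphism. -/
def scalarExtEquiv (f : R →ₐ[K] S) (e : R ⊗[K] M ≃ₗ[R] R ⊗[K] M) :
    S ⊗[K] M ≃ₗ[S] S ⊗[K] M :=
  LinearEquiv.ofLinearMap (scalarExt f e.toLinearMap) (scalarExt f e.symm.toLinearMap)
    (by rw [← scalarExt_comp, LinearEquiv.comp_symm, scalarExt_id])
    (by rw [← scalarExt_comp, LinearEquiv.symm_comp, scalarExt_id])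

theorem scalarExtEquiv_apply (f : R →ₐ[K] S) (e : R ⊗[K] M ≃ₗ[R] R ⊗[K] M) (a : S ⊗[K] M) :
    scalarExtEquiv f e a = scalarExt f e.toLinearMap a := rfl

end ScalarExtension

section Aut

variable {K : Type u} [Field K] {C : Type u₁} [Category.{v₁} C] [MonoidalCategory C]

/-- The tensor structure `(R ⊗ F X) ⊗_R (R ⊗ F Y) → R ⊗ F (X ⊗ Y)` of the functor `R ⊗ F(-)`. -/
def tensorator (F : C ⥤ ModuleCat.{u} K) [F.LaxMonoidal] (R : Type w) [CommRing R] [Algebra K R]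
    (X Y : C) :
    (R ⊗[K] F.obj X) ⊗[R] (R ⊗[K] F.obj Y) →ₗ[R] R ⊗[K] F.obj (X ⊗ Y) :=
  ((μ F X Y).hom.baseChange R : R ⊗[K] (F.obj X ⊗[K] F.obj Y) →ₗ[R] R ⊗[K] F.obj (X ⊗ Y)) ∘ₗ
    (TensorProduct.AlgebraTensorModule.distribBaseChange K R (F.obj X) (F.obj Y)).symm.toLinearMap

theorem tensorator_tmul (F : C ⥤ ModuleCat.{u} K) [F.LaxMonoidal] (R : Type w) [CommRing R]
    [Algebra K R] (X Y : C) (r s : R) (x : F.obj X) (y : F.obj Y) :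
    tensorator F R X Y ((r ⊗ₜ x) ⊗ₜ (s ⊗ₜ y)) =
      (r * s) ⊗ₜ ((μ F X Y).hom (x ⊗ₜ y : F.obj X ⊗[K] F.obj Y)) := by
  simp only [tensorator, LinearMap.comp_apply, LinearEquiv.coe_coe,
    TensorProduct.AlgebraTensorModule.distribBaseChange_symm_tmul]
  rfl

/-- The `R`-points of `Aut^⊗(F)`: natural automorphisms of the functor `X ↦ R ⊗ F(X)` with values
in `R`-modules, compatible with the tensor product and with the unit. -/
@[ext]
structure TensorAut (F : C ⥤ ModuleCat.{u} K) [F.LaxMonoidal] (R : Type w) [CommRing R]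
    [Algebra K R] where
  /-- The components. -/
  app (X : C) : R ⊗[K] F.obj X ≃ₗ[R] R ⊗[K] F.obj X
  naturality {X Y : C} (f : X ⟶ Y) :
    (F.map f).hom.baseChange R ∘ₗ (app X).toLinearMap =
      (app Y).toLinearMap ∘ₗ (F.map f).hom.baseChange R
  tensor (X Y : C) :
    (app (X ⊗ Y)).toLinearMap ∘ₗ tensorator F R X Y =
      tensorator F R X Y ∘ₗ TensorProduct.map (app X).toLinearMap (app Y).toLinearMap
  unit : app (𝟙_ C) (1 ⊗ₜ (ε F).hom (1 : K)) = 1 ⊗ₜ (ε F).hom (1 : K)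

namespace TensorAut

variable {F : C ⥤ ModuleCat.{u} K} [F.LaxMonoidal] {R : Type w₁} [CommRing R] [Algebra K R]
  {S : Type w₂} [CommRing S] [Algebra K S]

instance : One (TensorAut F R) where
  one :=
    { app := fun X => LinearEquiv.refl R _
      naturality := fun f => by ext; simp
      tensor := fun X Y => by
        simp [TensorProduct.map_id]
      unit := rfl }

instance : Mul (TensorAut F R) where
  mul a b :=
    { app := fun X => (b.app X).trans (a.app X)
      naturality := fun {X Y} f => by
        rw [LinearEquiv.coe_trans, LinearEquiv.coe_trans, ← LinearMap.comp_assoc, a.naturality,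
          LinearMap.comp_assoc, b.naturality, LinearMap.comp_assoc]
      tensor := fun X Y => by
        rw [LinearEquiv.coe_trans, LinearEquiv.coe_trans, LinearEquiv.coe_trans,
          LinearMap.comp_assoc, b.tensor, ← LinearMap.comp_assoc, a.tensor, LinearMap.comp_assoc,
          TensorProduct.map_comp]
      unit := by rw [LinearEquiv.trans_apply, b.unit, a.unit] }

instance : Inv (TensorAut F R) where
  inv a :=
    { app := fun X => (a.app X).symm
      naturality := fun {X Y} f => by
        apply LinearMap.ext
        intro z
        have h := LinearMap.congr_fun (a.naturality f) ((a.app X).symm z)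
        simp only [LinearMap.comp_apply, LinearEquiv.coe_coe, LinearEquiv.apply_symm_apply] at h
        simp only [LinearMap.comp_apply, LinearEquiv.coe_coe]
        rw [h, LinearEquiv.symm_apply_apply]
      tensor := fun X Y => by
        apply LinearMap.ext
        intro z
        have h := LinearMap.congr_fun (a.tensor X Y)
          (TensorProduct.map (a.app X).symm.toLinearMap (a.app Y).symm.toLinearMap z)
        have h2 : TensorProduct.map (a.app X).toLinearMap (a.app Y).toLinearMap
            (TensorProduct.map (a.app X).symm.toLinearMap (a.app Y).symm.toLinearMap z) = z := by
          rw [← LinearMap.comp_apply, ← TensorProduct.map_comp, LinearEquiv.comp_symm,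
            LinearEquiv.comp_symm, TensorProduct.map_id, LinearMap.id_apply]
        simp only [LinearMap.comp_apply, LinearEquiv.coe_coe] at h
        rw [h2] at h
        simp only [LinearMap.comp_apply, LinearEquiv.coe_coe]
        rw [← h, LinearEquiv.symm_apply_apply]
      unit := by rw [LinearEquiv.symm_apply_eq, a.unit] }

theorem one_app (X : C) : (1 : TensorAut F R).app X = LinearEquiv.refl R _ := rfl

theorem mul_app (a b : TensorAut F R) (X : C) :
    (a * b).app X = (b.app X).trans (a.app X) := rfl

theorem inv_app (a : TensorAut F R) (X : C) : (a⁻¹).app X = (a.app X).symm := rfl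

/-- The group structure is composition. -/
instance : Group (TensorAut F R) where
  mul_assoc a b c := by ext X : 2; rfl
  one_mul a := by ext X : 2; rfl
  mul_one a := by ext X : 2; rfl
  inv_mul_cancel a := by ext X : 2; simp [mul_app, inv_app, one_app]

theorem rTensor_tensorator (f : R →ₐ[K] S) (X Y : C) (r s : R) (x : F.obj X) (y : F.obj Y) :
    f.toLinearMap.rTensor _ (tensorator F R X Y ((r ⊗ₜ x) ⊗ₜ (s ⊗ₜ y))) =
      tensorator F S X Y ((f r ⊗ₜ x) ⊗ₜ (f s ⊗ₜ y)) := by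
  simp [tensorator_tmul]

theorem rTensor_tensorator' (f : R →ₐ[K] S) (X Y : C) (a : R ⊗[K] F.obj X) (b : R ⊗[K] F.obj Y) :
    f.toLinearMap.rTensor _ (tensorator F R X Y (a ⊗ₜ b)) =
      tensorator F S X Y (f.toLinearMap.rTensor _ a ⊗ₜ f.toLinearMap.rTensor _ b) := by
  induction a using TensorProduct.induction_on with
  | zero => simp
  | add a a' ha ha' => simp only [TensorProduct.add_tmul, map_add, ha, ha']
  | tmul r x =>
    induction b using TensorProduct.induction_on with
    | zero => simp
    | add b b' hb hb' => simp only [TensorProduct.tmul_add, map_add, hb, hb']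
    | tmul s y => rw [rTensor_tensorator]; simp

/-- Extension of scalars along a map of `K`-algebras. -/
def baseChange (f : R →ₐ[K] S) (a : TensorAut F R) : TensorAut F S where
  app X := scalarExtEquiv f (a.app X)
  naturality {X Y} φ := by
    have hnat : ∀ z : R ⊗[K] F.obj X, (F.map φ).hom.baseChange S (f.toLinearMap.rTensor _ z) =
        f.toLinearMap.rTensor _ ((F.map φ).hom.baseChange R z) := by
      intro z
      induction z using TensorProduct.induction_on with
      | zero => simp
      | tmul r x => simp
      | add z z' h h' => simp only [map_add, h, h']
    refine hom_ext_one_tmul fun m => ?_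
    simp only [LinearMap.comp_apply, LinearEquiv.coe_coe, scalarExtEquiv_apply,
      scalarExt_one_tmul, hnat, LinearMap.baseChange_tmul]
    rw [← LinearEquiv.coe_coe, ← LinearMap.comp_apply, a.naturality]
    simp
  tensor X Y := by
    have key : ∀ (x : F.obj X) (y : F.obj Y),
        scalarExt f (a.app (X ⊗ Y)).toLinearMap (tensorator F S X Y ((1 ⊗ₜ x) ⊗ₜ (1 ⊗ₜ y))) =
        tensorator F S X Y (scalarExt f (a.app X).toLinearMap (1 ⊗ₜ x) ⊗ₜ
          scalarExt f (a.app Y).toLinearMap (1 ⊗ₜ y)) := by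
      intro x y
      have h1 := rTensor_tensorator f X Y 1 1 x y
      rw [map_one] at h1
      rw [← h1, scalarExt_rTensor, scalarExt_one_tmul, scalarExt_one_tmul, ← rTensor_tensorator']
      congr 1
      exact LinearMap.congr_fun (a.tensor X Y) ((1 ⊗ₜ x) ⊗ₜ (1 ⊗ₜ y))
    exact hom_ext_tmul_tmul key
  unit := by
    rw [scalarExtEquiv_apply, scalarExt_one_tmul, LinearEquiv.coe_coe, a.unit]
    simp

theorem baseChange_app (f : R →ₐ[K] S) (a : TensorAut F R) (X : C) :
    (a.baseChange f).app X = scalarExtEquiv f (a.app X) := rfl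

/-- Extension of scalars as a group homomorphism. -/
def baseChangeHom (f : R →ₐ[K] S) : TensorAut F R →* TensorAut F S where
  toFun := baseChange f
  map_one' := by
    ext X : 2
    apply LinearEquiv.toLinearMap_injective
    exact scalarExt_id f
  map_mul' a b := by
    ext X : 2
    apply LinearEquiv.toLinearMap_injective
    exact scalarExt_comp f (a.app X).toLinearMap (b.app X).toLinearMap

/-- Restriction along a tensor functor `G : B → C`: the family `(φ_X)` goes to `(φ_{G(Y)})`. -/
def restrict {B : Type u₂} [Category.{v₂} B] [MonoidalCategory B] (G : B ⥤ C) [G.LaxMonoidal] :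
    TensorAut F R →* TensorAut (G ⋙ F) R where
  toFun a :=
    { app := fun Y => a.app (G.obj Y)
      naturality := fun f => a.naturality (G.map f)
      tensor := fun Y Z => by
        have h : tensorator (G ⋙ F) R Y Z =
            (F.map (μ G Y Z)).hom.baseChange R ∘ₗ tensorator F R (G.obj Y) (G.obj Z) := by
          refine hom_ext_tmul_tmul fun x y => ?_
          have h1 := tensorator_tmul (G ⋙ F) R Y Z 1 1 x y
          have h2 := tensorator_tmul F R (G.obj Y) (G.obj Z) 1 1 x y
          refine h1.trans ?_
          refine Eq.trans ?_ (congrArg ((F.map (μ G Y Z)).hom.baseChange R) h2).symm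
          simp only [Functor.LaxMonoidal.comp_μ, LinearMap.baseChange_tmul]
          rfl
        rw [h, ← LinearMap.comp_assoc]
        erw [← a.naturality]
        rw [LinearMap.comp_assoc]
        erw [a.tensor]
        rfl
      unit := by
        have h : (1 : R) ⊗ₜ[K] (ε (G ⋙ F)).hom (1 : K) =
            (F.map (ε G)).hom.baseChange R (1 ⊗ₜ (ε F).hom (1 : K)) := by
          simp only [Functor.LaxMonoidal.comp_ε, LinearMap.baseChange_tmul]
          rfl
        have hn := LinearMap.congr_fun (a.naturality (ε G)) (1 ⊗ₜ (ε F).hom (1 : K))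
        rw [LinearMap.comp_apply, LinearMap.comp_apply, LinearEquiv.coe_coe, a.unit] at hn
        exact (congrArg (a.app (G.obj (𝟙_ B))) h).trans (hn.symm.trans h.symm) }
  map_one' := rfl
  map_mul' _ _ := rfl

end TensorAut

/-- The Galois group `Aut^⊗(F)` of a tensor functor `F` to vector spaces: the group-valued functor
on commutative `K`-algebras with `R ↦ Aut^⊗(R ⊗ F)`. -/
def Gal (F : C ⥤ ModuleCat.{u} K) [F.LaxMonoidal] :
    CommAlgCat.{w} K ⥤ GrpCat.{max u₁ u w} where
  obj R := GrpCat.of (TensorAut F R)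
  map f := GrpCat.ofHom (TensorAut.baseChangeHom f.hom)
  map_id _ := by
    ext a : 2
    apply TensorAut.ext
    funext X
    apply LinearEquiv.toLinearMap_injective
    refine hom_ext_one_tmul fun m => ?_
    refine (scalarExt_one_tmul _ _ m).trans ?_
    exact LinearMap.congr_fun (LinearMap.rTensor_id _ _) _
  map_comp f g := by
    ext a : 2
    apply TensorAut.ext
    funext X
    apply LinearEquiv.toLinearMap_injective
    refine hom_ext_one_tmul fun m => ?_
    refine (scalarExt_one_tmul _ _ m).trans ?_
    refine Eq.trans ?_ (scalarExt_one_tmul _ _ m).symm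
    refine Eq.trans ?_ (congrArg _ (scalarExt_one_tmul _ _ m).symm)
    exact LinearMap.congr_fun (LinearMap.rTensor_comp _ g.hom.toLinearMap f.hom.toLinearMap) _

/-- The homomorphism `Aut^⊗(F) → Aut^⊗(F ∘ G)`, `φ ↦ φ ∘ G`. -/
def galRestrict {B : Type u₂} [Category.{v₂} B] [MonoidalCategory B] (G : B ⥤ C) [G.LaxMonoidal]
    (F : C ⥤ ModuleCat.{u} K) [F.LaxMonoidal] :
    Gal.{max w u₁ u₂} F ⟶ Gal.{max w u₁ u₂} (G ⋙ F) where
  app R := GrpCat.ofHom (TensorAut.restrict G)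
  naturality _ _ _ := rfl

end Aut

/-! ### Homomorphisms of group functors -/

section Homs

variable {K : Type u} [Field K] {G₁ G₂ G₃ : CommAlgCat.{w} K ⥤ GrpCat.{v}}

/-- A homomorphism of group functors is surjective if it is an epimorphism of sheaves for the fpqc
topology: every point of the target lifts after a faithfully flat extension of the base. (For affine
group schemes over a field this says that the homomorphism is faithfully flat.) -/
def IsSurjective (p : G₁ ⟶ G₂) : Prop :=
  ∀ (R : CommAlgCat.{w} K) (g : G₂.obj R), ∃ (S : CommAlgCat.{w} K) (f : R ⟶ S),
    f.hom.toRingHom.FaithfullyFlat ∧ ∃ h : G₁.obj S, (p.app S).hom h = (G₂.map f).hom g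

/-- A homomorphism of group functors is injective if it is so on `R`-points for all `R`. -/
def IsInjective (i : G₁ ⟶ G₂) : Prop :=
  ∀ R : CommAlgCat.{w} K, Function.Injective (i.app R).hom

/-- A homomorphism of group functors is trivial if it maps every point to the identity. -/
def IsTrivial (f : G₁ ⟶ G₂) : Prop :=
  ∀ (R : CommAlgCat.{w} K) (g : G₁.obj R), (f.app R).hom g = 1

/-- `Ker p ⊆ Im i`, on `R`-points for all `R`. -/
def KerLeIm (i : G₁ ⟶ G₂) (p : G₂ ⟶ G₃) : Prop :=
  ∀ R : CommAlgCat.{w} K, (p.app R).hom.ker ≤ (i.app R).hom.range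

/-- `1 → G₁ → G₂ → G₃ → 1` is a short exact sequence. -/
structure IsShortExact (i : G₁ ⟶ G₂) (p : G₂ ⟶ G₃) : Prop where
  injective : IsInjective i
  exact : ∀ R : CommAlgCat.{w} K, (p.app R).hom.ker = (i.app R).hom.range
  surjective : IsSurjective p

end Homs

/-! ### Conditions on `A ⊂ C` and `H : C → D` -/

section Assumptions

variable {K : Type u} [Field K]

/-- Every object is a finite direct sum of simple objects. -/
def IsSemisimple (D : TensorCat.{v₁, u, u₁} K) : Prop :=
  ∀ X : D, ∃ (n : ℕ) (S : Fin n → D), (∀ i, Simple (S i)) ∧ Nonempty (X ≅ ⨁ S)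

/-- A full subcategory (given by its objects) of `D` is dense if its pseudo-abelian envelope is all
of `D`: every object of `D` is a direct factor of an object of the subcategory. -/
def IsDense (D : TensorCat.{v₁, u, u₁} K) (P : ObjectProperty D) : Prop :=
  ∀ Y : D, ∃ Z : D, P Z ∧ Nonempty (Retract Y Z)

variable {A : TensorCat.{v₁, u, u₁} K} {C : TensorCat.{v₂, u, u₂} K} {D : TensorCat.{v₃, u, u₃} K}

/-- `H` sends every object of `A` (included in `C` by `J`) to a finite direct sum of copies of the
unit. -/
def AssumptionA1 (J : TensorFunctor A C) (H : TensorFunctor C D) : Prop :=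
  ∀ X : A, ∃ m : ℕ, Nonempty (H.functor.obj (J.functor.obj X) ≅ ⨁ fun _ : Fin m => 𝟙_ D)

/-- `D` is semi-simple and every object of some dense full subcategory of `D` is a quotient of an
object in the image of `H`. -/
def AssumptionA2 (H : TensorFunctor C D) : Prop :=
  IsSemisimple D ∧ ∃ P : ObjectProperty D, IsDense D P ∧
    ∀ Y : D, P Y → ∃ (X : C) (f : H.functor.obj X ⟶ Y), Epi f

/-- The natural transformation `- ⊗ G(1) ⇒ G(H(-))` that corresponds under the adjunction `H ⊣ G` to
`H(X ⊗ G(1)) ≅ H(X) ⊗ HG(1) → H(X) ⊗ 1 ≅ H(X)`, the middle map being `id ⊗ ε_1`. -/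
def projectionMap (H : TensorFunctor C D) {G : D ⥤ C} (adj : H.functor ⊣ G) :
    tensorRight (G.obj (𝟙_ D)) ⟶ H.functor ⋙ G where
  app X := adj.homEquiv (X ⊗ G.obj (𝟙_ D)) (H.functor.obj X) (δ H.functor X (G.obj (𝟙_ D)) ≫
    (H.functor.obj X ◁ adj.counit.app (𝟙_ D)) ≫ (ρ_ (H.functor.obj X)).hom)
  naturality X Y f := by
    change f ▷ _ ≫ _ = _ ≫ G.map (H.functor.map f)
    rw [← adj.homEquiv_naturality_left, ← adj.homEquiv_naturality_right]
    congr 1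
    rw [← Functor.OplaxMonoidal.δ_natural_left_assoc]
    simp only [Category.assoc]
    rw [← rightUnitor_naturality]
    congr 1
    exact (whisker_exchange_assoc _ _ _).symm

/-- `D` is semi-simple and `H` is the left adjoint of a monadic adjunction `H ⊣ G` such that `G(1)`
lies in `A` (included in `C` by `J`) and the natural transformation `- ⊗ G(1) ⇒ G(H(-))` is an
isomorphism. -/
def AssumptionA3 (J : TensorFunctor A C) (H : TensorFunctor C D) : Prop :=
  IsSemisimple D ∧ ∃ (G : D ⥤ C) (adj : H.functor ⊣ G),
    (Monad.comparison adj).IsEquivalence ∧ J.functor.essImage (G.obj (𝟙_ D)) ∧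
      IsIso (projectionMap H adj)

/-- A diagram `{H : C → Dᵢ → D}` of tensor categories and tensor functors indexed by `I`: a
(pseudo)functor `i ↦ Dᵢ`, and functors `Hᵢ : C → Dᵢ` and `Lᵢ : Dᵢ → D` with `Lᵢ Hᵢ ≅ H`, compatible
with the transition functors. All the isomorphisms are monoidal and coherent. -/
structure TensorDiagram (H : TensorFunctor C D) (I : Type u₄) [Category.{v₄} I] where
  /-- The categories `Dᵢ`. -/
  obj : I → TensorCat.{v₅, u, u₅} K
  /-- The transition functors. -/
  map {i j : I} (f : i ⟶ j) : TensorFunctor (obj i) (obj j)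
  /-- The transition functor of an identity is isomorphic to the identity. -/
  mapId (i : I) : (map (𝟙 i)).functor ≅ 𝟭 (obj i)
  mapId_monoidal (i : I) : NatTrans.IsMonoidal (mapId i).hom
  /-- The transition functor of a composite is isomorphic to the composite. -/
  mapComp {i j k : I} (f : i ⟶ j) (g : j ⟶ k) :
    (map (f ≫ g)).functor ≅ (map f).functor ⋙ (map g).functor
  mapComp_monoidal {i j k : I} (f : i ⟶ j) (g : j ⟶ k) : NatTrans.IsMonoidal (mapComp f g).hom
  id_comp {i j : I} (f : i ⟶ j) (X : obj i) :
    (mapComp (𝟙 i) f).hom.app X ≫ (map f).functor.map ((mapId i).hom.app X) =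
      eqToHom (congrArg (fun φ => (map φ).functor.obj X) (Category.id_comp f))
  comp_id {i j : I} (f : i ⟶ j) (X : obj i) :
    (mapComp f (𝟙 j)).hom.app X ≫ (mapId j).hom.app ((map f).functor.obj X) =
      eqToHom (congrArg (fun φ => (map φ).functor.obj X) (Category.comp_id f))
  assoc {i j k l : I} (f : i ⟶ j) (g : j ⟶ k) (h : k ⟶ l) (X : obj i) :
    (mapComp (f ≫ g) h).hom.app X ≫ (map h).functor.map ((mapComp f g).hom.app X) =
      eqToHom (congrArg (fun φ => (map φ).functor.obj X) (Category.assoc f g h)) ≫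
        (mapComp f (g ≫ h)).hom.app X ≫ (mapComp g h).hom.app ((map f).functor.obj X)
  /-- The functors `Hᵢ : C → Dᵢ`. -/
  src (i : I) : TensorFunctor C (obj i)
  /-- Compatibility of the `Hᵢ` with the transition functors. -/
  srcIso {i j : I} (f : i ⟶ j) : (src i).functor ⋙ (map f).functor ≅ (src j).functor
  srcIso_monoidal {i j : I} (f : i ⟶ j) : NatTrans.IsMonoidal (srcIso f).hom
  srcIso_id (i : I) (X : C) :
    (srcIso (𝟙 i)).hom.app X = (mapId i).hom.app ((src i).functor.obj X)
  srcIso_comp {i j k : I} (f : i ⟶ j) (g : j ⟶ k) (X : C) :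
    (srcIso (f ≫ g)).hom.app X = (mapComp f g).hom.app ((src i).functor.obj X) ≫
      (map g).functor.map ((srcIso f).hom.app X) ≫ (srcIso g).hom.app X
  /-- The functors `Lᵢ : Dᵢ → D`. -/
  tgt (i : I) : TensorFunctor (obj i) D
  /-- Compatibility of the `Lᵢ` with the transition functors. -/
  tgtIso {i j : I} (f : i ⟶ j) : (map f).functor ⋙ (tgt j).functor ≅ (tgt i).functor
  tgtIso_monoidal {i j : I} (f : i ⟶ j) : NatTrans.IsMonoidal (tgtIso f).hom
  tgtIso_id (i : I) (X : obj i) :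
    (tgtIso (𝟙 i)).hom.app X = (tgt i).functor.map ((mapId i).hom.app X)
  tgtIso_comp {i j k : I} (f : i ⟶ j) (g : j ⟶ k) (X : obj i) :
    (tgtIso (f ≫ g)).hom.app X = (tgt k).functor.map ((mapComp f g).hom.app X) ≫
      (tgtIso g).hom.app ((map f).functor.obj X) ≫ (tgtIso f).hom.app X
  /-- `Lᵢ Hᵢ ≅ H`. -/
  compIso (i : I) : (src i).functor ⋙ (tgt i).functor ≅ H.functor
  compIso_monoidal (i : I) : NatTrans.IsMonoidal (compIso i).hom
  compIso_naturality {i j : I} (f : i ⟶ j) (X : C) :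
    (tgt j).functor.map ((srcIso f).hom.app X) ≫ (compIso j).hom.app X =
      (tgtIso f).hom.app ((src i).functor.obj X) ≫ (compIso i).hom.app X

/-- For a filtered diagram: the functor `colimᵢ Dᵢ → D` is an equivalence. Objects of the colimit are
objects of the `Dᵢ`, and the morphisms between two objects `X`, `Y` of `Dᵢ` are the elements of the
filtered colimit of the sets of morphisms between their images in `Dⱼ`, over all `i ⟶ j`. -/
structure TensorDiagram.IsColimit {H : TensorFunctor C D} {I : Type u₄} [Category.{v₄} I]
    (Δ : TensorDiagram.{v₂, v₃, v₄, v₅, u, u₂, u₃, u₄, u₅} H I) : Prop where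
  essSurj (Y : D) : ∃ (i : I) (X : Δ.obj i), Nonempty ((Δ.tgt i).functor.obj X ≅ Y)
  full {i : I} {X Y : Δ.obj i}
    (f : (Δ.tgt i).functor.obj X ⟶ (Δ.tgt i).functor.obj Y) :
    ∃ (j : I) (t : i ⟶ j) (g : (Δ.map t).functor.obj X ⟶ (Δ.map t).functor.obj Y),
      (Δ.tgt j).functor.map g ≫ (Δ.tgtIso t).hom.app Y = (Δ.tgtIso t).hom.app X ≫ f
  faithful {i : I} {X Y : Δ.obj i} (f g : X ⟶ Y)
    (h : (Δ.tgt i).functor.map f = (Δ.tgt i).functor.map g) :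
    ∃ (j : I) (t : i ⟶ j), (Δ.map t).functor.map f = (Δ.map t).functor.map g

/-- `D` is the colimit of a filtered diagram `{H : C → Dᵢ → D}` all of whose
functors `Hᵢ : C → Dᵢ` satisfy `AssumptionA3`. -/
def AssumptionA3' (J : TensorFunctor A C) (H : TensorFunctor C D) : Prop :=
  ∃ (I : Type u₄) (_ : Category.{v₄} I) (_ : IsFiltered I)
    (Δ : TensorDiagram.{v₂, v₃, v₄, v₅, u, u₂, u₃, u₄, u₅} H I),
    Δ.IsColimit ∧ ∀ i, AssumptionA3 J (Δ.src i)

end Assumptions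

/-! ### The homomorphisms `I` and `P` -/

section Main

variable {K : Type u} [Field K] {A : TensorCat.{v₁, u, u₁} K} {C : TensorCat.{v₂, u, u₂} K}
  {D : TensorCat.{v₃, u, u₃} K}

/-- `I : Gal(D) → Gal(C)`, `φ ↦ φ ∘ H`. -/
def homI (H : TensorFunctor C D) (ω : FiberFunctor D) :
    Gal.{max w u₂ u₃} ω.functor ⟶ Gal.{max w u₂ u₃} (H.functor ⋙ ω.functor) :=
  galRestrict.{w} H.functor ω.functor

/-- `P : Gal(C) → Gal(A)`, `ψ ↦ ψ|_A`. -/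
def homP (J : TensorFunctor A C) (H : TensorFunctor C D) (ω : FiberFunctor D) :
    Gal.{max w u₁ u₂} (H.functor ⋙ ω.functor) ⟶
      Gal.{max w u₁ u₂} (J.functor ⋙ H.functor ⋙ ω.functor) :=
  galRestrict.{w} J.functor (H.functor ⋙ ω.functor)

end Main

end TannakaSES

end

open TannakaSES

noncomputable section

namespace TannakaSES

/-! ### Monoidal functors to vector spaces, elementwise -/

section Elementwise

variable {K : Type u} [Field K] {C : Type u₂} [Category.{v₂} C]

section

variable (F : C ⥤ ModuleCat.{u} K)

/-! Write `F = ω ∘ H`.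

Surjectivity of `P`. Let `g` be an `R`-point of `Gal(A)`. A tensor automorphism `h` of `F` is
determined by its matrix coefficients `⟨ξ, h y⟩`, and if `h` restricts to `g`, these satisfy linear
relations over `R`: for `f : P ⟶ J(Z) ⊗ Y` and a functional `ζ` on `F(J Z)`, naturality gives `⟨ξ, h
(b p)⟩ = ⟨ξ ∘ b₁, h p⟩`, where `b p` contracts `F(f) p` with the coefficient `⟨ζ, g -⟩` and `b₁` is
the same contraction for `g = 1`. If `ξ ∘ b₁ = 0`, then `b p` is a relation (`rel`). Dividing `R ⊗
F(Y)` by these relations and taking the direct limit over all pairs `(Y, ξ)` gives a commutative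
`R`-algebra `LiftAlg g`, multiplied by tensoring indices, over which `g` has a lift.

The substance is its faithful flatness (`LiftAlg.faithfullyFlat`). It rests on a dichotomy for the
pull-back `φ` of a matrix coefficient of `g` along a morphism of `C`, with `φ₁` its value at `g =
1`: if `φ₁ = 0` then `φ = 0`, and if `φ₁ ≠ 0` then the values of `φ` generate the unit ideal
(`Good.eq_zero`, `Good.span_eq_top`). So `φ` behaves as though it had constant rank. Such functions
are closed under sums and products, hence under minors of the vector-valued functions `b`. The ranks
of the relations are therefore the same as at `g = 1`, where everything is linear algebra over `K`;
Cramer's rule then splits each relation module off `R ⊗ F(Y)` (`exists_projection`). A similar minor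
argument shows that `1` stays outside `m • LiftAlg g` for every maximal ideal `m`
(`exists_functional`).

The dichotomy needs less than closure under subobjects: each subobject of `J(Z)` should have the
same image under `F` as some morphism of `A` (`SubobjectsFrom`). This also follows from the
assumptions for the exact sequence. If `Y ⊆ J(Z)`, then `H(Y)` is a subobject of a sum of units,
hence itself such a sum, so that `Y ⊗ G(𝟙) ≅ G(H Y)` is a sum of copies of `G(𝟙)` and comes from
`A`. Then `F(Y)` is cut out by morphisms of `A`, as the set of `z` with `z ⊗ u ∈ F(Y ⊗ G(𝟙))` for a
nonzero vector `u` (`exists_range_map_eq`).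

Kernel of `P`. By adjunction and the projection formula, a morphism `q : H X ⟶ H X'` is the image of
a morphism `X ⟶ X' ⊗ G(𝟙)` followed by contraction with the counit. An automorphism trivial on `A`
is trivial on `G(𝟙)`, so it commutes with `ω(q)` (`commutes_conj`). As every object of `D` is a
quotient of some `H X`, it descends to an automorphism of `ω` (`exists_extension`). For filtered
diagrams, morphisms and isomorphisms are first brought to a finite stage. The remaining two parts
only use that automorphisms fix the unit and are determined on a cover. -/

theorem map_inv_map_hom {X Y : C} (e : X ≅ Y) (x : F.obj X) :
    (F.map e.inv).hom ((F.map e.hom).hom x) = x := by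
  rw [← LinearMap.comp_apply, ← ModuleCat.hom_comp, ← F.map_comp]; simp

theorem map_hom_map_inv {X Y : C} (e : X ≅ Y) (y : F.obj Y) :
    (F.map e.hom).hom ((F.map e.inv).hom y) = y := by
  rw [← LinearMap.comp_apply, ← ModuleCat.hom_comp, ← F.map_comp]; simp

theorem map_comp_apply {X Y Z : C} (f : X ⟶ Y) (g : Y ⟶ Z) (x : F.obj X) :
    (F.map (f ≫ g)).hom x = (F.map g).hom ((F.map f).hom x) := by
  simp

end

variable [MonoidalCategory C]

/-- The vector `x ⊗ y` of `F(X ⊗ Y)`. -/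
def tm (F : C ⥤ ModuleCat.{u} K) [F.LaxMonoidal] {X Y : C} :
    F.obj X →ₗ[K] F.obj Y →ₗ[K] F.obj (X ⊗ Y) :=
  (TensorProduct.mk K (F.obj X) (F.obj Y)).compr₂ (μ F X Y).hom

/-- The vector `1` of `F(𝟙)`. -/
def unitVec (F : C ⥤ ModuleCat.{u} K) [F.LaxMonoidal] : F.obj (𝟙_ C) :=
  (ε F).hom (1 : K)

variable (F : C ⥤ ModuleCat.{u} K)

section Lax

variable [F.LaxMonoidal]

theorem map_tm {X X' Y Y' : C} (f : X ⟶ X') (g : Y ⟶ Y') (x : F.obj X) (y : F.obj Y) :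
    (F.map (f ⊗ₘ g)).hom (tm F x y) = tm F ((F.map f).hom x) ((F.map g).hom y) :=
  (LinearMap.congr_fun (congrArg ModuleCat.Hom.hom (μ_natural F f g))
    (x ⊗ₜ y : F.obj X ⊗[K] F.obj Y)).symm

theorem map_whiskerLeft_tm {X Y Y' : C} (g : Y ⟶ Y') (x : F.obj X) (y : F.obj Y) :
    (F.map (X ◁ g)).hom (tm F x y) = tm F x ((F.map g).hom y) := by
  rw [← id_tensorHom, map_tm]; simp

theorem map_whiskerRight_tm {X X' Y : C} (f : X ⟶ X') (x : F.obj X) (y : F.obj Y) :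
    (F.map (f ▷ Y)).hom (tm F x y) = tm F ((F.map f).hom x) y := by
  rw [← tensorHom_id, map_tm]; simp

theorem map_associator_hom_tm {X Y Z : C} (x : F.obj X) (y : F.obj Y) (z : F.obj Z) :
    (F.map (α_ X Y Z).hom).hom (tm F (tm F x y) z) = tm F x (tm F y z) :=
  LinearMap.congr_fun (congrArg ModuleCat.Hom.hom (associativity F X Y Z))
    ((x ⊗ₜ y) ⊗ₜ z : (F.obj X ⊗[K] F.obj Y) ⊗[K] F.obj Z)

theorem map_associator_inv_tm {X Y Z : C} (x : F.obj X) (y : F.obj Y) (z : F.obj Z) :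
    (F.map (α_ X Y Z).inv).hom (tm F x (tm F y z)) = tm F (tm F x y) z := by
  rw [← map_associator_hom_tm, map_inv_map_hom]

theorem map_leftUnitor_hom_tm {X : C} (x : F.obj X) :
    (F.map (λ_ X).hom).hom (tm F (unitVec F) x) = x := by
  have h := LinearMap.congr_fun (congrArg ModuleCat.Hom.hom (left_unitality F X))
    ((1 : K) ⊗ₜ x : K ⊗[K] F.obj X)
  refine h.symm.trans ?_
  exact (ModuleCat.MonoidalCategory.leftUnitor_hom_apply (1 : K) x).trans (one_smul K x)

theorem map_rightUnitor_hom_tm {X : C} (x : F.obj X) :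
    (F.map (ρ_ X).hom).hom (tm F x (unitVec F)) = x := by
  have h := LinearMap.congr_fun (congrArg ModuleCat.Hom.hom (right_unitality F X))
    (x ⊗ₜ (1 : K) : F.obj X ⊗[K] K)
  refine h.symm.trans ?_
  exact (ModuleCat.MonoidalCategory.rightUnitor_hom_apply x (1 : K)).trans (one_smul K x)

theorem map_leftUnitor_inv {X : C} (x : F.obj X) :
    (F.map (λ_ X).inv).hom x = tm F (unitVec F) x := by
  conv_lhs => rw [← map_leftUnitor_hom_tm F x]
  rw [map_inv_map_hom]

theorem map_rightUnitor_inv {X : C} (x : F.obj X) :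
    (F.map (ρ_ X).inv).hom x = tm F x (unitVec F) := by
  conv_lhs => rw [← map_rightUnitor_hom_tm F x]
  rw [map_inv_map_hom]

theorem tensorator_one_tmul (R : Type w) [CommRing R] [Algebra K R] {X Y : C} (r s : R)
    (x : F.obj X) (y : F.obj Y) :
    tensorator F R X Y ((r ⊗ₜ x) ⊗ₜ (s ⊗ₜ y)) = (r * s) ⊗ₜ tm F x y :=
  tensorator_tmul F R X Y r s x y

end Lax

section Braided

variable [BraidedCategory C] [F.LaxBraided]

theorem map_braiding_hom_tm {X Y : C} (x : F.obj X) (y : F.obj Y) :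
    (F.map (β_ X Y).hom).hom (tm F x y) = tm F y x :=
  LinearMap.congr_fun (congrArg ModuleCat.Hom.hom (Functor.LaxBraided.braided (F := F) X Y))
    (x ⊗ₜ y : F.obj X ⊗[K] F.obj Y)

theorem map_tensorμ_tm {X₁ X₂ Y₁ Y₂ : C} (x₁ : F.obj X₁) (x₂ : F.obj X₂) (y₁ : F.obj Y₁)
    (y₂ : F.obj Y₂) :
    (F.map (tensorμ X₁ X₂ Y₁ Y₂)).hom (tm F (tm F x₁ x₂) (tm F y₁ y₂)) =
      tm F (tm F x₁ y₁) (tm F x₂ y₂) := by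
  simp only [tensorμ, map_comp_apply, map_associator_hom_tm, map_whiskerLeft_tm,
    map_associator_inv_tm, map_whiskerRight_tm, map_braiding_hom_tm]

end Braided

section Strong

variable [F.Monoidal]

/-- The functional on `F(𝟙)` that sends `1` to `1`. -/
def unitFun : F.obj (𝟙_ C) →ₗ[K] K := (η F).hom

theorem unitFun_unitVec : unitFun F (unitVec F) = 1 :=
  LinearMap.congr_fun (congrArg ModuleCat.Hom.hom (Functor.Monoidal.ε_η F)) (1 : K)

theorem unitFun_smul_unitVec (x : F.obj (𝟙_ C)) : unitFun F x • unitVec F = x := by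
  have h := LinearMap.congr_fun (congrArg ModuleCat.Hom.hom (Functor.Monoidal.η_ε F)) x
  refine Eq.trans ?_ h
  refine ((ε F).hom.map_smul (unitFun F x) (1 : K)).symm.trans ?_
  exact congrArg (ε F).hom ((smul_eq_mul _ _).trans (mul_one _))

/-- As `μ` is invertible, the vectors `x ⊗ y` generate `F(X ⊗ Y)` additively, so identities can be
checked on them. -/
theorem tm_induction {X Y : C} {p : F.obj (X ⊗ Y) → Prop} (z : F.obj (X ⊗ Y))
    (zero : p 0) (tmul : ∀ x y, p (tm F x y)) (add : ∀ a b, p a → p b → p (a + b)) : p z := by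
  have h : (μ F X Y).hom ((δ F X Y).hom z) = z :=
    LinearMap.congr_fun (congrArg ModuleCat.Hom.hom (Functor.Monoidal.δ_μ F X Y)) z
  have key : ∀ t : F.obj X ⊗[K] F.obj Y, p ((μ F X Y).hom t) := by
    intro t
    induction t using TensorProduct.induction_on with
    | zero => exact (map_zero (μ F X Y).hom).symm ▸ zero
    | tmul x y => exact tmul x y
    | add a b ha hb => exact (map_add (μ F X Y).hom a b).symm ▸ add _ _ ha hb
  exact h ▸ key ((δ F X Y).hom z)

theorem linearMap_ext_tm {X Y : C} {N : Type w} [AddCommGroup N] [Module K N]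
    {f g : F.obj (X ⊗ Y) →ₗ[K] N} (h : ∀ x y, f (tm F x y) = g (tm F x y)) : f = g := by
  ext z
  induction z using tm_induction F with
  | zero => simp
  | tmul x y => exact h x y
  | add a b ha hb => simp [ha, hb]

/-- The linear map on `F(X ⊗ Y)` given by a bilinear map on `F(X) × F(Y)`. -/
def tmLift {X Y : C} {N : Type w} [AddCommGroup N] [Module K N]
    (b : F.obj X →ₗ[K] F.obj Y →ₗ[K] N) : F.obj (X ⊗ Y) →ₗ[K] N :=
  TensorProduct.lift b ∘ₗ (δ F X Y).hom

theorem tmLift_tm {X Y : C} {N : Type w} [AddCommGroup N] [Module K N]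
    (b : F.obj X →ₗ[K] F.obj Y →ₗ[K] N) (x : F.obj X) (y : F.obj Y) :
    tmLift F b (tm F x y) = b x y := by
  have h := LinearMap.congr_fun (congrArg ModuleCat.Hom.hom (Functor.Monoidal.μ_δ F X Y))
    (x ⊗ₜ y : F.obj X ⊗[K] F.obj Y)
  exact (congrArg (TensorProduct.lift b) h).trans (TensorProduct.lift.tmul x y)

/-- The tensor product of two linear maps with values in an algebra. -/
def tf {S : Type w} [CommRing S] [Algebra K S] {X Y : C} (φ : F.obj X →ₗ[K] S)
    (ψ : F.obj Y →ₗ[K] S) : F.obj (X ⊗ Y) →ₗ[K] S :=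
  tmLift F ((LinearMap.mul K S).compl₁₂ φ ψ)

theorem tf_tm {S : Type w} [CommRing S] [Algebra K S] {X Y : C} (φ : F.obj X →ₗ[K] S)
    (ψ : F.obj Y →ₗ[K] S) (x : F.obj X) (y : F.obj Y) :
    tf F φ ψ (tm F x y) = φ x * ψ y :=
  tmLift_tm F _ x y

end Strong

/-! ### Duals and finite-dimensionality of the values of a fiber functor. -/

section Duality

variable [F.Monoidal]

/-- The functional on `F(Y)` given by a vector of the dual. -/
def hat {Y : C} [HasLeftDual Y] : F.obj (ᘁY) →ₗ[K] F.obj Y →ₗ[K] K :=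
  ((tm F (X := Y) (Y := ᘁY)).compr₂ (unitFun F ∘ₗ (F.map (ε_ (ᘁY) Y)).hom)).flip

theorem map_evaluation_tm {Y : C} [HasLeftDual Y] (θ : F.obj (ᘁY)) (y : F.obj Y) :
    (F.map (ε_ (ᘁY) Y)).hom (tm F y θ) = hat F θ y • unitVec F :=
  (unitFun_smul_unitVec F _).symm

theorem exists_coevaluation (Y : C) [HasLeftDual Y] :
    ∃ (n : ℕ) (θ : Fin n → F.obj (ᘁY)) (y : Fin n → F.obj Y),
      (F.map (η_ (ᘁY) Y)).hom (unitVec F) = ∑ i, tm F (θ i) (y i) := by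
  induction (F.map (η_ (ᘁY) Y)).hom (unitVec F) using tm_induction F with
  | zero => exact ⟨0, Fin.elim0, Fin.elim0, by simp⟩
  | tmul θ y => exact ⟨1, fun _ => θ, fun _ => y, by simp⟩
  | add a b ha hb =>
    obtain ⟨n, θ, y, h⟩ := ha
    obtain ⟨n', θ', y', h'⟩ := hb
    refine ⟨n + n', Fin.append θ θ', Fin.append y y', ?_⟩
    rw [Fin.sum_univ_add]
    simp [h, h']

/-- One zigzag identity for the dual, evaluated on `z`: the components of the coevaluation form a
finite dual-basis system for `F(Y)`. -/
theorem sum_hat_smul {Y : C} [HasLeftDual Y] {n : ℕ} {θ : Fin n → F.obj (ᘁY)}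
    {y : Fin n → F.obj Y}
    (h : (F.map (η_ (ᘁY) Y)).hom (unitVec F) = ∑ i, tm F (θ i) (y i)) (z : F.obj Y) :
    ∑ i, hat F (θ i) z • y i = z := by
  have hz := congrArg (fun f => (F.map f).hom (tm F z (unitVec F)))
    (ExactPairing.coevaluation_evaluation (ᘁY) Y)
  simp only [map_comp_apply, map_whiskerLeft_tm, h, map_sum, map_associator_inv_tm,
    map_whiskerRight_tm, map_evaluation_tm, map_rightUnitor_hom_tm, map_leftUnitor_inv] at hz
  have h2 := congrArg (F.map (λ_ Y).hom).hom hz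
  simpa [map_leftUnitor_hom_tm] using h2

theorem hat_surjective (Y : C) [HasLeftDual Y] :
    Function.Surjective (hat F : F.obj (ᘁY) →ₗ[K] F.obj Y →ₗ[K] K) := by
  intro l
  obtain ⟨n, θ, y, h⟩ := exists_coevaluation F Y
  refine ⟨∑ i, l (y i) • θ i, ?_⟩
  ext z
  conv_rhs => rw [← sum_hat_smul F h z]
  simp [mul_comm]

theorem finite_obj (Y : C) [HasLeftDual Y] : Module.Finite K (F.obj Y) := by
  obtain ⟨n, θ, y, h⟩ := exists_coevaluation F Y
  refine Module.Finite.of_surjective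
    (Fintype.linearCombination K y : (Fin n → K) →ₗ[K] F.obj Y) fun z => ?_
  exact ⟨fun i => hat F (θ i) z, by
    rw [Fintype.linearCombination_apply]; exact sum_hat_smul F h z⟩

end Duality

end Elementwise

end TannakaSES

end

noncomputable section

namespace TannakaSES

/-! ### Matrix coefficients of a point of `Gal(A)` -/

section ScalarExt

variable {K : Type u} [Field K] {R : Type w} [CommRing R] [Algebra K R]
  {M : Type v₁} [AddCommGroup M] [Module K M] {N : Type v₂} [AddCommGroup N] [Module K N]

variable (R) in
/-- The `R`-linear extension of a functional. -/
def scal (ζ : M →ₗ[K] K) : R ⊗[K] M →ₗ[R] R :=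
  LinearMap.liftBaseChange R (Algebra.linearMap K R ∘ₗ ζ)

theorem scal_tmul (ζ : M →ₗ[K] K) (r : R) (m : M) :
    scal R ζ (r ⊗ₜ m) = r * algebraMap K R (ζ m) := by
  simp [scal]

theorem scal_baseChange (ζ : N →ₗ[K] K) (f : M →ₗ[K] N) (v : R ⊗[K] M) :
    scal R ζ (f.baseChange R v) = scal R (ζ ∘ₗ f) v := by
  induction v using TensorProduct.induction_on with
  | zero => simp
  | tmul r m => simp [scal_tmul]
  | add a b ha hb => simp [ha, hb]

theorem scal_add (ζ ζ' : M →ₗ[K] K) (v : R ⊗[K] M) :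
    scal R (ζ + ζ') v = scal R ζ v + scal R ζ' v := by
  induction v using TensorProduct.induction_on with
  | zero => simp
  | tmul r m => simp [scal_tmul, mul_add]
  | add a b ha hb => simp only [map_add, ha, hb]; ring

theorem scal_smul (c : K) (ζ : M →ₗ[K] K) (v : R ⊗[K] M) :
    scal R (c • ζ) v = algebraMap K R c * scal R ζ v := by
  induction v using TensorProduct.induction_on with
  | zero => simp
  | tmul r m => simp [scal_tmul]; ring
  | add a b ha hb => simp only [map_add, ha, hb]; ring

theorem scal_zero (v : R ⊗[K] M) : scal R (0 : M →ₗ[K] K) v = 0 := by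
  simp [scal]

/-- The coordinates of `v` in a base-changed `K`-basis are its pairings with the `K`-rational
coordinate functionals. -/
theorem eq_of_scal_eq [Module.Finite K M] {v v' : R ⊗[K] M}
    (h : ∀ ζ : M →ₗ[K] K, scal R ζ v = scal R ζ v') : v = v' := by
  let b := Module.finBasis K M
  let B : Module.Basis _ R (R ⊗[K] M) := b.baseChange R
  refine B.ext_elem fun i => ?_
  have key : ∀ v : R ⊗[K] M, B.repr v i = scal R (b.coord i) v := by
    intro v
    induction v using TensorProduct.induction_on with
    | zero => simp
    | tmul r m => simp [scal_tmul, B, Algebra.smul_def, mul_comm]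
    | add a b ha hb => simp only [map_add, Finsupp.add_apply, ha, hb]
  rw [key, key, h]

end ScalarExt

section Coeff

variable {K : Type u} [Field K] {A : Type u₁} [Category.{v₁} A] [MonoidalCategory A]
  {C : Type u₂} [Category.{v₂} C] [MonoidalCategory C] {J : A ⥤ C} [J.Monoidal]
  {F : C ⥤ ModuleCat.{u} K} [F.Monoidal] {R : Type w} [CommRing R] [Algebra K R]
  (g : TensorAut (J ⋙ F) R)

/-- The components of a point of `Aut^⊗(F ∘ J)`. -/
def gl (Z : A) : R ⊗[K] F.obj (J.obj Z) →ₗ[R] R ⊗[K] F.obj (J.obj Z) :=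
  (g.app Z).toLinearMap

theorem gl_surjective (Z : A) : Function.Surjective (gl g Z) := (g.app Z).surjective

theorem gl_naturality {Z Z' : A} (s : Z ⟶ Z') (v : R ⊗[K] F.obj (J.obj Z)) :
    gl g Z' ((F.map (J.map s)).hom.baseChange R v) =
      (F.map (J.map s)).hom.baseChange R (gl g Z v) :=
  (LinearMap.congr_fun (g.naturality s) v).symm

theorem tensorator_comp (Z Z' : A) :
    tensorator (J ⋙ F) R Z Z' =
      (F.map (μ J Z Z')).hom.baseChange R ∘ₗ tensorator F R (J.obj Z) (J.obj Z') := by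
  refine hom_ext_tmul_tmul fun x y => ?_
  refine (tensorator_tmul (J ⋙ F) R Z Z' 1 1 x y).trans ?_
  refine Eq.trans ?_ (congrArg ((F.map (μ J Z Z')).hom.baseChange R)
    (tensorator_tmul F R (J.obj Z) (J.obj Z') 1 1 x y)).symm
  simp only [Functor.LaxMonoidal.comp_μ, LinearMap.baseChange_tmul]
  rfl

theorem gl_tensor (Z Z' : A) (a : R ⊗[K] F.obj (J.obj Z)) (b : R ⊗[K] F.obj (J.obj Z')) :
    gl g (Z ⊗ Z') ((F.map (μ J Z Z')).hom.baseChange R (tensorator F R _ _ (a ⊗ₜ b))) =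
      (F.map (μ J Z Z')).hom.baseChange R (tensorator F R _ _ (gl g Z a ⊗ₜ gl g Z' b)) := by
  have h := LinearMap.congr_fun (g.tensor Z Z') (a ⊗ₜ b)
  have h1 := LinearMap.congr_fun (tensorator_comp (J := J) (F := F) (R := R) Z Z') (a ⊗ₜ b)
  have h2 := LinearMap.congr_fun (tensorator_comp (J := J) (F := F) (R := R) Z Z')
    (gl g Z a ⊗ₜ gl g Z' b)
  exact (congrArg (gl g (Z ⊗ Z')) h1.symm).trans (h.trans h2)

theorem gl_unit : gl g (𝟙_ A) (1 ⊗ₜ (F.map (ε J)).hom (unitVec F)) =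
    1 ⊗ₜ (F.map (ε J)).hom (unitVec F) := by
  have h : (ε (J ⋙ F)).hom (1 : K) = (F.map (ε J)).hom (unitVec F) := by
    rw [Functor.LaxMonoidal.comp_ε]; rfl
  have h2 := g.unit
  rw [h] at h2
  exact h2

/-- The matrix coefficient `z ↦ ⟨ζ, g z⟩`. -/
def coeff (Z : A) (ζ : F.obj (J.obj Z) →ₗ[K] K) : F.obj (J.obj Z) →ₗ[K] R :=
  ((scal R ζ ∘ₗ gl g Z).restrictScalars K) ∘ₗ TensorProduct.mk K R _ 1

theorem coeff_apply (Z : A) (ζ : F.obj (J.obj Z) →ₗ[K] K) (z : F.obj (J.obj Z)) :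
    coeff g Z ζ z = scal R ζ (gl g Z (1 ⊗ₜ z)) := rfl

theorem coeff_map {Z Z' : A} (s : Z ⟶ Z') (ζ : F.obj (J.obj Z') →ₗ[K] K)
    (z : F.obj (J.obj Z)) :
    coeff g Z' ζ ((F.map (J.map s)).hom z) = coeff g Z (ζ ∘ₗ (F.map (J.map s)).hom) z := by
  rw [coeff_apply, coeff_apply, ← scal_baseChange, ← gl_naturality]
  simp

theorem coeff_add (Z : A) (ζ ζ' : F.obj (J.obj Z) →ₗ[K] K) :
    coeff g Z (ζ + ζ') = coeff g Z ζ + coeff g Z ζ' := by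
  ext z; simp [coeff_apply, scal_add]

theorem coeff_smul (Z : A) (c : K) (ζ : F.obj (J.obj Z) →ₗ[K] K) :
    coeff g Z (c • ζ) = c • coeff g Z ζ := by
  ext z; simp [coeff_apply, scal_smul, Algebra.smul_def]

theorem coeff_zero (Z : A) : coeff g Z (0 : F.obj (J.obj Z) →ₗ[K] K) = 0 := by
  ext z; simp [coeff_apply, scal_zero]

theorem scal_tf_tensorator {X Y : C} (ζ : F.obj X →ₗ[K] K) (ξ : F.obj Y →ₗ[K] K)
    (a : R ⊗[K] F.obj X) (b : R ⊗[K] F.obj Y) :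
    scal R (tf F ζ ξ) (tensorator F R X Y (a ⊗ₜ b)) = scal R ζ a * scal R ξ b := by
  induction a using TensorProduct.induction_on with
  | zero => simp
  | add a a' ha ha' => simp only [TensorProduct.add_tmul, map_add, ha, ha', add_mul]
  | tmul r x =>
    induction b using TensorProduct.induction_on with
    | zero => simp
    | add b b' hb hb' => simp only [TensorProduct.tmul_add, map_add, hb, hb', mul_add]
    | tmul s y =>
      rw [tensorator_one_tmul, scal_tmul, scal_tmul, scal_tmul, tf_tm, map_mul]
      ring

/-- `Good g φ φ₁`: the function `φ` on `F(P)` is the pull-back of a matrix coefficient of `g` along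
a morphism from `P` to an object of `A`, and `φ₁` is the same function for `g = 1`. -/
def Good {P : C} (φ : F.obj P →ₗ[K] R) (φ₁ : F.obj P →ₗ[K] K) : Prop :=
  ∃ (Z : A) (f : P ⟶ J.obj Z) (ζ : F.obj (J.obj Z) →ₗ[K] K),
    φ = coeff g Z ζ ∘ₗ (F.map f).hom ∧ φ₁ = ζ ∘ₗ (F.map f).hom

variable {g}

theorem Good.comp {P Q : C} {φ : F.obj P →ₗ[K] R} {φ₁ : F.obj P →ₗ[K] K} (h : Good g φ φ₁)
    (q : Q ⟶ P) : Good g (φ ∘ₗ (F.map q).hom) (φ₁ ∘ₗ (F.map q).hom) := by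
  obtain ⟨Z, f, ζ, rfl, rfl⟩ := h
  exact ⟨Z, q ≫ f, ζ, by ext; simp, by ext; simp⟩

theorem Good.smul {P : C} {φ : F.obj P →ₗ[K] R} {φ₁ : F.obj P →ₗ[K] K} (h : Good g φ φ₁)
    (c : K) : Good g (c • φ) (c • φ₁) := by
  obtain ⟨Z, f, ζ, rfl, rfl⟩ := h
  exact ⟨Z, f, c • ζ, by rw [coeff_smul]; rfl, rfl⟩

/-- Since `g` is monoidal, the product of coefficients on `Z` and `Z'` is a coefficient on `Z ⊗ Z'`,
for the functional `ζ ⊗ ζ'` transported along `δ`. -/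
theorem Good.mul {P Q : C} {φ : F.obj P →ₗ[K] R} {φ₁ : F.obj P →ₗ[K] K}
    {ψ : F.obj Q →ₗ[K] R} {ψ₁ : F.obj Q →ₗ[K] K} (h : Good g φ φ₁) (h' : Good g ψ ψ₁) :
    Good g (tf F φ ψ) (tf F φ₁ ψ₁) := by
  obtain ⟨Z, f, ζ, rfl, rfl⟩ := h
  obtain ⟨Z', f', ζ', rfl, rfl⟩ := h'
  have hδ : ∀ w, (F.map (δ J Z Z')).hom ((F.map (μ J Z Z')).hom w) = w := fun w => by
    rw [← map_comp_apply, Functor.Monoidal.μ_δ]; simp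
  refine ⟨Z ⊗ Z', (f ⊗ₘ f') ≫ μ J Z Z', tf F ζ ζ' ∘ₗ (F.map (δ J Z Z')).hom, ?_, ?_⟩
  · refine linearMap_ext_tm F fun x y => ?_
    have h1 : (1 : R) ⊗ₜ[K] (F.map (μ J Z Z')).hom (tm F ((F.map f).hom x) ((F.map f').hom y)) =
        (F.map (μ J Z Z')).hom.baseChange R (tensorator F R _ _
          ((1 ⊗ₜ (F.map f).hom x) ⊗ₜ (1 ⊗ₜ (F.map f').hom y))) := by
      rw [tensorator_one_tmul]; simp
    rw [tf_tm, LinearMap.comp_apply, LinearMap.comp_apply, LinearMap.comp_apply, map_comp_apply,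
      map_tm, coeff_apply g (Z ⊗ Z'), h1, gl_tensor, scal_baseChange]
    have h2 : (tf F ζ ζ' ∘ₗ (F.map (δ J Z Z')).hom) ∘ₗ (F.map (μ J Z Z')).hom = tf F ζ ζ' :=
      LinearMap.ext fun w => congrArg (tf F ζ ζ') (hδ w)
    rw [h2, scal_tf_tensorator]
    rfl
  · refine linearMap_ext_tm F fun x y => ?_
    simp only [LinearMap.comp_apply]
    rw [map_comp_apply, hδ, map_tm, tf_tm, tf_tm]
    rfl

variable (g) in
theorem Good.const {P : C} (e : P ⟶ 𝟙_ C) :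
    Good g (Algebra.linearMap K R ∘ₗ unitFun F ∘ₗ (F.map e).hom) (unitFun F ∘ₗ (F.map e).hom) := by
  have hη : ∀ w, (F.map (η J)).hom ((F.map (ε J)).hom w) = w := fun w => by
    rw [← map_comp_apply, Functor.Monoidal.ε_η]; simp
  refine ⟨𝟙_ A, e ≫ ε J, unitFun F ∘ₗ (F.map (η J)).hom, ?_, ?_⟩
  · ext p
    simp only [LinearMap.comp_apply]
    rw [map_comp_apply, ← unitFun_smul_unitVec F ((F.map e).hom p), map_smul, map_smul,
      map_smul, map_smul, coeff_apply, gl_unit, scal_tmul, LinearMap.comp_apply, hη, unitFun_unitVec]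
    simp [Algebra.smul_def]
  · ext p
    simp only [LinearMap.comp_apply]
    rw [map_comp_apply, hη]

/-! ### Pulled-back coefficients vanish or generate the unit ideal. -/

section Dichotomy

variable [Abelian C] [PreservesFiniteColimits F]

/-- Every subobject of an object of `A` has the same image under `F` as a morphism of `A`. -/
def SubobjectsFrom (J : A ⥤ C) (F : C ⥤ ModuleCat.{u} K) : Prop :=
  ∀ (Z : A) (Y : C) (i : Y ⟶ J.obj Z), Mono i → ∃ (Z' : A) (s : Z' ⟶ Z),
    LinearMap.range (F.map (J.map s)).hom = LinearMap.range (F.map i).hom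

/-- The hypothesis is applied to the image of `f`; right exactness of `F` makes `F(P)` surject onto
the value of `F` at that image. -/
theorem SubobjectsFrom.exists_range_eq (h : SubobjectsFrom J F) {P : C} {Z : A}
    (f : P ⟶ J.obj Z) : ∃ (Z' : A) (s : Z' ⟶ Z),
      LinearMap.range (F.map (J.map s)).hom = LinearMap.range (F.map f).hom := by
  obtain ⟨Z', s, hs⟩ := h Z _ (image.ι f) inferInstance
  refine ⟨Z', s, hs.trans ?_⟩
  have hsurj : Function.Surjective (F.map (factorThruImage f)).hom :=
    (ModuleCat.epi_iff_surjective _).1 inferInstance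
  conv_rhs => rw [← image.fac f, F.map_comp, ModuleCat.hom_comp, LinearMap.range_comp,
    LinearMap.range_eq_top.2 hsurj, Submodule.map_top]

/-- The image of `F(f)` is also the image of a morphism `s` of `A`, with which `g` commutes. So if
`ζ` vanishes on this image, it still does after applying `g`. -/
theorem Good.eq_zero (hsub : SubobjectsFrom J F) {P : C} {φ : F.obj P →ₗ[K] R}
    {φ₁ : F.obj P →ₗ[K] K} (h : Good g φ φ₁) (h₁ : φ₁ = 0) : φ = 0 := by
  obtain ⟨Z, f, ζ, rfl, rfl⟩ := h
  obtain ⟨Z', s, hs⟩ := hsub.exists_range_eq f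
  have h0 : ζ ∘ₗ (F.map (J.map s)).hom = 0 := by
    ext z
    have hz : (F.map (J.map s)).hom z ∈ LinearMap.range (F.map f).hom := hs ▸ ⟨z, rfl⟩
    obtain ⟨p, hp⟩ := hz
    rw [LinearMap.comp_apply, ← hp]
    exact LinearMap.congr_fun h₁ p
  ext p
  have hp : (F.map f).hom p ∈ LinearMap.range (F.map (J.map s)).hom := hs ▸ ⟨p, rfl⟩
  obtain ⟨z, hz⟩ := hp
  rw [LinearMap.comp_apply, ← hz, coeff_map, h0, coeff_zero]
  rfl

/-- On the source `Z'` of a morphism of `A` with the same image as `F(f)`, the component of `g` is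
surjective; hence `⟨ζ', g -⟩` takes the value `1` as soon as `ζ' ≠ 0`. -/
theorem Good.span_eq_top (hsub : SubobjectsFrom J F) {P : C} {φ : F.obj P →ₗ[K] R}
    {φ₁ : F.obj P →ₗ[K] K} (h : Good g φ φ₁) (h₁ : φ₁ ≠ 0) :
    Ideal.span (Set.range φ) = ⊤ := by
  obtain ⟨Z, f, ζ, rfl, rfl⟩ := h
  obtain ⟨Z', s, hs⟩ := hsub.exists_range_eq f
  obtain ⟨p, hp⟩ := DFunLike.ne_iff.1 h₁
  have hp' : (F.map f).hom p ∈ LinearMap.range (F.map (J.map s)).hom := hs ▸ ⟨p, rfl⟩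
  obtain ⟨z, hz⟩ := hp'
  set ζ' := ζ ∘ₗ (F.map (J.map s)).hom with hζ'
  have hz0 : ζ' z ≠ 0 := by
    rw [hζ', LinearMap.comp_apply, hz]; exact hp
  -- Equality of the two images turns each value of the coefficient on `Z'` at `1 ⊗ m` into a value
  -- of the given function; `R`-linearity does the rest.
  have key : ∀ v : R ⊗[K] F.obj (J.obj Z'), scal R ζ' (gl g Z' v) ∈
      Ideal.span (Set.range (coeff g Z ζ ∘ₗ (F.map f).hom)) := by
    intro v
    induction v using TensorProduct.induction_on with
    | zero => simp
    | add a b ha hb => simp only [map_add]; exact add_mem ha hb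
    | tmul r m =>
      have hm : (F.map (J.map s)).hom m ∈ LinearMap.range (F.map f).hom := hs ▸ ⟨m, rfl⟩
      obtain ⟨q, hq⟩ := hm
      have : r ⊗ₜ[K] m = r • ((1 : R) ⊗ₜ[K] m) := by simp [TensorProduct.smul_tmul']
      rw [this, map_smul, map_smul, ← coeff_apply, hζ', ← coeff_map, ← hq]
      exact Ideal.mul_mem_left _ _ (Ideal.subset_span ⟨q, rfl⟩)
  -- The vector is scaled so that `ζ'` takes the value `1` on it.
  obtain ⟨v, hv⟩ := gl_surjective g Z' (1 ⊗ₜ ((ζ' z)⁻¹ • z))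
  have := key v
  rw [hv, scal_tmul, map_smul, smul_eq_mul, inv_mul_cancel₀ hz0, map_one, one_mul] at this
  exact (Ideal.eq_top_iff_one _).2 this

end Dichotomy

section Additive

variable [Preadditive C] [F.Additive]

theorem Good.zero (P : C) : Good g (0 : F.obj P →ₗ[K] R) 0 :=
  ⟨𝟙_ A, 0, 0, by simp, by simp⟩

variable [Preadditive A] [HasBinaryBiproducts A] [J.Additive]

/-- A sum of two coefficients is one coefficient on the biproduct `Z ⊞ Z'`. -/
theorem Good.add {P : C} {φ ψ : F.obj P →ₗ[K] R} {φ₁ ψ₁ : F.obj P →ₗ[K] K}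
    (h : Good g φ φ₁) (h' : Good g ψ ψ₁) : Good g (φ + ψ) (φ₁ + ψ₁) := by
  obtain ⟨Z, f, ζ, rfl, rfl⟩ := h
  obtain ⟨Z', f', ζ', rfl, rfl⟩ := h'
  have e1 : (f ≫ J.map biprod.inl + f' ≫ J.map biprod.inr) ≫ J.map (biprod.fst : Z ⊞ Z' ⟶ Z) = f := by
    simp [Preadditive.add_comp, ← J.map_comp]
  have e2 : (f ≫ J.map biprod.inl + f' ≫ J.map biprod.inr) ≫ J.map (biprod.snd : Z ⊞ Z' ⟶ Z') = f' := by
    simp [Preadditive.add_comp, ← J.map_comp]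
  refine ⟨Z ⊞ Z', f ≫ J.map biprod.inl + f' ≫ J.map biprod.inr,
    ζ ∘ₗ (F.map (J.map biprod.fst)).hom + ζ' ∘ₗ (F.map (J.map biprod.snd)).hom, ?_, ?_⟩
  · ext p
    simp only [coeff_add, LinearMap.add_apply, LinearMap.comp_apply, ← coeff_map]
    rw [← map_comp_apply, ← map_comp_apply, e1, e2]
  · ext p
    simp only [LinearMap.add_apply, LinearMap.comp_apply]
    rw [← map_comp_apply, ← map_comp_apply, e1, e2]

theorem Good.sum {P : C} {ι : Type*} (s : Finset ι) {φ : ι → F.obj P →ₗ[K] R}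
    {φ₁ : ι → F.obj P →ₗ[K] K} (h : ∀ i ∈ s, Good g (φ i) (φ₁ i)) :
    Good g (∑ i ∈ s, φ i) (∑ i ∈ s, φ₁ i) := by
  classical
  induction s using Finset.induction_on with
  | empty => simpa using Good.zero P
  | insert a s ha ih =>
    rw [Finset.sum_insert ha, Finset.sum_insert ha]
    exact (h a (Finset.mem_insert_self a s)).add
      (ih fun i hi => h i (Finset.mem_insert_of_mem hi))

end Additive

end Coeff

end TannakaSES

end

noncomputable section

namespace TannakaSES

/-! ### Tensor powers -/

section Powers

variable {K : Type u} [Field K] {C : Type u₂} [Category.{v₂} C] [MonoidalCategory C]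

/-- The tensor powers of an object. -/
def pw (X : C) : ℕ → C
  | 0 => 𝟙_ C
  | n + 1 => X ⊗ pw X n

variable (F : C ⥤ ModuleCat.{u} K)

/-- The decomposable vectors of `F(X^{⊗ n})`. -/
def pure [F.LaxMonoidal] {X : C} : (n : ℕ) → (Fin n → F.obj X) → F.obj (pw X n)
  | 0, _ => unitVec F
  | n + 1, x => tm F (x 0) (pure n (Fin.tail x))

theorem span_range_tm [F.Monoidal] {X Y : C} {ι κ : Type*} {x : ι → F.obj X} {y : κ → F.obj Y}
    (hx : Submodule.span K (Set.range x) = ⊤) (hy : Submodule.span K (Set.range y) = ⊤) :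
    Submodule.span K (Set.range fun p : ι × κ => tm F (x p.1) (y p.2)) = ⊤ := by
  refine eq_top_iff.2 fun z _ => ?_
  induction z using tm_induction F with
  | zero => exact zero_mem _
  | add a b ha hb => exact add_mem (ha trivial) (hb trivial)
  | tmul a b =>
    have ha : a ∈ Submodule.span K (Set.range x) := hx ▸ trivial
    have hb : b ∈ Submodule.span K (Set.range y) := hy ▸ trivial
    have h := Submodule.apply_mem_map₂ (tm F) ha hb
    rw [Submodule.map₂_span_span] at h
    refine Submodule.span_mono ?_ h
    rintro _ ⟨_, ⟨i, rfl⟩, _, ⟨k, rfl⟩, rfl⟩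
    exact ⟨(i, k), rfl⟩

theorem span_range_unitVec [F.Monoidal] {ι : Type*} [Nonempty ι] :
    Submodule.span K (Set.range fun _ : ι => unitVec F) = ⊤ := by
  refine eq_top_iff.2 fun z _ => ?_
  rw [← unitFun_smul_unitVec F z]
  exact Submodule.smul_mem _ _ (Submodule.subset_span ⟨Classical.arbitrary ι, rfl⟩)

theorem span_range_pure [F.Monoidal] (X : C) (n : ℕ) :
    Submodule.span K (Set.range (pure F (X := X) n)) = ⊤ := by
  induction n with
  | zero => exact span_range_unitVec F
  | succ n ih =>
    have hid : Submodule.span K (Set.range (id : F.obj X → F.obj X)) = ⊤ := by simp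
    refine eq_top_iff.2 ((span_range_tm F hid ih).ge.trans (Submodule.span_mono ?_))
    rintro _ ⟨⟨a, b⟩, rfl⟩
    exact ⟨Fin.cons a b, by simp only [pure, Fin.tail_cons, Fin.cons_zero]; rfl⟩

/-- Realizes by braidings the permutation that brings the `i`-th tensor factor to the front and
keeps the order of the others. It makes each term of a Laplace expansion a pull-back along a
morphism of `C`. -/
theorem exists_front [BraidedCategory C] [F.LaxBraided] (X : C) (n : ℕ) (i : Fin (n + 1)) :
    ∃ f : X ⊗ pw X n ⟶ X ⊗ pw X n, ∀ x : Fin (n + 1) → F.obj X,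
      (F.map f).hom (tm F (x 0) (pure F n (Fin.tail x))) =
        tm F (x i) (pure F n (x ∘ i.succAbove)) := by
  induction n with
  | zero =>
    obtain rfl : i = 0 := Fin.fin_one_eq_zero i
    exact ⟨𝟙 _, fun x => by simp [pure]⟩
  | succ n ih =>
    refine Fin.cases ⟨𝟙 _, fun x => ?_⟩ (fun j => ?_) i
    · rw [F.map_id]; rfl
    · obtain ⟨f, hf⟩ := ih j
      let f' : X ⊗ pw X (n + 1) ⟶ X ⊗ pw X (n + 1) :=
        X ◁ f ≫ (α_ X X (pw X n)).inv ≫ (β_ X X).hom ▷ pw X n ≫ (α_ X X (pw X n)).hom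
      refine ⟨f', fun x => ?_⟩
      have h : (F.map (X ◁ f ≫ (α_ X X (pw X n)).inv ≫ (β_ X X).hom ▷ pw X n ≫
          (α_ X X (pw X n)).hom)).hom
          (tm F (x 0) (tm F (Fin.tail x 0) (pure F n (Fin.tail (Fin.tail x))))) =
          tm F (x j.succ) (tm F (x 0) (pure F n (Fin.tail x ∘ j.succAbove))) := by
        rw [map_comp_apply, map_comp_apply, map_comp_apply, map_whiskerLeft_tm, hf,
          map_associator_inv_tm, map_whiskerRight_tm, map_braiding_hom_tm, map_associator_hom_tm]
        rfl
      refine h.trans (congrArg (tm F (x j.succ)) ?_)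
      change _ = tm F (x (j.succ.succAbove 0)) (pure F n (Fin.tail (x ∘ j.succ.succAbove)))
      rw [Fin.succ_succAbove_zero]
      refine congrArg (tm F (x 0)) (congrArg (pure F n) ?_)
      funext k
      simp [Fin.tail, Fin.succ_succAbove_succ]

end Powers

/-! ### Vector-valued matrix coefficients -/

section VGood

variable {K : Type u} [Field K] {A : Type u₁} [Category.{v₁} A] [MonoidalCategory A]
  {C : Type u₂} [Category.{v₂} C] [MonoidalCategory C] {J : A ⥤ C} [J.Monoidal]
  {F : C ⥤ ModuleCat.{u} K} [F.Monoidal] {R : Type w} [CommRing R] [Algebra K R]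

/-- Contraction of the first factor of `F(X ⊗ Y)` with a function. -/
def contr {X Y : C} (φ : F.obj X →ₗ[K] R) : F.obj (X ⊗ Y) →ₗ[K] R ⊗[K] F.obj Y :=
  tmLift F (TensorProduct.mk K R (F.obj Y) ∘ₗ φ)

theorem contr_tm {X Y : C} (φ : F.obj X →ₗ[K] R) (x : F.obj X) (y : F.obj Y) :
    contr φ (tm F x y) = φ x ⊗ₜ y := tmLift_tm F _ x y

/-- Contraction of the first factor of `F(X ⊗ Y)` with a functional. -/
def contr₁ {X Y : C} (ζ : F.obj X →ₗ[K] K) : F.obj (X ⊗ Y) →ₗ[K] F.obj Y :=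
  tmLift F (LinearMap.lsmul K (F.obj Y) ∘ₗ ζ)

theorem contr₁_tm {X Y : C} (ζ : F.obj X →ₗ[K] K) (x : F.obj X) (y : F.obj Y) :
    contr₁ ζ (tm F x y) = ζ x • y := tmLift_tm F _ x y

variable (g : TensorAut (J ⋙ F) R)

/-- The vector-valued analogue of `Good`: functions on `F(P)` with values in `R ⊗ F(Y)`, and their
specializations at `g = 1`. -/
def VGood {P Y : C} (b : F.obj P →ₗ[K] R ⊗[K] F.obj Y) (b₁ : F.obj P →ₗ[K] F.obj Y) : Prop :=
  ∃ (Z : A) (f : P ⟶ J.obj Z ⊗ Y) (ζ : F.obj (J.obj Z) →ₗ[K] K),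
    b = contr (coeff g Z ζ) ∘ₗ (F.map f).hom ∧ b₁ = contr₁ ζ ∘ₗ (F.map f).hom

/-- The target is `F(𝟙)`: a scalar coefficient of `g` seen as a vector-valued function. It later
forces the universal lift to restrict to `g`. -/
theorem VGood.of_coeff (Z : A) (ζ : F.obj (J.obj Z) →ₗ[K] K) :
    VGood g ((TensorProduct.mk K R _).flip (unitVec F) ∘ₗ coeff g Z ζ)
      (LinearMap.toSpanSingleton K _ (unitVec F) ∘ₗ ζ) := by
  refine ⟨Z, (ρ_ _).inv, ζ, ?_, ?_⟩
  · ext z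
    rw [LinearMap.comp_apply, LinearMap.comp_apply, map_rightUnitor_inv, contr_tm]
    rfl
  · ext z
    rw [LinearMap.comp_apply, LinearMap.comp_apply, map_rightUnitor_inv, contr₁_tm]
    rfl

/-- Contracting with the unit of `A`, on which `g` is trivial, gives a function that does not depend
on `g`. Thus naturality in `C` is among the relations. -/
theorem VGood.of_hom {P Y : C} (f : P ⟶ Y) :
    VGood g (TensorProduct.mk K R _ 1 ∘ₗ (F.map f).hom) (F.map f).hom := by
  have hη : ∀ w, (F.map (η J)).hom ((F.map (ε J)).hom w) = w := fun w => by
    rw [← map_comp_apply, Functor.Monoidal.ε_η]; simp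
  refine ⟨𝟙_ A, f ≫ (λ_ Y).inv ≫ ε J ▷ Y, unitFun F ∘ₗ (F.map (η J)).hom, ?_, ?_⟩
  · ext p
    simp only [LinearMap.comp_apply]
    rw [map_comp_apply, map_comp_apply, map_leftUnitor_inv, map_whiskerRight_tm, contr_tm,
      coeff_apply, gl_unit, scal_tmul, LinearMap.comp_apply, hη, unitFun_unitVec]
    simp
  · ext p
    simp only [LinearMap.comp_apply]
    rw [map_comp_apply, map_comp_apply, map_leftUnitor_inv, map_whiskerRight_tm, contr₁_tm,
      LinearMap.comp_apply, hη, unitFun_unitVec, one_smul]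

variable {g}

theorem VGood.comp {P Q Y : C} {b : F.obj P →ₗ[K] R ⊗[K] F.obj Y} {b₁ : F.obj P →ₗ[K] F.obj Y}
    (h : VGood g b b₁) (q : Q ⟶ P) :
    VGood g (b ∘ₗ (F.map q).hom) (b₁ ∘ₗ (F.map q).hom) := by
  obtain ⟨Z, f, ζ, rfl, rfl⟩ := h
  exact ⟨Z, q ≫ f, ζ, by ext; simp, by ext; simp⟩

theorem contr_map {X Y Y' : C} (φ : F.obj X →ₗ[K] R) (f : Y ⟶ Y') (w : F.obj (X ⊗ Y)) :
    contr φ ((F.map (X ◁ f)).hom w) = (F.map f).hom.baseChange R (contr φ w) := by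
  induction w using tm_induction F with
  | zero => simp
  | add a b ha hb => simp only [map_add, ha, hb]
  | tmul x y => rw [map_whiskerLeft_tm, contr_tm, contr_tm, LinearMap.baseChange_tmul]

theorem contr₁_map {X Y Y' : C} (ζ : F.obj X →ₗ[K] K) (f : Y ⟶ Y') (w : F.obj (X ⊗ Y)) :
    contr₁ ζ ((F.map (X ◁ f)).hom w) = (F.map f).hom (contr₁ ζ w) := by
  induction w using tm_induction F with
  | zero => simp
  | add a b ha hb => simp only [map_add, ha, hb]
  | tmul x y => rw [map_whiskerLeft_tm, contr₁_tm, contr₁_tm, map_smul]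

theorem VGood.map {P Y Y' : C} {b : F.obj P →ₗ[K] R ⊗[K] F.obj Y}
    {b₁ : F.obj P →ₗ[K] F.obj Y} (h : VGood g b b₁) (f : Y ⟶ Y') :
    VGood g (((F.map f).hom.baseChange R).restrictScalars K ∘ₗ b) ((F.map f).hom ∘ₗ b₁) := by
  obtain ⟨Z, u, ζ, rfl, rfl⟩ := h
  refine ⟨Z, u ≫ _ ◁ f, ζ, ?_, ?_⟩
  · ext p
    simp only [LinearMap.comp_apply]
    rw [map_comp_apply, contr_map]
    rfl
  · ext p
    simp only [LinearMap.comp_apply]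
    rw [map_comp_apply, contr₁_map]

theorem VGood.tensor {P Y : C} {b : F.obj P →ₗ[K] R ⊗[K] F.obj Y}
    {b₁ : F.obj P →ₗ[K] F.obj Y} (h : VGood g b b₁) (Y' : C) :
    ∃ b' b₁', VGood g (P := P ⊗ Y') (Y := Y ⊗ Y') b' b₁' ∧
      (∀ p y, b' (tm F p y) = tensorator F R Y Y' (b p ⊗ₜ (1 ⊗ₜ y))) ∧
      ∀ p y, b₁' (tm F p y) = tm F (b₁ p) y := by
  obtain ⟨Z, u, ζ, rfl, rfl⟩ := h
  refine ⟨_, _, ⟨Z, u ▷ Y' ≫ (α_ _ _ _).hom, ζ, rfl, rfl⟩, fun p y => ?_, fun p y => ?_⟩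
  · simp only [LinearMap.comp_apply]
    rw [map_comp_apply, map_whiskerRight_tm]
    induction (F.map u).hom p using tm_induction F with
    | zero => simp
    | add a b ha hb => simp only [map_add, LinearMap.add_apply, ha, hb, TensorProduct.add_tmul]
    | tmul z x => rw [map_associator_hom_tm, contr_tm, contr_tm, tensorator_one_tmul, mul_one]
  · simp only [LinearMap.comp_apply]
    rw [map_comp_apply, map_whiskerRight_tm]
    induction (F.map u).hom p using tm_induction F with
    | zero => simp
    | add a b ha hb => simp only [map_add, LinearMap.add_apply, ha, hb]
    | tmul z x => rw [map_associator_hom_tm, contr₁_tm, contr₁_tm, map_smul, LinearMap.smul_apply]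

/-- Composing with the evaluation of `Y` turns the coordinates of `b` into scalar functions on `F(P
⊗ ᘁY)`, to which the dichotomy applies. -/
theorem VGood.pairing {P Y : C} [HasLeftDual Y] {b : F.obj P →ₗ[K] R ⊗[K] F.obj Y}
    {b₁ : F.obj P →ₗ[K] F.obj Y} (h : VGood g b b₁) :
    ∃ φ φ₁, Good g (P := P ⊗ ᘁY) φ φ₁ ∧
      (∀ p θ, φ (tm F p θ) = scal R (hat F θ) (b p)) ∧
      ∀ p θ, φ₁ (tm F p θ) = hat F θ (b₁ p) := by
  obtain ⟨Z, u, ζ, rfl, rfl⟩ := h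
  refine ⟨_, _, ⟨Z, u ▷ (ᘁY) ≫ (α_ _ _ _).hom ≫ _ ◁ (ε_ (ᘁY) Y) ≫ (ρ_ _).hom, ζ, rfl, rfl⟩,
    fun p θ => ?_, fun p θ => ?_⟩
  · simp only [LinearMap.comp_apply]
    rw [map_comp_apply, map_comp_apply, map_comp_apply, map_whiskerRight_tm]
    induction (F.map u).hom p using tm_induction F with
    | zero => simp
    | add a b ha hb => simp only [map_add, LinearMap.add_apply, ha, hb]
    | tmul z x =>
      rw [map_associator_hom_tm, map_whiskerLeft_tm, contr_tm, map_evaluation_tm, map_smul,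
        map_smul, map_rightUnitor_hom_tm, map_smul, scal_tmul, Algebra.smul_def, mul_comm]
  · simp only [LinearMap.comp_apply]
    rw [map_comp_apply, map_comp_apply, map_comp_apply, map_whiskerRight_tm]
    induction (F.map u).hom p using tm_induction F with
    | zero => simp
    | add a b ha hb => simp only [map_add, LinearMap.add_apply, ha, hb]
    | tmul z x =>
      rw [map_associator_hom_tm, map_whiskerLeft_tm, contr₁_tm, map_evaluation_tm, map_smul,
        map_smul, map_rightUnitor_hom_tm, map_smul, map_smul, smul_eq_mul, smul_eq_mul, mul_comm]

theorem contr_whiskerRight {Z Z' : A} {Y : C} (s : Z ⟶ Z') (ζ : F.obj (J.obj Z') →ₗ[K] K)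
    (w : F.obj (J.obj Z ⊗ Y)) :
    contr (coeff g Z' ζ) ((F.map (J.map s ▷ Y)).hom w) =
      contr (coeff g Z (ζ ∘ₗ (F.map (J.map s)).hom)) w := by
  induction w using tm_induction F with
  | zero => simp
  | add a b ha hb => simp only [map_add, ha, hb]
  | tmul x y => rw [map_whiskerRight_tm, contr_tm, contr_tm, coeff_map]

theorem contr₁_whiskerRight {X X' Y : C} (s : X ⟶ X') (ζ : F.obj X' →ₗ[K] K)
    (w : F.obj (X ⊗ Y)) :
    contr₁ ζ ((F.map (s ▷ Y)).hom w) = contr₁ (ζ ∘ₗ (F.map s).hom) w := by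
  induction w using tm_induction F with
  | zero => simp
  | add a b ha hb => simp only [map_add, ha, hb]
  | tmul x y => rw [map_whiskerRight_tm, contr₁_tm, contr₁_tm]; rfl

theorem contr_add {X Y : C} (φ ψ : F.obj X →ₗ[K] R) (w : F.obj (X ⊗ Y)) :
    contr (φ + ψ) w = contr φ w + contr ψ w := by
  induction w using tm_induction F with
  | zero => simp
  | add a b ha hb => simp only [map_add, ha, hb]; abel
  | tmul x y => simp only [contr_tm, LinearMap.add_apply, TensorProduct.add_tmul]

theorem contr₁_add {X Y : C} (φ ψ : F.obj X →ₗ[K] K) (w : F.obj (X ⊗ Y)) :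
    contr₁ (φ + ψ) w = contr₁ φ w + contr₁ ψ w := by
  induction w using tm_induction F with
  | zero => simp
  | add a b ha hb => simp only [map_add, ha, hb]; abel
  | tmul x y => simp only [contr₁_tm, LinearMap.add_apply, add_smul]

section Additive

variable [Preadditive A] [HasBinaryBiproducts A] [Preadditive C] [MonoidalPreadditive C]
  [J.Additive]

theorem VGood.add {P Y : C} {b c : F.obj P →ₗ[K] R ⊗[K] F.obj Y} {b₁ c₁ : F.obj P →ₗ[K] F.obj Y}
    (h : VGood g b b₁) (h' : VGood g c c₁) : VGood g (b + c) (b₁ + c₁) := by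
  obtain ⟨Z, f, ζ, rfl, rfl⟩ := h
  obtain ⟨Z', f', ζ', rfl, rfl⟩ := h'
  have e1 : (f ≫ J.map biprod.inl ▷ Y + f' ≫ J.map biprod.inr ▷ Y) ≫
      J.map (biprod.fst : Z ⊞ Z' ⟶ Z) ▷ Y = f := by
    simp [Preadditive.add_comp, ← J.map_comp, ← comp_whiskerRight]
  have e2 : (f ≫ J.map biprod.inl ▷ Y + f' ≫ J.map biprod.inr ▷ Y) ≫
      J.map (biprod.snd : Z ⊞ Z' ⟶ Z') ▷ Y = f' := by
    simp [Preadditive.add_comp, ← J.map_comp, ← comp_whiskerRight]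
  refine ⟨Z ⊞ Z', f ≫ J.map biprod.inl ▷ Y + f' ≫ J.map biprod.inr ▷ Y,
    ζ ∘ₗ (F.map (J.map biprod.fst)).hom + ζ' ∘ₗ (F.map (J.map biprod.snd)).hom, ?_, ?_⟩
  · ext p
    simp only [coeff_add, LinearMap.add_apply, LinearMap.comp_apply, contr_add,
      ← contr_whiskerRight]
    rw [← map_comp_apply, ← map_comp_apply, e1, e2]
  · ext p
    simp only [LinearMap.add_apply, LinearMap.comp_apply, contr₁_add, ← contr₁_whiskerRight]
    rw [← map_comp_apply, ← map_comp_apply, e1, e2]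

end Additive

end VGood

end TannakaSES

end

noncomputable section

namespace TannakaSES

/-! ### Minors of vector-valued matrix coefficients -/

section LinearAlgebra

variable {K : Type u} [Field K]

theorem det_dual_eq_zero {V : Type v} [AddCommGroup V] [Module K V] {n : ℕ} {x : Fin n → V}
    (hx : ¬ LinearIndependent K x) (l : Fin n → V →ₗ[K] K) :
    (Matrix.of fun i j => l i (x j)).det = 0 := by
  obtain ⟨c, hc, i, hi⟩ := Fintype.not_linearIndependent_iff.1 hx
  refine Matrix.exists_mulVec_eq_zero_iff.1 ⟨c, fun h => hi (congrFun h i), ?_⟩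
  funext k
  have := congrArg (l k) hc
  simpa [Matrix.mulVec, dotProduct, mul_comm] using this

theorem exists_det_dual_ne_zero {V : Type v} [AddCommGroup V] [Module K V] {n : ℕ}
    {x : Fin n → V} (hx : LinearIndependent K x) :
    ∃ l : Fin n → V →ₗ[K] K, (Matrix.of fun i j => l i (x j)).det ≠ 0 := by
  obtain ⟨p, hp⟩ := (Fintype.linearCombination K x).exists_leftInverse_of_injective
    (LinearMap.ker_eq_bot.2 (linearIndependent_iff_injective_fintypeLinearCombination.1 hx))
  refine ⟨fun i => LinearMap.proj i ∘ₗ p, ?_⟩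
  have h : (Matrix.of fun i j => (LinearMap.proj i ∘ₗ p : V →ₗ[K] K) (x j)) = 1 := by
    ext i j
    have := congrFun (LinearMap.congr_fun hp (Pi.single j 1)) i
    simp only [LinearMap.comp_apply, Fintype.linearCombination_apply_single, one_smul,
      LinearMap.id_apply] at this
    simp [this, Matrix.one_apply, Pi.single_apply]
  rw [h, Matrix.det_one]
  exact one_ne_zero

end LinearAlgebra

section Minors

variable {K : Type u} [Field K] {A : Type u₁} [Category.{v₁} A] [MonoidalCategory A]
  {C : Type u₂} [Category.{v₂} C] [MonoidalCategory C] [BraidedCategory C] {J : A ⥤ C}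
  [J.Monoidal] {F : C ⥤ ModuleCat.{u} K} [F.Braided] {R : Type w} [CommRing R] [Algebra K R]

/-- The determinant of the matrix of the pairings of `n` vectors with `n` dual vectors. -/
def minor {Y : C} [HasLeftDual Y] {n : ℕ} (v : Fin n → R ⊗[K] F.obj Y)
    (θ : Fin n → F.obj (ᘁY)) : R :=
  (Matrix.of fun i j => scal R (hat F (θ i)) (v j)).det

theorem minor_zero {Y : C} [HasLeftDual Y] (v : Fin 0 → R ⊗[K] F.obj Y)
    (θ : Fin 0 → F.obj (ᘁY)) : minor v θ = 1 := Matrix.det_fin_zero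

theorem minor_succ {Y : C} [HasLeftDual Y] {n : ℕ} (v : Fin (n + 1) → R ⊗[K] F.obj Y)
    (θ : Fin (n + 1) → F.obj (ᘁY)) :
    minor v θ = ∑ i : Fin (n + 1), (-1) ^ (i : ℕ) * scal R (hat F (θ i)) (v 0) *
      minor (Fin.tail v) (θ ∘ i.succAbove) :=
  Matrix.det_succ_column_zero _

/-- The determinant of the matrix of the pairings of `n` vectors with `n` dual vectors. -/
def minor₁ {Y : C} [HasLeftDual Y] {n : ℕ} (v : Fin n → F.obj Y)
    (θ : Fin n → F.obj (ᘁY)) : K :=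
  (Matrix.of fun i j => hat F (θ i) (v j)).det

theorem minor₁_zero {Y : C} [HasLeftDual Y] (v : Fin 0 → F.obj Y)
    (θ : Fin 0 → F.obj (ᘁY)) : minor₁ v θ = 1 := Matrix.det_fin_zero

theorem minor₁_succ {Y : C} [HasLeftDual Y] {n : ℕ} (v : Fin (n + 1) → F.obj Y)
    (θ : Fin (n + 1) → F.obj (ᘁY)) :
    minor₁ v θ = ∑ i : Fin (n + 1), (-1) ^ (i : ℕ) * hat F (θ i) (v 0) *
      minor₁ (Fin.tail v) (θ ∘ i.succAbove) :=
  Matrix.det_succ_column_zero _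

variable (g : TensorAut (J ⋙ F) R)

/-- The minors of a family `v` of `n`-tuples of vectors of `R ⊗ F(Y)` form a matrix coefficient, with
specialization given by the family `v₁`; the index set of the family spans `F(Q)`. -/
def MinorGood {Y : C} [HasLeftDual Y] (n : ℕ) {ι : Type*} (v : ι → Fin n → R ⊗[K] F.obj Y)
    (v₁ : ι → Fin n → F.obj Y) : Prop :=
  ∃ (Q : C) (q : ι → F.obj Q) (Φ : F.obj (Q ⊗ pw (ᘁY) n) →ₗ[K] R)
    (Φ₁ : F.obj (Q ⊗ pw (ᘁY) n) →ₗ[K] K), Submodule.span K (Set.range q) = ⊤ ∧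
    Good g Φ Φ₁ ∧ (∀ i θ, Φ (tm F (q i) (pure F n θ)) = minor (v i) θ) ∧
    ∀ i θ, Φ₁ (tm F (q i) (pure F n θ)) = minor₁ (v₁ i) θ

variable {g}

/-- Membership can be tested on decomposable vectors, which span because the `q i` do. -/
theorem MinorGood.span {Y : C} [HasLeftDual Y] {n : ℕ} {Q : C} {ι : Type*} {q : ι → F.obj Q}
    (hq : Submodule.span K (Set.range q) = ⊤) {N : Type*} [AddCommGroup N] [Module K N]
    (Φ : F.obj (Q ⊗ pw (ᘁY) n) →ₗ[K] N) (M : Submodule K N)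
    (h : ∀ i θ, Φ (tm F (q i) (pure F n θ)) ∈ M) (z) : Φ z ∈ M := by
  have hz : z ∈ Submodule.span K (Set.range fun p : ι × (Fin n → F.obj (ᘁY)) =>
      tm F (q p.1) (pure F n p.2)) := by
    rw [span_range_tm F hq (span_range_pure F _ n)]; trivial
  have hle : Submodule.span K (Set.range fun p : ι × (Fin n → F.obj (ᘁY)) =>
      tm F (q p.1) (pure F n p.2)) ≤ M.comap Φ := by
    rw [Submodule.span_le]
    rintro _ ⟨⟨i, θ⟩, rfl⟩
    exact h i θ
  exact hle hz

section Dichotomy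

variable {Y : C} [HasLeftDual Y] {n : ℕ} {ι : Type*} {v : ι → Fin n → R ⊗[K] F.obj Y}
    {v₁ : ι → Fin n → F.obj Y}

/-- Upper semicontinuity of the rank: if all tuples are dependent at `g = 1`, the function formed by
the minors vanishes there, hence identically. -/
theorem MinorGood.minor_eq_zero [Abelian C] [PreservesFiniteColimits F]
    (hsub : SubobjectsFrom J F) (h : MinorGood g n v v₁)
    (h₁ : ∀ i, ¬ LinearIndependent K (v₁ i)) (i : ι) (θ : Fin n → F.obj (ᘁY)) :
    minor (v i) θ = 0 := by
  obtain ⟨Q, q, Φ, Φ₁, hq, hg, hΦ, hΦ₁⟩ := h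
  have h0 : Φ₁ = 0 := LinearMap.ext fun z => (Submodule.mem_bot K).1
    (MinorGood.span hq Φ₁ ⊥ (fun i θ => (Submodule.mem_bot K).2
      ((hΦ₁ i θ).trans (det_dual_eq_zero (h₁ i) _))) z)
  rw [← hΦ, hg.eq_zero hsub h0]
  rfl

/-- Lower bound for the rank: one independent tuple at `g = 1` makes the function of minors nonzero
there, so its values generate the unit ideal. -/
theorem MinorGood.ideal_eq_top [Abelian C] [PreservesFiniteColimits F]
    (hsub : SubobjectsFrom J F) (h : MinorGood g n v v₁) (i : ι)
    (h₁ : LinearIndependent K (v₁ i)) (I : Ideal R) (hI : ∀ i θ, minor (v i) θ ∈ I) :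
    I = ⊤ := by
  obtain ⟨Q, q, Φ, Φ₁, hq, hg, hΦ, hΦ₁⟩ := h
  have h0 : Φ₁ ≠ 0 := by
    rintro rfl
    obtain ⟨l, hl⟩ := exists_det_dual_ne_zero h₁
    choose θ hθ using fun k => hat_surjective F Y (l k)
    refine hl ?_
    have := hΦ₁ i θ
    rw [minor₁] at this
    simp only [hθ] at this
    exact this.symm
  refine top_le_iff.1 ((hg.span_eq_top hsub h0).ge.trans (Ideal.span_le.2 ?_))
  rintro _ ⟨z, rfl⟩
  exact MinorGood.span hq Φ (I.restrictScalars K) (fun i θ => by rw [hΦ]; exact hI i θ) z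

end Dichotomy

variable (g) in
theorem MinorGood.zero (Y : C) [HasLeftDual Y] {ι : Type*} [Nonempty ι]
    (v : ι → Fin 0 → R ⊗[K] F.obj Y) (v₁ : ι → Fin 0 → F.obj Y) : MinorGood g 0 v v₁ := by
  have h : ∀ θ : Fin 0 → F.obj (ᘁY), unitFun F ((F.map (λ_ (𝟙_ C)).hom).hom
      (tm F (unitVec F) (pure F 0 θ))) = 1 := fun θ =>
    (congrArg (unitFun F) (map_leftUnitor_hom_tm F (unitVec F))).trans (unitFun_unitVec F)
  refine ⟨𝟙_ C, fun _ => unitVec F, _, _, span_range_unitVec F, Good.const g (λ_ (𝟙_ C)).hom,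
    fun i θ => ?_, fun i θ => ?_⟩
  · rw [minor_zero]
    refine (congrArg (algebraMap K R) (h θ)).trans (map_one _)
  · rw [minor₁_zero]
    exact h θ

/-- Laplace expansion along the column of the new vector. The `i`-th term is a signed product of a
coordinate function and a smaller minor, pulled back along the morphism that pairs `P` with the
`i`-th dual factor and `Q` with the others. -/
theorem MinorGood.succ [Preadditive A] [HasBinaryBiproducts A] [Preadditive C] [J.Additive]
    {Y : C} [HasLeftDual Y] {n : ℕ} {ι : Type*} [F.Additive]
    {v : ι → Fin n → R ⊗[K] F.obj Y} {v₁ : ι → Fin n → F.obj Y} {P : C}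
    {b : F.obj P →ₗ[K] R ⊗[K] F.obj Y} {b₁ : F.obj P →ₗ[K] F.obj Y}
    (hb : VGood g b b₁) {κ : Type*} {p : κ → F.obj P}
    (hp : Submodule.span K (Set.range p) = ⊤) (h : MinorGood g n v v₁) :
    MinorGood g (n + 1) (fun k : κ × ι => (Fin.cons (b (p k.1)) (v k.2) : Fin (n + 1) → _))
      (fun k => (Fin.cons (b₁ (p k.1)) (v₁ k.2) : Fin (n + 1) → _)) := by
  obtain ⟨Q, q, Φ, Φ₁, hq, hg, hΦ, hΦ₁⟩ := h
  obtain ⟨ψ, ψ₁, hψ, hb, hb₁⟩ := hb.pairing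
  choose f hf using exists_front F (ᘁY) n
  let s (i : Fin (n + 1)) : (P ⊗ Q) ⊗ pw (ᘁY) (n + 1) ⟶ (P ⊗ ᘁY) ⊗ (Q ⊗ pw (ᘁY) n) :=
    (P ⊗ Q) ◁ f i ≫ tensorμ P Q (ᘁY) (pw (ᘁY) n)
  have hs : ∀ i a b θ, (F.map (s i)).hom (tm F (tm F a b) (pure F (n + 1) θ)) =
      tm F (tm F a (θ i)) (tm F b (pure F n (θ ∘ i.succAbove))) := fun i a b θ => by
    have h : (F.map ((P ⊗ Q) ◁ f i ≫ tensorμ P Q (ᘁY) (pw (ᘁY) n))).hom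
        (tm F (tm F a b) (tm F (θ 0) (pure F n (Fin.tail θ)))) =
        tm F (tm F a (θ i)) (tm F b (pure F n (θ ∘ i.succAbove))) := by
      rw [map_comp_apply, map_whiskerLeft_tm, hf, map_tensorμ_tm]
    exact h
  refine ⟨P ⊗ Q, fun k => tm F (p k.1) (q k.2),
    ∑ i : Fin (n + 1), ((-1) ^ (i : ℕ) : K) • (tf F ψ Φ ∘ₗ (F.map (s i)).hom),
    ∑ i : Fin (n + 1), ((-1) ^ (i : ℕ) : K) • (tf F ψ₁ Φ₁ ∘ₗ (F.map (s i)).hom),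
    span_range_tm F hp hq, Good.sum _ fun i _ => ((hψ.mul hg).comp (s i)).smul _,
    fun k θ => ?_, fun k θ => ?_⟩
  · rw [minor_succ, LinearMap.sum_apply]
    refine Finset.sum_congr rfl fun i _ => ?_
    rw [LinearMap.smul_apply, LinearMap.comp_apply, hs, tf_tm, hb, hΦ]
    simp [Algebra.smul_def, mul_assoc]
  · rw [minor₁_succ, LinearMap.sum_apply]
    refine Finset.sum_congr rfl fun i _ => ?_
    rw [LinearMap.smul_apply, LinearMap.comp_apply, hs, tf_tm, hb₁, hΦ₁]
    simp [mul_assoc]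

theorem VGood.minorGood [Preadditive A] [HasBinaryBiproducts A] [Preadditive C] [J.Additive]
    [F.Additive] {Y : C} [HasLeftDual Y] {P : C} {b : F.obj P →ₗ[K] R ⊗[K] F.obj Y}
    {b₁ : F.obj P →ₗ[K] F.obj Y} (hb : VGood g b b₁) (n : ℕ) :
    MinorGood g n (fun (p : Fin n → F.obj P) i => b (p i)) (fun p i => b₁ (p i)) := by
  induction n with
  | zero => exact MinorGood.zero g Y _ _
  | succ n ih =>
    have hid : Submodule.span K (Set.range (id : F.obj P → F.obj P)) = ⊤ := by simp
    obtain ⟨Q, q, Φ, Φ₁, hq, hg, hΦ, hΦ₁⟩ := ih.succ hb hid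
    refine ⟨Q, fun p => q (p 0, Fin.tail p), Φ, Φ₁, ?_, hg, fun p θ => ?_, fun p θ => ?_⟩
    · rw [← hq]
      congr 1
      ext x
      constructor
      · rintro ⟨p, rfl⟩
        exact ⟨_, rfl⟩
      · rintro ⟨⟨a, p⟩, rfl⟩
        exact ⟨Fin.cons a p, rfl⟩
    · rw [hΦ]
      exact congrArg (fun v => minor v θ) (Fin.cons_self_tail fun i => b (p i))
    · rw [hΦ₁]
      exact congrArg (fun v => minor₁ v θ) (Fin.cons_self_tail fun i => b₁ (p i))

end Minors

end TannakaSES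

end

noncomputable section

namespace TannakaSES

/-! ### The relation modules -/

section Minors

variable {K : Type u} [Field K] {C : Type u₂} [Category.{v₂} C] [MonoidalCategory C]
  [BraidedCategory C] {F : C ⥤ ModuleCat.{u} K} [F.Braided] {R : Type w} [CommRing R]
  [Algebra K R] {Y : C} [HasLeftDual Y] {n : ℕ}

/-- A minor as a linear function of its first vector. -/
def minorLin (y : Fin n → R ⊗[K] F.obj Y) (θ : Fin (n + 1) → F.obj (ᘁY)) :
    R ⊗[K] F.obj Y →ₗ[R] R :=
  ∑ i : Fin (n + 1), ((-1) ^ (i : ℕ) * minor y (θ ∘ i.succAbove)) • scal R (hat F (θ i))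

theorem minorLin_apply (y : Fin n → R ⊗[K] F.obj Y) (θ : Fin (n + 1) → F.obj (ᘁY))
    (v : R ⊗[K] F.obj Y) : minorLin y θ v = minor (Fin.cons v y : Fin (n + 1) → _) θ := by
  rw [minor_succ, minorLin, LinearMap.sum_apply]
  refine Finset.sum_congr rfl fun i _ => ?_
  simp only [LinearMap.smul_apply, smul_eq_mul, Fin.cons_zero, Fin.tail_cons]
  ring

theorem minor_row (v : Fin (n + 1) → R ⊗[K] F.obj Y) (θ : Fin (n + 1) → F.obj (ᘁY)) :
    minor v θ = scal R (hat F (θ 0)) (∑ j : Fin (n + 1), ((-1) ^ (j : ℕ) *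
      minor (v ∘ j.succAbove) (Fin.tail θ)) • v j) := by
  rw [map_sum]
  refine (Matrix.det_succ_row_zero _).trans (Finset.sum_congr rfl fun j _ => ?_)
  rw [map_smul, smul_eq_mul]
  change _ * _ * minor (v ∘ j.succAbove) (Fin.tail θ) = _
  simp only [Matrix.of_apply]
  ring

/-- Cramer's rule without inverting the determinant. If all `(n + 1)`-minors of `(v, y)` vanish,
expansion along a row shows that the signed sum of `n`-minors times the vectors pairs to zero with
every functional. Solving for the term in `v` gives `π v`. -/
theorem exists_cramer (y : Fin n → R ⊗[K] F.obj Y) (θ : Fin n → F.obj (ᘁY)) :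
    ∃ π : R ⊗[K] F.obj Y →ₗ[R] R ⊗[K] F.obj Y,
      (∀ v, π v ∈ Submodule.span R (Set.range y)) ∧
      ∀ v, (∀ θ' : Fin (n + 1) → F.obj (ᘁY), minor (Fin.cons v y : Fin (n + 1) → _) θ' = 0) →
        π v = minor y θ • v := by
  have hL : ∀ k : Fin n, ∃ L : R ⊗[K] F.obj Y →ₗ[R] R, ∀ v,
      L v = minor ((Fin.cons v y : Fin (n + 1) → _) ∘ k.succ.succAbove) θ := by
    intro k
    -- With `y k` omitted from `(v, y)`, the vector `v` remains in front, so the minor is linear in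
    -- `v`.
    obtain _ | n := n
    · exact k.elim0
    · refine ⟨minorLin (y ∘ k.succAbove) θ, fun v => ?_⟩
      rw [minorLin_apply]
      congr 1
      funext i
      refine Fin.cases ?_ (fun i => ?_) i
      · simp
      · simp [Fin.succ_succAbove_succ]
  choose L hL using hL
  refine ⟨-∑ k : Fin n, ((-1) ^ (k.succ : ℕ) : R) • (L k).smulRight (y k), fun v => ?_, fun v hv => ?_⟩
  · rw [LinearMap.neg_apply, LinearMap.sum_apply]
    refine neg_mem (sum_mem fun k _ => ?_)
    rw [LinearMap.smul_apply, LinearMap.smulRight_apply]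
    exact Submodule.smul_mem _ _ (Submodule.smul_mem _ _ (Submodule.subset_span ⟨k, rfl⟩))
  · have hfin := finite_obj F Y
    have h0 : ∑ j : Fin (n + 1), ((-1) ^ (j : ℕ) *
        minor ((Fin.cons v y : Fin (n + 1) → _) ∘ j.succAbove) θ) •
          (Fin.cons v y : Fin (n + 1) → R ⊗[K] F.obj Y) j = 0 := by
      refine eq_of_scal_eq fun ζ => ?_
      obtain ⟨θ₀, rfl⟩ := hat_surjective F Y ζ
      have := minor_row (Fin.cons v y : Fin (n + 1) → R ⊗[K] F.obj Y)
        (Fin.cons θ₀ θ : Fin (n + 1) → F.obj (ᘁY))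
      rw [hv, Fin.tail_cons, Fin.cons_zero] at this
      rw [← this, map_zero]
    rw [Fin.sum_univ_succ] at h0
    have h1 : (Fin.cons v y : Fin (n + 1) → R ⊗[K] F.obj Y) ∘ Fin.succAbove 0 = y := by
      funext i; simp
    rw [h1] at h0
    simp only [Fin.val_zero, pow_zero, one_mul, Fin.cons_zero, Fin.cons_succ] at h0
    rw [LinearMap.neg_apply, LinearMap.sum_apply, eq_comm, eq_neg_iff_add_eq_zero, ← h0]
    congr 1
    refine Finset.sum_congr rfl fun k _ => ?_
    rw [LinearMap.smul_apply, LinearMap.smulRight_apply, hL, mul_smul]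

end Minors

section Rel

variable {K : Type u} [Field K] {A : Type u₁} [Category.{v₁} A] [MonoidalCategory A]
  {C : Type u₂} [Category.{v₂} C] [MonoidalCategory C] {J : A ⥤ C}
  [J.Monoidal] {F : C ⥤ ModuleCat.{u} K} [F.Monoidal] {R : Type w} [CommRing R] [Algebra K R]
  (g : TensorAut (J ⋙ F) R)

/-- The relations between the matrix coefficients `⟨ξ, h y⟩`, `y ∈ F(Y)`, of a tensor automorphism
`h` that restricts to `g`. -/
def rel (Y : C) (ξ : F.obj Y →ₗ[K] K) : Submodule R (R ⊗[K] F.obj Y) :=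
  Submodule.span R {x | ∃ (P : C) (b : F.obj P →ₗ[K] R ⊗[K] F.obj Y)
    (b₁ : F.obj P →ₗ[K] F.obj Y) (p : F.obj P), VGood g b b₁ ∧ ξ ∘ₗ b₁ = 0 ∧ b p = x}

variable {g}

theorem VGood.mem_rel {P Y : C} {b : F.obj P →ₗ[K] R ⊗[K] F.obj Y}
    {b₁ : F.obj P →ₗ[K] F.obj Y} (h : VGood g b b₁) {ξ : F.obj Y →ₗ[K] K} (hξ : ξ ∘ₗ b₁ = 0)
    (p : F.obj P) : b p ∈ rel g Y ξ :=
  Submodule.subset_span ⟨P, b, b₁, p, h, hξ, rfl⟩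

theorem rel_le {Y : C} {ξ : F.obj Y →ₗ[K] K} {N : Submodule R (R ⊗[K] F.obj Y)}
    (h : ∀ (P : C) (b : F.obj P →ₗ[K] R ⊗[K] F.obj Y) (b₁ : F.obj P →ₗ[K] F.obj Y),
      VGood g b b₁ → ξ ∘ₗ b₁ = 0 → ∀ p, b p ∈ N) : rel g Y ξ ≤ N := by
  refine Submodule.span_le.2 ?_
  rintro _ ⟨P, b, b₁, p, hb, hξ, rfl⟩
  exact h P b b₁ hb hξ p

end Rel

/-! ### The relation modules have constant rank and split off. -/

section Splitting

variable {K : Type u} [Field K] {A : Type u₁} [Category.{v₁} A] [MonoidalCategory A]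
  [Preadditive A] [HasBinaryBiproducts A]
  {C : Type u₂} [Category.{v₂} C] [MonoidalCategory C] [BraidedCategory C] [Abelian C]
  [MonoidalPreadditive C] {J : A ⥤ C} [J.Monoidal] [J.Additive]
  {F : C ⥤ ModuleCat.{u} K} [F.Braided] [F.Additive]
  {R : Type w} [CommRing R] [Algebra K R] {g : TensorAut (J ⋙ F) R}

variable (g) in
theorem exists_greatest_range (Y : C) [HasLeftDual Y] (ξ : F.obj Y →ₗ[K] K) :
    ∃ (P : C) (b : F.obj P →ₗ[K] R ⊗[K] F.obj Y) (b₁ : F.obj P →ₗ[K] F.obj Y),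
      VGood g b b₁ ∧ ξ ∘ₗ b₁ = 0 ∧ ∀ (P' : C) (b' : F.obj P' →ₗ[K] R ⊗[K] F.obj Y)
        (b₁' : F.obj P' →ₗ[K] F.obj Y), VGood g b' b₁' → ξ ∘ₗ b₁' = 0 →
        LinearMap.range b₁' ≤ LinearMap.range b₁ := by
  have hfin := finite_obj F Y
  let S : Set (Submodule K (F.obj Y)) := {V | ∃ (P : C) (b : F.obj P →ₗ[K] R ⊗[K] F.obj Y)
      (b₁ : F.obj P →ₗ[K] F.obj Y), VGood g b b₁ ∧ ξ ∘ₗ b₁ = 0 ∧ LinearMap.range b₁ = V}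
  have hS : S.Nonempty :=
    ⟨_, 𝟙_ C, _, _, VGood.of_hom g (0 : 𝟙_ C ⟶ Y), by ext; simp, rfl⟩
  obtain ⟨V, ⟨P, b, b₁, hb, hξ, rfl⟩, hmax⟩ :=
    (wellFounded_gt (α := Submodule K (F.obj Y))).has_min S hS
  refine ⟨P, b, b₁, hb, hξ, fun P' b' b₁' hb' hξ' => ?_⟩
  -- The sum on `P ⊞ P'` has a range containing both ranges, so a maximal range is the greatest one.
  have hB := (hb.comp (biprod.fst : P ⊞ P' ⟶ P)).add (hb'.comp (biprod.snd : P ⊞ P' ⟶ P'))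
  set B₁ := b₁ ∘ₗ (F.map (biprod.fst : P ⊞ P' ⟶ P)).hom +
    b₁' ∘ₗ (F.map (biprod.snd : P ⊞ P' ⟶ P')).hom with hB₁
  have hl : ∀ p, B₁ ((F.map biprod.inl).hom p) = b₁ p := fun p => by
    simp only [hB₁, LinearMap.add_apply, LinearMap.comp_apply]
    rw [← map_comp_apply, ← map_comp_apply]
    simp
  have hr : ∀ p, B₁ ((F.map biprod.inr).hom p) = b₁' p := fun p => by
    simp only [hB₁, LinearMap.add_apply, LinearMap.comp_apply]
    rw [← map_comp_apply, ← map_comp_apply]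
    simp
  have hξB : ξ ∘ₗ B₁ = 0 := by
    rw [hB₁, LinearMap.comp_add, ← LinearMap.comp_assoc, ← LinearMap.comp_assoc, hξ, hξ']
    simp
  have hle : LinearMap.range b₁ ≤ LinearMap.range B₁ := by
    rintro _ ⟨p, rfl⟩
    exact ⟨_, hl p⟩
  have hle' : LinearMap.range b₁' ≤ LinearMap.range B₁ := by
    rintro _ ⟨p, rfl⟩
    exact ⟨_, hr p⟩
  have heq : LinearMap.range b₁ = LinearMap.range B₁ := by
    by_contra hne
    exact hmax _ ⟨_, _, _, hB, hξB, rfl⟩ (lt_of_le_of_ne hle hne)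
  exact hle'.trans heq.ge

/-- Here `r` is the rank at `g = 1` of the greatest range of relations. Any further relation lies in
that range at `g = 1`, so the minors of size `r + 1` vanish there and hence over `R`; this extends
to the span because a minor is linear in its first vector. -/
theorem exists_rank [PreservesFiniteColimits F] (hsub : SubobjectsFrom J F)
    (Y : C) [HasLeftDual Y] (ξ : F.obj Y →ₗ[K] K) :
    ∃ (P : C) (b : F.obj P →ₗ[K] R ⊗[K] F.obj Y) (b₁ : F.obj P →ₗ[K] F.obj Y) (r : ℕ)
      (p : Fin r → F.obj P), VGood g b b₁ ∧ ξ ∘ₗ b₁ = 0 ∧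
      LinearIndependent K (fun i => b₁ (p i)) ∧
      ∀ (p' : Fin r → F.obj P) (v), v ∈ rel g Y ξ → ∀ θ : Fin (r + 1) → F.obj (ᘁY),
        minor (Fin.cons v (fun i => b (p' i)) : Fin (r + 1) → _) θ = 0 := by
  have hfin := finite_obj F Y
  obtain ⟨P, b, b₁, hb, hξ, hmax⟩ := exists_greatest_range g Y ξ
  let B := Module.finBasis K (LinearMap.range b₁)
  choose p hp using fun i => (B i).2
  refine ⟨P, b, b₁, _, p, hb, hξ, ?_, fun p' v hv θ => ?_⟩
  · have h := B.linearIndependent.map' (LinearMap.range b₁).subtype (Submodule.ker_subtype _)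
    have he : (fun i => b₁ (p i)) = (LinearMap.range b₁).subtype ∘ B := funext hp
    rw [he]
    exact h
  · rw [← minorLin_apply]
    have hle : rel g Y ξ ≤ LinearMap.ker (minorLin (fun i => b (p' i)) θ) := by
      refine rel_le fun P' b' b₁' hb' hξ' q => ?_
      rw [LinearMap.mem_ker, minorLin_apply]
      have hid : Submodule.span K (Set.range (id : F.obj P' → F.obj P')) = ⊤ := by simp
      refine (MinorGood.succ hb' hid (hb.minorGood _)).minor_eq_zero hsub (fun i hi => ?_)
        (q, p') θ
      have hmem : ∀ k, (Fin.cons (b₁' (id i.1)) (fun j => b₁ (i.2 j)) : Fin (_ + 1) → _) k ∈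
          LinearMap.range b₁ := by
        refine Fin.cases ?_ fun j => ?_
        · exact hmax P' b' b₁' hb' hξ' ⟨_, rfl⟩
        · exact ⟨_, rfl⟩
      have hcard := (LinearIndependent.of_comp (LinearMap.range b₁).subtype
        (v := fun k => (⟨_, hmem k⟩ : LinearMap.range b₁)) hi).fintype_card_le_finrank
      rw [Fintype.card_fin] at hcard
      omega
    exact hle hv

/-- The relation modules are direct summands. -/
theorem exists_projection [PreservesFiniteColimits F] (hsub : SubobjectsFrom J F)
    (Y : C) [HasLeftDual Y] (ξ : F.obj Y →ₗ[K] K) :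
    ∃ π : R ⊗[K] F.obj Y →ₗ[R] R ⊗[K] F.obj Y,
      (∀ v, π v ∈ rel g Y ξ) ∧ ∀ v ∈ rel g Y ξ, π v = v := by
  obtain ⟨P, b, b₁, r, p, hb, hξ, hp, hmin⟩ := exists_rank (g := g) hsub Y ξ
  -- The scalars by which some endomorphism with values in the relation module acts on that module.
  -- Cramer's rule puts all `r`-minors of `b` into this ideal.
  let I : Ideal R :=
    { carrier := {a | ∃ π : R ⊗[K] F.obj Y →ₗ[R] R ⊗[K] F.obj Y,
        (∀ v, π v ∈ rel g Y ξ) ∧ ∀ v ∈ rel g Y ξ, π v = a • v}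
      add_mem' := by
        rintro a a' ⟨π, h, h'⟩ ⟨π', k, k'⟩
        exact ⟨π + π', fun v => add_mem (h v) (k v), fun v hv => by
          rw [LinearMap.add_apply, h' v hv, k' v hv, add_smul]⟩
      zero_mem' := ⟨0, fun v => zero_mem _, fun v _ => by simp⟩
      smul_mem' := by
        rintro c a ⟨π, h, h'⟩
        exact ⟨c • π, fun v => Submodule.smul_mem _ c (h v), fun v hv => by
          rw [LinearMap.smul_apply, h' v hv, smul_assoc]⟩ }
  have hI : I = ⊤ := by
    refine (hb.minorGood r).ideal_eq_top hsub p hp I fun p' θ => ?_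
    obtain ⟨π, h, h'⟩ := exists_cramer (fun i => b (p' i)) θ
    refine ⟨π, fun v => ?_, fun v hv => h' v fun θ' => hmin p' v hv θ'⟩
    refine Submodule.span_le.2 ?_ (h v)
    rintro _ ⟨i, rfl⟩
    exact hb.mem_rel hξ _
  obtain ⟨π, h, h'⟩ := (Ideal.eq_top_iff_one I).1 hI
  exact ⟨π, h, fun v hv => (h' v hv).trans (one_smul R v)⟩

/-- At `g = 1` the vector `F(f) 1` lies outside the relations, since `ξ` kills them. The minors of
size `r + 1` with this vector in front thus generate the unit ideal, and as functions of their first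
vector they kill all relations. -/
theorem exists_functional [PreservesFiniteColimits F] (hsub : SubobjectsFrom J F)
    (Y : C) [HasLeftDual Y] (ξ : F.obj Y →ₗ[K] K) (f : 𝟙_ C ⟶ Y)
    (hf : ξ ((F.map f).hom (unitVec F)) ≠ 0) :
    ∃ l : R ⊗[K] F.obj Y →ₗ[R] R, (∀ v ∈ rel g Y ξ, l v = 0) ∧
      l (1 ⊗ₜ (F.map f).hom (unitVec F)) = 1 := by
  obtain ⟨P, b, b₁, r, p, hb, hξ, hp, hmin⟩ := exists_rank (g := g) hsub Y ξ
  let I : Ideal R :=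
    { carrier := {a | ∃ l : R ⊗[K] F.obj Y →ₗ[R] R, (∀ v ∈ rel g Y ξ, l v = 0) ∧
        l (1 ⊗ₜ (F.map f).hom (unitVec F)) = a}
      add_mem' := by
        rintro a a' ⟨l, h, rfl⟩ ⟨l', h', rfl⟩
        exact ⟨l + l', fun v hv => by rw [LinearMap.add_apply, h v hv, h' v hv, add_zero], rfl⟩
      zero_mem' := ⟨0, fun v _ => rfl, rfl⟩
      smul_mem' := by
        rintro c a ⟨l, h, rfl⟩
        exact ⟨c • l, fun v hv => by rw [LinearMap.smul_apply, h v hv, smul_zero], rfl⟩ }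
  have hI : I = ⊤ := by
    refine (MinorGood.succ (VGood.of_hom g f) (span_range_unitVec F (ι := Unit))
      (hb.minorGood r)).ideal_eq_top hsub ((), p) ?_ I fun p' θ => ?_
    · refine linearIndependent_finCons.2 ⟨hp, fun hmem => hf ?_⟩
      have hle : Submodule.span K (Set.range fun i => b₁ (p i)) ≤ LinearMap.ker ξ := by
        rw [Submodule.span_le]
        rintro _ ⟨i, rfl⟩
        exact LinearMap.congr_fun hξ (p i)
      exact hle hmem
    · refine ⟨minorLin (fun i => b (p'.2 i)) θ, fun v hv => ?_, ?_⟩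
      · rw [minorLin_apply, hmin p'.2 v hv θ]
      · rw [minorLin_apply]
        rfl
  exact (Ideal.eq_top_iff_one I).1 hI

end Splitting

end TannakaSES

end

noncomputable section

namespace TannakaSES

/-! ### The algebra that represents the lifts of a point of `Gal(A)` to `Gal(C)` -/

section Tensorator

variable {K : Type u} [Field K] {C : Type u₂} [Category.{v₂} C]
  {F : C ⥤ ModuleCat.{u} K} {R : Type w} [CommRing R] [Algebra K R]

variable (F R) in
/-- The map `R ⊗ F(X) → R ⊗ F(Y)` given by a morphism. -/
abbrev bc {X Y : C} (f : X ⟶ Y) : R ⊗[K] F.obj X →ₗ[R] R ⊗[K] F.obj Y :=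
  (F.map f).hom.baseChange R

theorem bc_comp {X Y Z : C} (f : X ⟶ Y) (f' : Y ⟶ Z) (v : R ⊗[K] F.obj X) :
    bc F R (f ≫ f') v = bc F R f' (bc F R f v) := by
  rw [bc, F.map_comp, ModuleCat.hom_comp, LinearMap.baseChange_comp]
  rfl

theorem bc_id {X : C} (v : R ⊗[K] F.obj X) : bc F R (𝟙 X) v = v := by
  simp [bc]

section Lax

variable [MonoidalCategory C] [F.LaxMonoidal]

theorem bc_tensorator {X X' Y Y' : C} (f : X ⟶ X') (f' : Y ⟶ Y') (v : R ⊗[K] F.obj X)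
    (w : R ⊗[K] F.obj Y) : bc F R (f ⊗ₘ f') (tensorator F R X Y (v ⊗ₜ w)) =
      tensorator F R X' Y' (bc F R f v ⊗ₜ bc F R f' w) := by
  induction v using TensorProduct.induction_on with
  | zero => simp
  | add a b ha hb => simp only [TensorProduct.add_tmul, map_add, ha, hb]
  | tmul r x =>
    induction w using TensorProduct.induction_on with
    | zero => simp
    | add a b ha hb => simp only [TensorProduct.tmul_add, map_add, ha, hb]
    | tmul s y =>
      simp only [tensorator_one_tmul, LinearMap.baseChange_tmul, map_tm]

theorem bc_associator {X Y Z : C} (a : R ⊗[K] F.obj X) (b : R ⊗[K] F.obj Y)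
    (c : R ⊗[K] F.obj Z) :
    bc F R (α_ X Y Z).hom (tensorator F R _ _ (tensorator F R _ _ (a ⊗ₜ b) ⊗ₜ c)) =
      tensorator F R _ _ (a ⊗ₜ tensorator F R _ _ (b ⊗ₜ c)) := by
  induction a using TensorProduct.induction_on with
  | zero => simp
  | add a a' ha hb => simp only [TensorProduct.add_tmul, map_add, ha, hb]
  | tmul r x =>
    induction b using TensorProduct.induction_on with
    | zero => simp
    | add a b ha hb =>
      simp only [TensorProduct.tmul_add, TensorProduct.add_tmul, map_add, ha, hb]
    | tmul s y =>
      induction c using TensorProduct.induction_on with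
      | zero => simp
      | add a b ha hb => simp only [TensorProduct.tmul_add, map_add, ha, hb]
      | tmul t z =>
        simp only [tensorator_one_tmul, LinearMap.baseChange_tmul, map_associator_hom_tm,
          mul_assoc]

theorem bc_leftUnitor {X : C} (a : R ⊗[K] F.obj X) :
    bc F R (λ_ X).hom (tensorator F R _ _ ((1 ⊗ₜ unitVec F) ⊗ₜ a)) = a := by
  induction a using TensorProduct.induction_on with
  | zero => simp
  | add a a' ha hb => simp only [TensorProduct.tmul_add, map_add, ha, hb]
  | tmul r x =>
    simp only [tensorator_one_tmul, LinearMap.baseChange_tmul, map_leftUnitor_hom_tm, one_mul]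

theorem bc_braiding [BraidedCategory C] {G : C ⥤ ModuleCat.{u} K} [G.LaxBraided] {X Y : C}
    (a : R ⊗[K] G.obj X) (b : R ⊗[K] G.obj Y) :
    bc G R (β_ X Y).hom (tensorator G R _ _ (a ⊗ₜ b)) = tensorator G R _ _ (b ⊗ₜ a) := by
  induction a using TensorProduct.induction_on with
  | zero => simp
  | add a a' ha hb =>
    simp only [TensorProduct.tmul_add, TensorProduct.add_tmul, map_add, ha, hb]
  | tmul r x =>
    induction b using TensorProduct.induction_on with
    | zero => simp
    | add a b ha hb =>
      simp only [TensorProduct.tmul_add, TensorProduct.add_tmul, map_add, ha, hb]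
    | tmul s y =>
      simp only [tensorator_one_tmul, LinearMap.baseChange_tmul, map_braiding_hom_tm, mul_comm]

end Lax

end Tensorator

section Idx

variable {K : Type u} [Field K] {C : Type u₂} [Category.{v₂} C]

/-- The objects of the category of elements of the dual of `F`. -/
structure Idx (F : C ⥤ ModuleCat.{u} K) where
  /-- The object. -/
  obj : C
  /-- The functional. -/
  fn : F.obj obj →ₗ[K] K

variable {F : C ⥤ ModuleCat.{u} K}

/-- Morphisms of `C` that are compatible with the functionals. -/
def Idx.Compat (i j : Idx F) (f : i.obj ⟶ j.obj) : Prop := j.fn ∘ₗ (F.map f).hom = i.fn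

theorem Idx.Compat.comp {i j k : Idx F} {f : i.obj ⟶ j.obj} {f' : j.obj ⟶ k.obj}
    (h : Idx.Compat i j f) (h' : Idx.Compat j k f') : Idx.Compat i k (f ≫ f') := by
  ext x
  rw [← h, ← h']
  simp

theorem Idx.Compat.id (i : Idx F) : Idx.Compat i i (𝟙 _) := by
  ext x; simp

instance : Preorder (Idx F) where
  le i j := ∃ f, Idx.Compat i j f
  le_refl i := ⟨_, .id i⟩
  le_trans _ _ _ := fun ⟨_, h⟩ ⟨_, h'⟩ => ⟨_, h.comp h'⟩

variable [Preadditive C] [HasBinaryBiproducts C]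

/-- The direct sum of two indices. -/
abbrev Idx.sum (i j : Idx F) : Idx F :=
  ⟨i.obj ⊞ j.obj, i.fn ∘ₗ (F.map biprod.fst).hom + j.fn ∘ₗ (F.map biprod.snd).hom⟩

variable [F.Additive]

theorem Idx.compat_inl (i j : Idx F) : Idx.Compat i (i.sum j) biprod.inl := by
  ext x
  simp only [LinearMap.comp_apply, LinearMap.add_apply]
  rw [← map_comp_apply, ← map_comp_apply]
  simp

theorem Idx.compat_inr (i j : Idx F) : Idx.Compat j (i.sum j) biprod.inr := by
  ext x
  simp only [LinearMap.comp_apply, LinearMap.add_apply]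
  rw [← map_comp_apply, ← map_comp_apply]
  simp

instance : IsDirectedOrder (Idx F) :=
  ⟨fun i j => ⟨i.sum j, ⟨_, i.compat_inl j⟩, ⟨_, i.compat_inr j⟩⟩⟩

end Idx

section TensorIdx

variable {K : Type u} [Field K] {C : Type u₂} [Category.{v₂} C] [MonoidalCategory C]
  {F : C ⥤ ModuleCat.{u} K} [F.Monoidal]

/-- The tensor product of two indices. -/
abbrev Idx.tensor (i j : Idx F) : Idx F := ⟨i.obj ⊗ j.obj, tf F i.fn j.fn⟩

variable (F) in
/-- The unit index. -/
abbrev Idx.unit : Idx F := ⟨𝟙_ C, unitFun F⟩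

theorem Idx.Compat.tensor {i i' j j' : Idx F} {f : i.obj ⟶ i'.obj} {f' : j.obj ⟶ j'.obj}
    (h : Idx.Compat i i' f) (h' : Idx.Compat j j' f') :
    Idx.Compat (i.tensor j) (i'.tensor j') (f ⊗ₘ f') := by
  refine linearMap_ext_tm F fun x y => ?_
  rw [LinearMap.comp_apply]
  rw [map_tm, tf_tm, tf_tm, ← h, ← h']
  rfl

theorem Idx.compat_associator (i j k : Idx F) :
    Idx.Compat ((i.tensor j).tensor k) (i.tensor (j.tensor k)) (α_ _ _ _).hom := by
  refine linearMap_ext_tm F fun x z => ?_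
  induction x using tm_induction F with
  | zero => simp
  | add a b ha hb => simp only [map_add, LinearMap.add_apply, ha, hb]
  | tmul x y =>
    rw [LinearMap.comp_apply]
    rw [map_associator_hom_tm, tf_tm, tf_tm, tf_tm, tf_tm, mul_assoc]

theorem Idx.compat_leftUnitor (i : Idx F) :
    Idx.Compat ((Idx.unit F).tensor i) i (λ_ _).hom := by
  refine linearMap_ext_tm F fun x y => ?_
  rw [LinearMap.comp_apply]
  rw [tf_tm, ← unitFun_smul_unitVec F x, map_smul, LinearMap.smul_apply, map_smul,
    map_leftUnitor_hom_tm, map_smul, map_smul, unitFun_unitVec]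
  simp

theorem Idx.compat_braiding [BraidedCategory C] {G : C ⥤ ModuleCat.{u} K} [G.Braided]
    (i j : Idx G) : Idx.Compat (i.tensor j) (j.tensor i) (β_ _ _).hom := by
  refine linearMap_ext_tm G fun x y => ?_
  rw [LinearMap.comp_apply]
  rw [map_braiding_hom_tm, tf_tm, tf_tm, mul_comm]

end TensorIdx

/-! ### Compatibility of the relations with morphisms and tensor products. -/

section RelFunctoriality

variable {K : Type u} [Field K] {A : Type u₁} [Category.{v₁} A] [MonoidalCategory A]
  {C : Type u₂} [Category.{v₂} C] [MonoidalCategory C]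
  {J : A ⥤ C} [J.Monoidal] {F : C ⥤ ModuleCat.{u} K} [F.Monoidal]
  {R : Type w} [CommRing R] [Algebra K R] {g : TensorAut (J ⋙ F) R}

theorem rel_map {i j : Idx F} {f : i.obj ⟶ j.obj} (hf : Idx.Compat i j f) :
    rel g i.obj i.fn ≤ (rel g j.obj j.fn).comap (bc F R f) := by
  refine rel_le fun P b b₁ hb hξ p => ?_
  refine (hb.map f).mem_rel (ξ := j.fn) ?_ p
  rw [← LinearMap.comp_assoc, hf, hξ]

/-- The functional of `j` kills `F(f - f')`, so the difference is itself a relation. Modulo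
relations, all compatible morphisms `i ⟶ j` agree, which is why a directed preorder can replace the
category of elements. -/
theorem bc_sub_mem_rel [Preadditive C] [F.Additive] {i j : Idx F} {f f' : i.obj ⟶ j.obj}
    (hf : Idx.Compat i j f) (hf' : Idx.Compat i j f') (v : R ⊗[K] F.obj i.obj) :
    bc F R f v - bc F R f' v ∈ rel g j.obj j.fn := by
  induction v using TensorProduct.induction_on with
  | zero => simp
  | add a b ha hb =>
    rw [map_add, map_add, add_sub_add_comm]
    exact add_mem ha hb
  | tmul r x =>
    have h := (VGood.of_hom g (f - f')).mem_rel (ξ := j.fn) (by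
      rw [F.map_sub, ModuleCat.hom_sub, LinearMap.comp_sub, hf, hf', sub_self]) x
    have h2 := Submodule.smul_mem _ r h
    simpa [TensorProduct.smul_tmul', TensorProduct.tmul_sub, smul_sub] using h2

theorem tensorator_mem_rel {i : Idx F} (j : Idx F) {v : R ⊗[K] F.obj i.obj}
    (hv : v ∈ rel g i.obj i.fn) (w : R ⊗[K] F.obj j.obj) :
    tensorator F R _ _ (v ⊗ₜ w) ∈ rel g (i.tensor j).obj (i.tensor j).fn := by
  induction w using TensorProduct.induction_on with
  | zero => simp
  | add a b ha hb =>
    rw [TensorProduct.tmul_add, map_add]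
    exact add_mem ha hb
  | tmul s y =>
    have hle : rel g i.obj i.fn ≤ (rel g (i.tensor j).obj (i.tensor j).fn).comap
        (tensorator F R _ _ ∘ₗ (TensorProduct.mk R (R ⊗[K] F.obj i.obj)
          (R ⊗[K] F.obj j.obj)).flip (s ⊗ₜ y)) := by
      refine rel_le fun P b b₁ hb hξ p => ?_
      obtain ⟨b', b₁', hb', h, h₁⟩ := hb.tensor j.obj
      have h0 : (i.tensor j).fn ∘ₗ b₁' = 0 := by
        refine linearMap_ext_tm F fun x y => ?_
        rw [LinearMap.comp_apply, h₁]
        refine (tf_tm F i.fn j.fn _ _).trans ?_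
        have := LinearMap.congr_fun hξ x
        rw [LinearMap.comp_apply] at this
        rw [this]
        simp
      have hs : s ⊗ₜ[K] y = s • ((1 : R) ⊗ₜ[K] y) := by simp [TensorProduct.smul_tmul']
      rw [Submodule.mem_comap, LinearMap.comp_apply, LinearMap.flip_apply,
        TensorProduct.mk_apply, hs, TensorProduct.tmul_smul, map_smul, ← h]
      exact Submodule.smul_mem _ s (hb'.mem_rel h0 _)
    exact hle hv

theorem tensorator_mem_rel' [BraidedCategory C] {G : C ⥤ ModuleCat.{u} K} [G.Braided]
    {g : TensorAut (J ⋙ G) R} (i : Idx G) {j : Idx G}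
    (v : R ⊗[K] G.obj i.obj) {w : R ⊗[K] G.obj j.obj} (hw : w ∈ rel g j.obj j.fn) :
    tensorator G R _ _ (v ⊗ₜ w) ∈ rel g (i.tensor j).obj (i.tensor j).fn := by
  have h := rel_map (Idx.compat_braiding j i) (tensorator_mem_rel i hw v)
  rw [Submodule.mem_comap] at h
  rw [← bc_braiding (G := G) w v]
  exact h

end RelFunctoriality

end TannakaSES

end

noncomputable section

namespace TannakaSES

/-! ### The direct limit of the quotients by the relations. -/

section LiftAlg

variable {K : Type u} [Field K] {A : Type u₁} [Category.{v₁} A] [MonoidalCategory A]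
  {C : Type u₂} [Category.{v₂} C] [MonoidalCategory C] [Abelian C]
  {J : A ⥤ C} [J.Monoidal] {F : C ⥤ ModuleCat.{u} K} [F.Monoidal] [F.Additive]
  {R : Type w} [CommRing R] [Algebra K R] (g : TensorAut (J ⋙ F) R)

/-- The quotient by the relation module. -/
def Quo (i : Idx F) : Type (max w u) := (R ⊗[K] F.obj i.obj) ⧸ rel g i.obj i.fn

instance (i : Idx F) : AddCommGroup (Quo g i) :=
  Submodule.Quotient.addCommGroup (rel g i.obj i.fn)

instance (i : Idx F) : Module R (Quo g i) :=
  Submodule.Quotient.module (rel g i.obj i.fn)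

/-- The quotient map. -/
def Quo.mk (i : Idx F) : R ⊗[K] F.obj i.obj →ₗ[R] Quo g i := Submodule.mkQ _

theorem Quo.mk_surjective (i : Idx F) : Function.Surjective (Quo.mk g i) :=
  Submodule.Quotient.mk_surjective _

theorem Quo.mk_eq_zero {i : Idx F} {v : R ⊗[K] F.obj i.obj} :
    Quo.mk g i v = 0 ↔ v ∈ rel g i.obj i.fn :=
  Submodule.Quotient.mk_eq_zero _

/-- Linear maps out of the quotient. -/
def Quo.lift {i : Idx F} {M : Type*} [AddCommGroup M] [Module R M]
    (l : R ⊗[K] F.obj i.obj →ₗ[R] M) (h : ∀ v ∈ rel g i.obj i.fn, l v = 0) : Quo g i →ₗ[R] M :=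
  Submodule.liftQ _ l h

theorem Quo.lift_mk {i : Idx F} {M : Type*} [AddCommGroup M] [Module R M]
    (l : R ⊗[K] F.obj i.obj →ₗ[R] M) (h : ∀ v ∈ rel g i.obj i.fn, l v = 0)
    (v : R ⊗[K] F.obj i.obj) : Quo.lift g l h (Quo.mk g i v) = l v := rfl

/-- The transition maps between the quotients by the relation modules. -/
def trans (i j : Idx F) (h : i ≤ j) : Quo g i →ₗ[R] Quo g j :=
  Quo.lift g (Quo.mk g j ∘ₗ bc F R h.choose) fun _ hv =>
    (Quo.mk_eq_zero g).2 (rel_map h.choose_spec hv)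

theorem trans_mk {i j : Idx F} (h : i ≤ j) {f : i.obj ⟶ j.obj} (hf : Idx.Compat i j f)
    (v : R ⊗[K] F.obj i.obj) : trans g i j h (Quo.mk g i v) = Quo.mk g j (bc F R f v) :=
  (Submodule.Quotient.eq _).2 (bc_sub_mem_rel h.choose_spec hf v)

instance : DirectedSystem (Quo g) (fun i j h => trans g i j h) where
  map_self i x := by
    obtain ⟨v, rfl⟩ := Quo.mk_surjective g i x
    rw [trans_mk g _ (.id i), bc_id]
  map_map i j k h h' x := by
    obtain ⟨v, rfl⟩ := Quo.mk_surjective g _ x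
    have e := trans_mk g h h.choose_spec v
    have e' := trans_mk g h' h'.choose_spec (bc F R h.choose v)
    have e'' := trans_mk g (h.trans h') (h.choose_spec.comp h'.choose_spec) v
    rw [bc_comp] at e''
    rw [e, e', e'']

open Classical in
/-- The `R`-algebra that represents the extensions of `g` to a tensor automorphism of `F`. -/
def LiftAlg : Type (max w u u₂) :=
  Module.DirectLimit (Quo g) (trans g)

namespace LiftAlg

open Classical in
instance : AddCommGroup (LiftAlg g) :=
  Module.DirectLimit.addCommGroup (Quo g) (trans g)

open Classical in
instance : Module R (LiftAlg g) :=
  Module.DirectLimit.module (Quo g) (trans g)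

open Classical in
/-- The matrix coefficients `⟨ξ, h v⟩` of the universal lift. -/
def mc (i : Idx F) : R ⊗[K] F.obj i.obj →ₗ[R] LiftAlg g :=
  Module.DirectLimit.of R (Idx F) _ (trans g) i ∘ₗ Quo.mk g i

theorem mc_bc {i j : Idx F} {f : i.obj ⟶ j.obj} (hf : Idx.Compat i j f)
    (v : R ⊗[K] F.obj i.obj) : mc g j (bc F R f v) = mc g i v := by
  classical
  have h : i ≤ j := ⟨f, hf⟩
  refine Eq.trans ?_ (Module.DirectLimit.of_f (hij := h))
  exact congrArg (Module.DirectLimit.of R (Idx F) _ (trans g) j) (trans_mk g h hf v).symm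

theorem mc_of_mem_rel {i : Idx F} {v : R ⊗[K] F.obj i.obj} (hv : v ∈ rel g i.obj i.fn) :
    mc g i v = 0 := by
  classical
  refine (congrArg (Module.DirectLimit.of R (Idx F) _ (trans g) i)
    ((Quo.mk_eq_zero g).2 hv)).trans (map_zero _)

theorem exists_mc (t : LiftAlg g) : ∃ i v, mc g i v = t := by
  classical
  have : Nonempty (Idx F) := ⟨Idx.unit F⟩
  obtain ⟨i, x, h⟩ := Module.DirectLimit.exists_of (f := trans g) t
  obtain ⟨v, rfl⟩ := Quo.mk_surjective g _ x
  exact ⟨i, v, h⟩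

theorem exists_of_mc_eq_zero {i : Idx F} {v : R ⊗[K] F.obj i.obj} (hv : mc g i v = 0) :
    ∃ (j : Idx F) (f : i.obj ⟶ j.obj), Idx.Compat i j f ∧ bc F R f v ∈ rel g j.obj j.fn := by
  classical
  obtain ⟨j, h, hj⟩ := Module.DirectLimit.of.zero_exact (f := trans g) hv
  refine ⟨j, h.choose, h.choose_spec, ?_⟩
  exact (Quo.mk_eq_zero g).1 hj

section Lift

variable {M : Type*} [AddCommGroup M] [Module R M]

open Classical in
/-- Linear maps out of the universal algebra. -/
def lift (l : ∀ i : Idx F, R ⊗[K] F.obj i.obj →ₗ[R] M)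
    (h0 : ∀ i : Idx F, ∀ v ∈ rel g i.obj i.fn, l i v = 0)
    (h1 : ∀ i j f, Idx.Compat i j f → ∀ v, l j (bc F R f v) = l i v) : LiftAlg g →ₗ[R] M :=
  Module.DirectLimit.lift R (Idx F) _ (trans g) (fun i => Quo.lift g (l i) (h0 i))
    fun i j h x => by
      obtain ⟨v, rfl⟩ := Quo.mk_surjective g _ x
      exact h1 i j _ h.choose_spec v

theorem lift_mc {l : ∀ i : Idx F, R ⊗[K] F.obj i.obj →ₗ[R] M}
    {h0 : ∀ i : Idx F, ∀ v ∈ rel g i.obj i.fn, l i v = 0}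
    {h1 : ∀ i j f, Idx.Compat i j f → ∀ v, l j (bc F R f v) = l i v} (i : Idx F)
    (v : R ⊗[K] F.obj i.obj) : lift g l h0 h1 (mc g i v) = l i v := by
  classical
  exact Module.DirectLimit.lift_of (f := trans g) _ _ _

theorem hom_ext {l l' : LiftAlg g →ₗ[R] M} (h : ∀ i v, l (mc g i v) = l' (mc g i v)) :
    l = l' := by
  ext t
  obtain ⟨i, v, rfl⟩ := exists_mc g t
  exact h i v

end Lift

/-- Equational criterion: a linear relation among finitely many elements of the limit already holds
at some index, and is trivial there. -/
theorem flat (h : ∀ i : Idx F, Module.Flat R (Quo g i)) :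
    Module.Flat R (LiftAlg g) := by
  classical
  have : Nonempty (Idx F) := ⟨Idx.unit F⟩
  refine Module.Flat.of_forall_isTrivialRelation fun {n f x} hfx => ?_
  have hx : ∀ i, ∃ (j : Idx F) (y : Quo g j),
      Module.DirectLimit.of R (Idx F) _ (trans g) j y = x i :=
    fun i => Module.DirectLimit.exists_of (f := trans g) (x i)
  choose j y hy using hx
  obtain ⟨k, hk⟩ := Finite.exists_le j
  have hy' : ∀ i, Module.DirectLimit.of R (Idx F) _ (trans g) k (trans g (j i) k (hk i) (y i)) =
      x i := fun i => Module.DirectLimit.of_f.trans (hy i)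
  have hsum : Module.DirectLimit.of R (Idx F) _ (trans g) k
      (∑ i, f i • trans g (j i) k (hk i) (y i)) = 0 := by
    rw [map_sum]
    simp only [map_smul, hy']
    exact hfx
  obtain ⟨l, hl, hzero⟩ := Module.DirectLimit.of.zero_exact (f := trans g) hsum
  rw [map_sum] at hzero
  simp only [map_smul] at hzero
  obtain ⟨m, a, z, hz, ha⟩ := (h l).isTrivialRelation_of_sum_smul_eq_zero hzero
  refine ⟨m, a, fun i => Module.DirectLimit.of R (Idx F) _ (trans g) l (z i), fun i => ?_, ha⟩
  rw [← hy' i]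
  have h2 := congrArg (Module.DirectLimit.of R (Idx F) _ (trans g) l) (hz i)
  rw [Module.DirectLimit.of_f] at h2
  rw [h2, map_sum]
  simp only [map_smul]
  rfl

/-! ### The multiplication -/

section Mul

/-- The unit of the universal algebra. -/
instance : One (LiftAlg g) := ⟨mc g (Idx.unit F) (1 ⊗ₜ unitVec F)⟩

theorem one_def : (1 : LiftAlg g) = mc g (Idx.unit F) (1 ⊗ₜ unitVec F) := rfl

/-- The product of matrix coefficients. -/
def mcMul (i j : Idx F) : R ⊗[K] F.obj i.obj →ₗ[R] R ⊗[K] F.obj j.obj →ₗ[R] LiftAlg g :=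
  (TensorProduct.mk R _ _).compr₂ (mc g (i.tensor j) ∘ₗ tensorator F R i.obj j.obj)

theorem mcMul_apply (i j : Idx F) (v : R ⊗[K] F.obj i.obj) (w : R ⊗[K] F.obj j.obj) :
    mcMul g i j v w = mc g (i.tensor j) (tensorator F R _ _ (v ⊗ₜ w)) := rfl

theorem mcMul_bc {i i' j j' : Idx F} {f : i.obj ⟶ i'.obj} (hf : Idx.Compat i i' f)
    {f' : j.obj ⟶ j'.obj} (hf' : Idx.Compat j j' f') (v : R ⊗[K] F.obj i.obj)
    (w : R ⊗[K] F.obj j.obj) : mcMul g i' j' (bc F R f v) (bc F R f' w) = mcMul g i j v w := by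
  rw [mcMul_apply, mcMul_apply, ← bc_tensorator]
  exact mc_bc g (hf.tensor hf') _

end Mul

end LiftAlg

end LiftAlg

section LiftAlgMul

variable {K : Type u} [Field K] {A : Type u₁} [Category.{v₁} A] [MonoidalCategory A]
  {C : Type u₂} [Category.{v₂} C] [MonoidalCategory C] [BraidedCategory C] [Abelian C]
  {J : A ⥤ C} [J.Monoidal] {F : C ⥤ ModuleCat.{u} K} [F.Braided] [F.Additive]
  {R : Type w} [CommRing R] [Algebra K R] (g : TensorAut (J ⋙ F) R)

namespace LiftAlg

theorem mcMul_eq_zero_left {i : Idx F} {v : R ⊗[K] F.obj i.obj} (hv : v ∈ rel g i.obj i.fn)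
    (j : Idx F) (w : R ⊗[K] F.obj j.obj) : mcMul g i j v w = 0 := by
  rw [mcMul_apply]
  exact mc_of_mem_rel g (tensorator_mem_rel j hv w)

theorem mcMul_eq_zero_right (i : Idx F) (v : R ⊗[K] F.obj i.obj) {j : Idx F}
    {w : R ⊗[K] F.obj j.obj} (hw : w ∈ rel g j.obj j.fn) : mcMul g i j v w = 0 := by
  rw [mcMul_apply]
  exact mc_of_mem_rel g (tensorator_mem_rel' i v hw)

/-- Multiplication by matrix coefficients. -/
def mcMulHom (i : Idx F) : LiftAlg g →ₗ[R] R ⊗[K] F.obj i.obj →ₗ[R] LiftAlg g :=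
  lift g (fun j => (mcMul g i j).flip)
    (fun _ _ hw => LinearMap.ext fun v => mcMul_eq_zero_right g i v hw)
    (fun j j' f hf w => LinearMap.ext fun v => by
      have h := mcMul_bc g (.id i) hf v w
      rw [bc_id] at h
      exact h)

theorem mcMulHom_mc (i j : Idx F) (v : R ⊗[K] F.obj i.obj) (w : R ⊗[K] F.obj j.obj) :
    mcMulHom g i (mc g j w) v = mcMul g i j v w := by
  rw [mcMulHom, lift_mc]
  rfl

/-- The multiplication of the universal algebra. -/
def mulHom : LiftAlg g →ₗ[R] LiftAlg g →ₗ[R] LiftAlg g :=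
  lift g (fun i => (mcMulHom g i).flip)
    (fun i v hv => hom_ext g fun j w => by
      rw [LinearMap.flip_apply, mcMulHom_mc, mcMul_eq_zero_left g hv]
      rfl)
    (fun i i' f hf v => hom_ext g fun j w => by
      rw [LinearMap.flip_apply, LinearMap.flip_apply, mcMulHom_mc, mcMulHom_mc]
      have h := mcMul_bc g hf (.id j) v w
      rw [bc_id] at h
      exact h)

instance : Mul (LiftAlg g) := ⟨fun a b => mulHom g a b⟩

theorem mul_def (a b : LiftAlg g) : a * b = mulHom g a b := rfl

theorem mc_mul_mc (i j : Idx F) (v : R ⊗[K] F.obj i.obj) (w : R ⊗[K] F.obj j.obj) :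
    mc g i v * mc g j w = mc g (i.tensor j) (tensorator F R _ _ (v ⊗ₜ w)) := by
  rw [mul_def, mulHom, lift_mc, LinearMap.flip_apply, mcMulHom_mc]
  rfl

theorem mul_comm' (a b : LiftAlg g) : a * b = b * a := by
  obtain ⟨i, v, rfl⟩ := exists_mc g a
  obtain ⟨j, w, rfl⟩ := exists_mc g b
  rw [mc_mul_mc, mc_mul_mc, ← mc_bc g (Idx.compat_braiding i j), bc_braiding]

theorem mul_assoc' (a b c : LiftAlg g) : a * b * c = a * (b * c) := by
  obtain ⟨i, v, rfl⟩ := exists_mc g a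
  obtain ⟨j, w, rfl⟩ := exists_mc g b
  obtain ⟨k, x, rfl⟩ := exists_mc g c
  rw [mc_mul_mc, mc_mul_mc, mc_mul_mc, mc_mul_mc, ← mc_bc g (Idx.compat_associator i j k),
    bc_associator]

theorem one_mul' (a : LiftAlg g) : 1 * a = a := by
  obtain ⟨i, v, rfl⟩ := exists_mc g a
  rw [one_def, mc_mul_mc, ← mc_bc g (Idx.compat_leftUnitor i), bc_leftUnitor]

instance : CommRing (LiftAlg g) :=
  { (inferInstance : AddCommGroup (LiftAlg g)), (inferInstance : Mul (LiftAlg g)),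
    (inferInstance : One (LiftAlg g)) with
    left_distrib := fun a b c => map_add (mulHom g a) b c
    right_distrib := fun a b c => by
      rw [mul_def, map_add]; rfl
    zero_mul := fun a => by rw [mul_def, map_zero]; rfl
    mul_zero := fun a => map_zero (mulHom g a)
    mul_assoc := mul_assoc' g
    one_mul := one_mul' g
    mul_one := fun a => by rw [mul_comm', one_mul']
    mul_comm := mul_comm' g }

instance : Algebra R (LiftAlg g) :=
  Algebra.ofModule (fun r a b => by rw [mul_def, map_smul]; rfl)
    (fun r a b => map_smul (mulHom g a) r b)

instance : Algebra K (LiftAlg g) :=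
  ((algebraMap R (LiftAlg g)).comp (algebraMap K R)).toAlgebra

instance : IsScalarTower K R (LiftAlg g) := IsScalarTower.of_algebraMap_eq fun _ => rfl

end LiftAlg

end LiftAlgMul

/-! ### Faithful flatness. -/

section FaithfullyFlat

variable {K : Type u} [Field K] {A : Type u₁} [Category.{v₁} A] [MonoidalCategory A]
  [Preadditive A] [HasBinaryBiproducts A]
  {C : Type u₂} [Category.{v₂} C] [MonoidalCategory C] [BraidedCategory C] [Abelian C]
  [MonoidalPreadditive C] [LeftRigidCategory C] {J : A ⥤ C} [J.Monoidal] [J.Additive]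
  {F : C ⥤ ModuleCat.{u} K} [F.Braided] [F.Additive] [PreservesFiniteColimits F]
  {R : Type w} [CommRing R] [Algebra K R] (g : TensorAut (J ⋙ F) R)

namespace LiftAlg

theorem exists_of_mem_smul_top (I : Ideal R) (t : LiftAlg g)
    (ht : t ∈ I • (⊤ : Submodule R (LiftAlg g))) :
    ∃ (i : Idx F) (v : R ⊗[K] F.obj i.obj), v ∈ I • (⊤ : Submodule R (R ⊗[K] F.obj i.obj)) ∧
      mc g i v = t := by
  have hbc : ∀ {i j : Idx F} (f : i.obj ⟶ j.obj) (v : R ⊗[K] F.obj i.obj),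
      v ∈ I • (⊤ : Submodule R (R ⊗[K] F.obj i.obj)) →
      bc F R f v ∈ I • (⊤ : Submodule R (R ⊗[K] F.obj j.obj)) := fun f v hv => by
    have h := Submodule.mem_map_of_mem (f := bc F R f) hv
    rw [Submodule.map_smul''] at h
    exact Submodule.smul_mono le_rfl le_top h
  induction ht using Submodule.smul_induction_on' with
  | smul r hr t _ =>
    obtain ⟨i, v, rfl⟩ := exists_mc g t
    exact ⟨i, r • v, Submodule.smul_mem_smul hr trivial, map_smul _ _ _⟩
  | add a _ b _ ha hb =>
    obtain ⟨i, v, hv, rfl⟩ := ha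
    obtain ⟨j, w, hw, rfl⟩ := hb
    -- Both elements are moved to the direct sum of the two indices, where they can be added.
    refine ⟨i.sum j, _, add_mem (hbc biprod.inl v hv) (hbc biprod.inr w hw), ?_⟩
    rw [map_add, mc_bc g (i.compat_inl j), mc_bc g (i.compat_inr j)]

theorem faithfullyFlat (hsub : SubobjectsFrom J F) : Module.FaithfullyFlat R (LiftAlg g) := by
  have hflat : Module.Flat R (LiftAlg g) := by
    refine flat g fun i => ?_
    obtain ⟨π, hπ, hπ'⟩ := exists_projection (g := g) hsub i.obj i.fn
    -- The complementary projection `1 - π` descends to a section of the quotient map, so the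
    -- quotient is a retract of a free module.
    refine Module.Flat.of_retract (M := R ⊗[K] F.obj i.obj)
      (Quo.lift g (LinearMap.id - π) fun v hv => ?_) (Quo.mk g i) ?_
    · simp [hπ' v hv]
    · ext x
      obtain ⟨v, rfl⟩ := Quo.mk_surjective g i x
      rw [LinearMap.comp_apply, Quo.lift_mk, LinearMap.sub_apply, map_sub,
        (Quo.mk_eq_zero g).2 (hπ v), sub_zero]
      rfl
  refine ⟨fun {m} hm htop => ?_⟩
  -- If `m` generated the whole algebra, `1` would be a coefficient of some `v` with entries in `m`.
  -- At a later index `j` the images of `v` and of `1` differ by a relation, and a functional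
  -- killing relations with value `1` on the image of `1` yields `1 ∈ m`.
  obtain ⟨i, v, hv, h⟩ := exists_of_mem_smul_top g m 1 (by rw [htop]; trivial)
  rw [one_def, ← mc_bc g (i.compat_inl (Idx.unit F)), ← mc_bc g (i.compat_inr (Idx.unit F)),
    ← sub_eq_zero, ← map_sub] at h
  obtain ⟨j, f, hf, hj⟩ := exists_of_mc_eq_zero g h
  rw [map_sub, ← bc_comp, ← bc_comp] at hj
  have hc := (i.compat_inr (Idx.unit F)).comp hf
  have hne : j.fn ((F.map ((biprod.inr : 𝟙_ C ⟶ i.obj ⊞ 𝟙_ C) ≫ f)).hom (unitVec F)) ≠ 0 := by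
    have := LinearMap.congr_fun hc (unitVec F)
    rw [LinearMap.comp_apply] at this
    rw [this, unitFun_unitVec]
    exact one_ne_zero
  obtain ⟨l, hl, hl'⟩ := exists_functional (g := g) hsub j.obj j.fn _ hne
  have h1 := hl _ hj
  rw [map_sub, LinearMap.baseChange_tmul, hl', sub_eq_zero] at h1
  have h2 := Submodule.mem_map_of_mem (f := l ∘ₗ bc F R (biprod.inl ≫ f)) hv
  rw [Submodule.map_smul''] at h2
  have h3 := Submodule.smul_mono (le_refl m) (le_top (a := Submodule.map _ _)) h2
  rw [LinearMap.comp_apply, h1] at h3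
  refine hm.ne_top ((Ideal.eq_top_iff_one m).2 ?_)
  simpa using h3

end LiftAlg

end FaithfullyFlat

end TannakaSES

end

noncomputable section

namespace TannakaSES

/-! ### The universal lift -/

section Invertibility

variable {K : Type u} [Field K] {C : Type u₂} [Category.{v₂} C] [MonoidalCategory C]
  [LeftRigidCategory C] {F : C ⥤ ModuleCat.{u} K} [F.Monoidal]
  {S : Type w} [CommRing S] [Algebra K S]

theorem contr₁_baseChange_tensorator {X Y : C} (ζ : F.obj X →ₗ[K] K) (a : S ⊗[K] F.obj X)
    (b : S ⊗[K] F.obj Y) :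
    (contr₁ ζ : F.obj (X ⊗ Y) →ₗ[K] F.obj Y).baseChange S (tensorator F S X Y (a ⊗ₜ b)) =
      scal S ζ a • b := by
  induction a using TensorProduct.induction_on with
  | zero => simp
  | add a a' ha ha' => simp only [TensorProduct.add_tmul, map_add, ha, ha', add_smul]
  | tmul r x =>
    induction b using TensorProduct.induction_on with
    | zero => simp
    | add b b' hb hb' => simp only [TensorProduct.tmul_add, map_add, hb, hb', smul_add]
    | tmul s y =>
      rw [tensorator_one_tmul, LinearMap.baseChange_tmul, contr₁_tm, scal_tmul,
        TensorProduct.tmul_smul, TensorProduct.smul_tmul', TensorProduct.smul_tmul',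
        Algebra.smul_def, smul_eq_mul]
      congr 1
      ring

/-- A monoidal endomorphism of a functor on a rigid category is invertible. -/
theorem bijective_of_monoidal (h : ∀ Y : C, S ⊗[K] F.obj Y →ₗ[S] S ⊗[K] F.obj Y)
    (hnat : ∀ {X Y : C} (f : X ⟶ Y) (x : F.obj X),
      h Y (1 ⊗ₜ (F.map f).hom x) = bc F S f (h X (1 ⊗ₜ x)))
    (htensor : ∀ {X Y : C} (x : F.obj X) (y : F.obj Y), h (X ⊗ Y) (1 ⊗ₜ tm F x y) =
      tensorator F S X Y (h X (1 ⊗ₜ x) ⊗ₜ h Y (1 ⊗ₜ y)))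
    (hunit : h (𝟙_ C) (1 ⊗ₜ unitVec F) = 1 ⊗ₜ unitVec F) (Y : C) :
    Function.Bijective (h Y) := by
  have hfin := finite_obj F Y
  have hsurj : Function.Surjective (h Y) := by
    obtain ⟨n, θ, y, hc⟩ := exists_coevaluation F Y
    -- The coevaluation vector is fixed by `h`. Contracting its first factor with `z` writes `1 ⊗ z`
    -- as a combination of values of `h Y`; injectivity then follows because the module is finite.
    have key : ∑ i, tensorator F S _ _ (h (ᘁY) (1 ⊗ₜ θ i) ⊗ₜ h Y (1 ⊗ₜ y i)) =
        ∑ i, (1 : S) ⊗ₜ[K] tm F (θ i) (y i) := by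
      have h1 := hnat (η_ (ᘁY) Y) (unitVec F)
      rw [hunit, LinearMap.baseChange_tmul, hc, TensorProduct.tmul_sum, map_sum] at h1
      simpa only [htensor] using h1
    have hz : ∀ z : F.obj Y, (1 : S) ⊗ₜ[K] z ∈ LinearMap.range (h Y) := fun z => by
      have h1 := congrArg ((contr₁ ((hat F).flip z) :
        F.obj ((ᘁY) ⊗ Y) →ₗ[K] F.obj Y).baseChange S) key
      simp only [map_sum, contr₁_baseChange_tensorator, LinearMap.baseChange_tmul, contr₁_tm,
        LinearMap.flip_apply] at h1
      rw [← TensorProduct.tmul_sum, sum_hat_smul F hc] at h1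
      rw [← h1]
      exact sum_mem fun i _ => Submodule.smul_mem _ _ ⟨_, rfl⟩
    intro v
    change v ∈ LinearMap.range (h Y)
    induction v using TensorProduct.induction_on with
    | zero => exact zero_mem _
    | add a b ha hb => exact add_mem ha hb
    | tmul s z =>
      have hs : s ⊗ₜ[K] z = s • ((1 : S) ⊗ₜ[K] z) := by simp [TensorProduct.smul_tmul']
      rw [hs]
      exact Submodule.smul_mem _ s (hz z)
  exact ⟨OrzechProperty.injective_of_surjective_endomorphism (h Y) hsurj, hsurj⟩

/-- A tensor automorphism is given by a monoidal endomorphism. -/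
def TensorAut.ofMonoidal (h : ∀ Y : C, S ⊗[K] F.obj Y →ₗ[S] S ⊗[K] F.obj Y)
    (hnat : ∀ {X Y : C} (f : X ⟶ Y) (x : F.obj X),
      h Y (1 ⊗ₜ (F.map f).hom x) = bc F S f (h X (1 ⊗ₜ x)))
    (htensor : ∀ {X Y : C} (x : F.obj X) (y : F.obj Y), h (X ⊗ Y) (1 ⊗ₜ tm F x y) =
      tensorator F S X Y (h X (1 ⊗ₜ x) ⊗ₜ h Y (1 ⊗ₜ y)))
    (hunit : h (𝟙_ C) (1 ⊗ₜ unitVec F) = 1 ⊗ₜ unitVec F) : TensorAut F S where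
  app Y := LinearEquiv.ofBijective (h Y) (bijective_of_monoidal h hnat htensor hunit Y)
  naturality f := hom_ext_one_tmul fun x => by
    refine (hnat f x).symm.trans ?_
    rw [LinearMap.comp_apply, LinearMap.baseChange_tmul]
    rfl
  tensor X Y := hom_ext_tmul_tmul fun x y => by
    rw [LinearMap.comp_apply, tensorator_one_tmul, mul_one]
    exact htensor x y
  unit := hunit

end Invertibility

section

variable {K : Type u} [Field K] {C : Type u₂} [Category.{v₂} C] [Preadditive C]
  {F : C ⥤ ModuleCat.{u} K} [F.Additive] {R : Type w} [CommRing R] [Algebra K R]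

theorem bc_add {X Y : C} (f f' : X ⟶ Y) (v : R ⊗[K] F.obj X) :
    bc F R (f + f') v = bc F R f v + bc F R f' v := by
  rw [bc, F.map_add, ModuleCat.hom_add, LinearMap.baseChange_add]
  rfl

end

/-! ### Assembling the matrix coefficients into a lift of `g`. -/

section Universal

variable {K : Type u} [Field K] {A : Type u₁} [Category.{v₁} A] [MonoidalCategory A]
  {C : Type u₂} [Category.{v₂} C] [MonoidalCategory C] [BraidedCategory C] [Abelian C]
  [Linear K C] [MonoidalPreadditive C] [LeftRigidCategory C] {J : A ⥤ C} [J.Monoidal]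
  {F : C ⥤ ModuleCat.{u} K} [F.Braided] [F.Additive] [F.Linear K]
  {R : Type w} [CommRing R] [Algebra K R] (g : TensorAut (J ⋙ F) R)

namespace LiftAlg

theorem mc_add (Y : C) (ξ ξ' : F.obj Y →ₗ[K] K) (v : R ⊗[K] F.obj Y) :
    mc g ⟨Y, ξ + ξ'⟩ v = mc g ⟨Y, ξ⟩ v + mc g ⟨Y, ξ'⟩ v := by
  -- The morphism is the diagonal of `Y`; it pulls `ξ ⊕ ξ'` back to `ξ + ξ'`.
  have h : Idx.Compat (⟨Y, ξ + ξ'⟩ : Idx F) (Idx.sum ⟨Y, ξ⟩ ⟨Y, ξ'⟩)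
      (biprod.inl + biprod.inr) := by
    ext x
    simp only [LinearMap.comp_apply, LinearMap.add_apply]
    rw [← map_comp_apply, ← map_comp_apply]
    simp
  rw [← mc_bc g h, bc_add, map_add, mc_bc g (Idx.compat_inl ⟨Y, ξ⟩ ⟨Y, ξ'⟩),
    mc_bc g (Idx.compat_inr ⟨Y, ξ⟩ ⟨Y, ξ'⟩)]

theorem algebraMap_smul_eq (c : K) (t : LiftAlg g) : c • t = algebraMap K R c • t := by
  rw [Algebra.smul_def, Algebra.smul_def]
  rfl

theorem mc_smul (Y : C) (c : K) (ξ : F.obj Y →ₗ[K] K) (v : R ⊗[K] F.obj Y) :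
    mc g ⟨Y, c • ξ⟩ v = c • mc g ⟨Y, ξ⟩ v := by
  have h : Idx.Compat (⟨Y, c • ξ⟩ : Idx F) ⟨Y, ξ⟩ (c • 𝟙 Y) := by
    ext x
    simp [Functor.map_smul]
  have hv : bc F R (c • 𝟙 Y) v = algebraMap K R c • v := by
    rw [bc, F.map_smul, F.map_id, ModuleCat.hom_smul, LinearMap.baseChange_smul]
    simp
  rw [← mc_bc g h, hv, map_smul, algebraMap_smul_eq]

/-- The matrix coefficients of the universal lift as a function of the functional. -/
def mcFun (Y : C) (y : F.obj Y) : (F.obj Y →ₗ[K] K) →ₗ[K] LiftAlg g where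
  toFun ξ := mc g ⟨Y, ξ⟩ (1 ⊗ₜ y)
  map_add' ξ ξ' := mc_add g Y ξ ξ' _
  map_smul' c ξ := mc_smul g Y c ξ _

theorem mcFun_apply (Y : C) (y : F.obj Y) (ξ : F.obj Y →ₗ[K] K) :
    mcFun g Y y ξ = mc g ⟨Y, ξ⟩ (1 ⊗ₜ y) := rfl

/-- The coefficient of `y` is linear in `ξ` and `F(Y)` is finite-dimensional, so all its values come
from pairing with one vector. -/
theorem exists_univ (Y : C) (y : F.obj Y) : ∃ v : LiftAlg g ⊗[K] F.obj Y,
    ∀ ξ : F.obj Y →ₗ[K] K, scal (LiftAlg g) ξ v = mcFun g Y y ξ := by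
  have hfin := finite_obj F Y
  let b := Module.finBasis K (F.obj Y)
  refine ⟨∑ i, mcFun g Y y (b.coord i) ⊗ₜ b i, fun ξ => ?_⟩
  have hξ : ξ = ∑ i, ξ (b i) • b.coord i := by
    refine b.ext fun j => ?_
    simp
  conv_rhs => rw [hξ]
  rw [map_sum, map_sum]
  refine Finset.sum_congr rfl fun i _ => ?_
  rw [scal_tmul, map_smul, Algebra.smul_def, mul_comm]

/-- The universal lift on vectors of `F(Y)`. -/
def univ (Y : C) : F.obj Y →ₗ[K] LiftAlg g ⊗[K] F.obj Y where
  toFun y := (exists_univ g Y y).choose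
  map_add' y y' := by
    have := finite_obj F Y
    refine eq_of_scal_eq fun ξ => ?_
    rw [map_add, (exists_univ g Y _).choose_spec, (exists_univ g Y _).choose_spec,
      (exists_univ g Y _).choose_spec, mcFun_apply, TensorProduct.tmul_add, map_add]
    rfl
  map_smul' c y := by
    have := finite_obj F Y
    refine eq_of_scal_eq fun ξ => ?_
    have h : (1 : R) ⊗ₜ[K] (c • y) = algebraMap K R c • ((1 : R) ⊗ₜ[K] y) := by
      simp [TensorProduct.smul_tmul']
    rw [RingHom.id_apply, ← algebraMap_smul (LiftAlg g) c (exists_univ g Y y).choose, map_smul,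
      (exists_univ g Y _).choose_spec,
      (exists_univ g Y _).choose_spec, mcFun_apply, h, map_smul, ← algebraMap_smul_eq,
      Algebra.smul_def]
    rfl

/-- The components of the universal lift. -/
def univHom (Y : C) : LiftAlg g ⊗[K] F.obj Y →ₗ[LiftAlg g] LiftAlg g ⊗[K] F.obj Y :=
  LinearMap.liftBaseChange (LiftAlg g) (univ g Y)

theorem scal_univHom (Y : C) (y : F.obj Y) (ξ : F.obj Y →ₗ[K] K) :
    scal (LiftAlg g) ξ (univHom g Y (1 ⊗ₜ y)) = mc g ⟨Y, ξ⟩ (1 ⊗ₜ y) := by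
  rw [univHom, LinearMap.liftBaseChange_tmul, one_smul]
  exact (exists_univ g Y y).choose_spec ξ

theorem univHom_naturality {X Y : C} (f : X ⟶ Y) (x : F.obj X) :
    univHom g Y (1 ⊗ₜ (F.map f).hom x) = bc F (LiftAlg g) f (univHom g X (1 ⊗ₜ x)) := by
  have := finite_obj F Y
  refine eq_of_scal_eq fun ξ => ?_
  rw [scal_univHom, scal_baseChange, scal_univHom]
  have h : Idx.Compat (⟨X, ξ ∘ₗ (F.map f).hom⟩ : Idx F) ⟨Y, ξ⟩ f := rfl
  have h2 := mc_bc g h (1 ⊗ₜ x)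
  rwa [LinearMap.baseChange_tmul] at h2

/-- Products `ξ ⊗ ξ'` span the dual of `F(X ⊗ Y)`. Multiplicativity of the universal lift can thus
be read off from `mc_mul_mc`. -/
theorem eq_of_scal_tf_eq {S : Type*} [CommRing S] [Algebra K S] {X Y : C}
    {v v' : S ⊗[K] F.obj (X ⊗ Y)}
    (h : ∀ (ξ : F.obj X →ₗ[K] K) (ξ' : F.obj Y →ₗ[K] K),
      scal S (tf F ξ ξ') v = scal S (tf F ξ ξ') v') : v = v' := by
  have := finite_obj F X
  have := finite_obj F Y
  have := finite_obj F (X ⊗ Y)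
  let b := Module.finBasis K (F.obj X)
  let c := Module.finBasis K (F.obj Y)
  refine eq_of_scal_eq fun ζ => ?_
  have hζ : ζ = ∑ i, ∑ j, ζ (tm F (b i) (c j)) • tf F (b.coord i) (c.coord j) := by
    have h2 : (tm F).compr₂ ζ = (tm F).compr₂
        (∑ i, ∑ j, ζ (tm F (b i) (c j)) • tf F (b.coord i) (c.coord j)) := by
      refine b.ext fun i => c.ext fun j => ?_
      simp [tf_tm, Finsupp.single_apply]
    exact linearMap_ext_tm F fun x y => LinearMap.congr_fun₂ h2 x y
  have key : ∀ v : S ⊗[K] F.obj (X ⊗ Y), scal S ζ v = ∑ i, ∑ j,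
      algebraMap K S (ζ (tm F (b i) (c j))) * scal S (tf F (b.coord i) (c.coord j)) v := by
    intro v
    conv_lhs => rw [hζ]
    induction v using TensorProduct.induction_on with
    | zero => simp
    | add v v' hv hv' => simp only [map_add, hv, hv', mul_add, Finset.sum_add_distrib]
    | tmul s m =>
      simp only [scal_tmul, LinearMap.sum_apply, LinearMap.smul_apply, map_sum, smul_eq_mul,
        map_mul, Finset.mul_sum]
      refine Finset.sum_congr rfl fun i _ => Finset.sum_congr rfl fun j _ => ?_
      ring
  rw [key, key]
  simp only [h]

theorem univHom_tensor {X Y : C} (x : F.obj X) (y : F.obj Y) :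
    univHom g (X ⊗ Y) (1 ⊗ₜ tm F x y) =
      tensorator F (LiftAlg g) X Y (univHom g X (1 ⊗ₜ x) ⊗ₜ univHom g Y (1 ⊗ₜ y)) := by
  refine eq_of_scal_tf_eq fun ξ ξ' => ?_
  rw [scal_univHom, scal_tf_tensorator, scal_univHom, scal_univHom, mc_mul_mc,
    tensorator_one_tmul, mul_one]

theorem univHom_unit : univHom g (𝟙_ C) (1 ⊗ₜ unitVec F) = 1 ⊗ₜ unitVec F := by
  have := finite_obj F (𝟙_ C)
  refine eq_of_scal_eq fun ξ => ?_
  have hξ : ξ = ξ (unitVec F) • unitFun F := by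
    ext x
    rw [← unitFun_smul_unitVec F x]
    simp [unitFun_unitVec, mul_comm]
  rw [hξ, scal_univHom, mc_smul, scal_smul, scal_tmul, unitFun_unitVec, Algebra.smul_def]
  simp only [map_one, mul_one]
  exact (congrArg _ (one_def g).symm).trans (mul_one _)

/-- The universal lift. -/
def lifted : TensorAut F (LiftAlg g) :=
  TensorAut.ofMonoidal (univHom g) (univHom_naturality g) (univHom_tensor g) (univHom_unit g)

variable [Preadditive A] [HasBinaryBiproducts A] [J.Additive]

/-- In `J(Z) ⊞ 𝟙` with the functional `ζ ⊕ 1`, the function `z ↦ ⟨ζ, g z⟩ • 1 - z` specializes at `g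
= 1` to one killed by the functional. It is therefore a relation, and it identifies the two
coefficients. -/
theorem mc_eq_coeff (Z : A) (ζ : F.obj (J.obj Z) →ₗ[K] K) (z : F.obj (J.obj Z)) :
    mc g ⟨J.obj Z, ζ⟩ (1 ⊗ₜ z) = algebraMap R (LiftAlg g) (coeff g Z ζ z) := by
  rw [Algebra.algebraMap_eq_smul_one, one_def, ← map_smul,
    ← mc_bc g (Idx.compat_inl ⟨J.obj Z, ζ⟩ (Idx.unit F)),
    ← mc_bc g (Idx.compat_inr ⟨J.obj Z, ζ⟩ (Idx.unit F)), eq_comm, ← sub_eq_zero, ← map_sub]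
  refine mc_of_mem_rel g ?_
  have hv := ((VGood.of_coeff g Z ζ).map (biprod.inr : 𝟙_ C ⟶ J.obj Z ⊞ 𝟙_ C)).add
    (VGood.of_hom g (-(biprod.inl : J.obj Z ⟶ J.obj Z ⊞ 𝟙_ C)))
  have h := hv.mem_rel (ξ := (Idx.sum ⟨J.obj Z, ζ⟩ (Idx.unit F)).fn) ?_ z
  · convert h using 1
    simp only [LinearMap.add_apply, LinearMap.comp_apply, F.map_neg, ModuleCat.hom_neg,
      LinearMap.neg_apply, map_neg, ← sub_eq_add_neg]
    congr 1
    rw [map_smul, LinearMap.baseChange_tmul]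
    simp [TensorProduct.smul_tmul']
  · ext x
    simp only [LinearMap.add_apply, LinearMap.comp_apply, F.map_neg, ModuleCat.hom_neg,
      LinearMap.neg_apply, map_neg, LinearMap.toSpanSingleton_apply, map_smul, map_add]
    simp only [← map_comp_apply]
    simp [unitFun_unitVec]

theorem exists_lift : ∃ h : TensorAut F (LiftAlg g),
    TensorAut.restrict J h =
      TensorAut.baseChange (IsScalarTower.toAlgHom K R (LiftAlg g)) g := by
  refine ⟨lifted g, ?_⟩
  refine TensorAut.ext (funext fun Z => LinearEquiv.toLinearMap_injective ?_)
  refine hom_ext_one_tmul fun z => ?_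
  have := finite_obj F (J.obj Z)
  refine eq_of_scal_eq (K := K) (M := F.obj (J.obj Z)) fun ζ => ?_
  refine (scal_univHom g (J.obj Z) z ζ).trans ?_
  rw [mc_eq_coeff]
  refine Eq.trans ?_ (congrArg (scal (LiftAlg g) ζ) (scalarExt_one_tmul _ _ z)).symm
  have key : ∀ v : R ⊗[K] F.obj (J.obj Z), algebraMap R (LiftAlg g) (scal R ζ v) =
      scal (LiftAlg g) ζ ((IsScalarTower.toAlgHom K R (LiftAlg g)).toLinearMap.rTensor _ v) := by
    intro v
    induction v using TensorProduct.induction_on with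
    | zero => simp
    | add a b ha hb => simp only [map_add, ha, hb]
    | tmul r m =>
      simp only [LinearMap.rTensor_tmul, scal_tmul, map_mul]
      rfl
  exact key _

end LiftAlg

end Universal

end TannakaSES

end

noncomputable section

namespace TannakaSES

/-! ### Surjectivity -/

section Surjectivity

variable {K : Type u} [Field K] {A : TensorCat.{v₁, u, u₁} K} {C : TensorCat.{v₂, u, u₂} K}
  {D : TensorCat.{v₃, u, u₃} K}

theorem isSurjective_homP (J : TensorFunctor A C) (H : TensorFunctor C D) (ω : FiberFunctor D)
    (hsub : SubobjectsFrom J.functor (H.functor ⋙ ω.functor)) :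
    IsSurjective (homP.{max w u u₃} J H ω) := by
  intro R g
  let g' : TensorAut (J.functor ⋙ H.functor ⋙ ω.functor) R := g
  have hff := LiftAlg.faithfullyFlat (g := g') hsub
  obtain ⟨h, hh⟩ := LiftAlg.exists_lift g'
  refine ⟨CommAlgCat.of K (LiftAlg g'),
    CommAlgCat.ofHom (IsScalarTower.toAlgHom K R (LiftAlg g')), ?_, h, hh⟩
  change (algebraMap R (LiftAlg g')).FaithfullyFlat
  exact (RingHom.faithfullyFlat_algebraMap_iff).2 hff

/-- The subobject is isomorphic to some `J(Z')`, and fullness makes its inclusion a morphism of `A`.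
-/
theorem subobjectsFrom_of_isClosedUnderSubobjects (J : TensorFunctor A C) [J.functor.Full]
    (F : C ⥤ ModuleCat.{u} K) [J.functor.essImage.IsClosedUnderSubobjects] :
    SubobjectsFrom J.functor F := by
  intro Z Y i hi
  obtain ⟨Z', ⟨e⟩⟩ := J.functor.essImage.prop_of_mono i (J.functor.obj_mem_essImage Z)
  obtain ⟨s, hs⟩ := J.functor.map_surjective (e.hom ≫ i)
  refine ⟨Z', s, ?_⟩
  rw [hs, F.map_comp, ModuleCat.hom_comp, LinearMap.range_comp_of_range_eq_top]
  exact LinearMap.range_eq_top.2 fun y => ⟨_, map_hom_map_inv F e y⟩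

end Surjectivity

section

variable {K : Type u} [Field K] {C : Type u₁} [Category.{v₁} C] {F : C ⥤ ModuleCat.{u} K}
  {R : Type w} [CommRing R] [Algebra K R]

theorem bc_sum [Preadditive C] [F.Additive] {X Y : C} {ι : Type*} (s : Finset ι)
    (f : ι → (X ⟶ Y)) : bc F R (∑ i ∈ s, f i) = ∑ i ∈ s, bc F R (f i) := by
  have h0 : bc F R (0 : X ⟶ Y) = 0 := by simp [bc]
  classical
  induction s using Finset.induction_on with
  | empty => simpa using h0
  | insert i s hi ih =>
    rw [Finset.sum_insert hi, Finset.sum_insert hi, ← ih]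
    exact LinearMap.ext fun v => bc_add _ _ v

theorem bc_surjective [F.PreservesEpimorphisms] {X Y : C} (f : X ⟶ Y) [Epi f] :
    Function.Surjective (bc F R f) :=
  LinearMap.lTensor_surjective R ((ModuleCat.epi_iff_surjective (F.map f)).1 inferInstance)

end

/-! ### Triviality of the composite and injectivity of `I`. -/

section Trivial

variable {K : Type u} [Field K] {C : Type u₁} [Category.{v₁} C] [MonoidalCategory C]
  {F : C ⥤ ModuleCat.{u} K} [F.Monoidal] {R : Type w} [CommRing R] [Algebra K R]

theorem TensorAut.map_app (φ : TensorAut F R) {X Y : C} (f : X ⟶ Y) (v : R ⊗[K] F.obj X) :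
    φ.app Y (bc F R f v) = bc F R f (φ.app X v) :=
  (LinearMap.congr_fun (φ.naturality f) v).symm

theorem TensorAut.app_unit (φ : TensorAut F R) (v : R ⊗[K] F.obj (𝟙_ C)) :
    φ.app (𝟙_ C) v = v := by
  suffices (φ.app (𝟙_ C)).toLinearMap = LinearMap.id from LinearMap.congr_fun this v
  refine hom_ext_one_tmul fun m => ?_
  rw [← unitFun_smul_unitVec F m, TensorProduct.tmul_smul, ← algebraMap_smul R (unitFun F m),
    map_smul, map_smul]
  exact congrArg _ φ.unit

theorem TensorAut.app_biproduct_unit [Preadditive C] [HasFiniteBiproducts C] [F.Additive]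
    (φ : TensorAut F R) {m : ℕ} (v : R ⊗[K] F.obj (⨁ fun _ : Fin m => 𝟙_ C)) :
    φ.app (⨁ fun _ : Fin m => 𝟙_ C) v = v := by
  have h : ∀ v : R ⊗[K] F.obj (⨁ fun _ : Fin m => 𝟙_ C), v = ∑ i,
      bc F R (biproduct.ι (fun _ : Fin m => 𝟙_ C) i)
        (bc F R (biproduct.π (fun _ : Fin m => 𝟙_ C) i) v) := by
    intro v
    simp only [← bc_comp]
    rw [← LinearMap.sum_apply, ← bc_sum, biproduct.total, bc_id]
  rw [h v, map_sum]
  refine Finset.sum_congr rfl fun i _ => ?_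
  rw [φ.map_app]
  exact congrArg _ (φ.app_unit _)

theorem TensorAut.app_eq_of_iso (φ : TensorAut F R) {X Y : C} (e : X ≅ Y)
    (h : ∀ v, φ.app Y v = v) (v : R ⊗[K] F.obj X) : φ.app X v = v := by
  have h1 : bc F R e.inv (bc F R e.hom v) = v := by
    rw [← bc_comp, e.hom_inv_id, bc_id]
  rw [← h1, φ.map_app, h]

end Trivial

section PartTwo

variable {K : Type u} [Field K] {A : TensorCat.{v₁, u, u₁} K} {C : TensorCat.{v₂, u, u₂} K}
  {D : TensorCat.{v₃, u, u₃} K}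

theorem isTrivial_of_assumptionA1 {J : TensorFunctor A C} {H : TensorFunctor C D}
    (ω : FiberFunctor D) (h : AssumptionA1 J H) :
    IsTrivial (homI.{max w u u₁} H ω ≫ homP.{max w u u₃} J H ω) := by
  intro R φ
  refine TensorAut.ext (funext fun Z => LinearEquiv.ext fun v => ?_)
  obtain ⟨m, ⟨e⟩⟩ := h Z
  exact TensorAut.app_eq_of_iso (F := ω.functor) φ e (fun v => TensorAut.app_biproduct_unit φ v) v

/-- Tensor automorphisms that agree on enough objects are equal. -/
theorem isInjective_of_assumptionA2 {H : TensorFunctor C D}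
    (ω : FiberFunctor D) (h : AssumptionA2 H) : IsInjective (homI.{max w u u₁} H ω) := by
  obtain ⟨-, P, hP, hepi⟩ := h
  intro R φ φ' hφ
  change TensorAut ω.functor R at φ φ'
  have hX : ∀ (X : C) v, φ.app (H.functor.obj X) v = φ'.app (H.functor.obj X) v := fun X v =>
    LinearEquiv.congr_fun (congrFun (congrArg TensorAut.app hφ) X) v
  have hY : ∀ Y : D, P Y → ∀ v, φ.app Y v = φ'.app Y v := by
    intro Y hY v
    obtain ⟨X, f, hf⟩ := hepi Y hY
    obtain ⟨v, rfl⟩ := bc_surjective (F := ω.functor) (R := R) f v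
    rw [φ.map_app, φ'.map_app, hX]
  refine TensorAut.ext (funext fun Y => LinearEquiv.ext fun v => ?_)
  obtain ⟨Z, hZ, ⟨r⟩⟩ := hP Y
  have h1 : bc ω.functor R r.r (bc ω.functor R r.i v) = v := by
    rw [← bc_comp, r.retract, bc_id]
  rw [← h1, φ.map_app, φ'.map_app, hY Z hZ]

end PartTwo

end TannakaSES

end

noncomputable section

namespace TannakaSES

/-! ### Extension of tensor automorphisms along covers -/

section Composite

variable {K : Type u} [Field K] {C : Type u₁} [Category.{v₁} C] [MonoidalCategory C]
  {D : Type u₂} [Category.{v₂} D] [MonoidalCategory D] (H : C ⥤ D) [H.Monoidal]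
  (ω : D ⥤ ModuleCat.{u} K) [ω.Monoidal]

theorem tm_comp {X Y : C} (x : ω.obj (H.obj X)) (y : ω.obj (H.obj Y)) :
    tm (H ⋙ ω) (X := X) (Y := Y) x y = (ω.map (μ H X Y)).hom (tm ω x y) := rfl

theorem unitVec_comp : unitVec (H ⋙ ω) = (ω.map (ε H)).hom (unitVec ω) := rfl

theorem tensorator_comp_tmul {R : Type w} [CommRing R] [Algebra K R] {X Y : C}
    (v : R ⊗[K] ω.obj (H.obj X)) (w : R ⊗[K] ω.obj (H.obj Y)) :
    tensorator (H ⋙ ω) R X Y (v ⊗ₜ w) =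
      bc ω R (μ H X Y) (tensorator ω R (H.obj X) (H.obj Y) (v ⊗ₜ w)) := by
  rw [tensorator_comp]
  rfl

end Composite

section Kernel

variable {K : Type u} [Field K] {D : Type u₁} [Category.{v₁} D] [Abelian D]
  {ω : D ⥤ ModuleCat.{u} K} [ω.Additive] [PreservesFiniteLimits ω]
  {R : Type w} [CommRing R] [Algebra K R]

theorem exact_map_kernel_ι {X Y : D} (f : X ⟶ Y) :
    Function.Exact (ω.map (kernel.ι f)).hom (ω.map f).hom := by
  have h : (ShortComplex.mk (kernel.ι f) f (kernel.condition f)).Exact :=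
    ShortComplex.exact_kernel f
  have h2 := h.map_of_mono_of_preservesKernel ω inferInstance inferInstance
  exact (ShortComplex.ShortExact.moduleCat_exact_iff_function_exact _).1 h2

theorem exists_bc_kernel_ι {X Y : D} (f : X ⟶ Y) (v : R ⊗[K] ω.obj X) (hv : bc ω R f v = 0) :
    ∃ w, bc ω R (kernel.ι f) w = v :=
  (Module.Flat.lTensor_exact R (exact_map_kernel_ι (ω := ω) f) v).1 hv

end Kernel

section Extension

variable {K : Type u} [Field K] {C : Type u₁} [Category.{v₁} C] [MonoidalCategory C]
  {D : Type u₂} [Category.{v₂} D] [Abelian D] [MonoidalCategory D] [LeftRigidCategory D]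
  {H : C ⥤ D} [H.Monoidal] {ω : D ⥤ ModuleCat.{u} K} [ω.Monoidal] [ω.Additive]
  [PreservesFiniteLimits ω] [PreservesFiniteColimits ω]
  {R : Type w} [CommRing R] [Algebra K R]

/-- `ψ` descends along a cover `f : H X ⟶ Y`: the kernel of `f` is covered by some `H X'`, so it is
preserved by `ψ`. For any other `q : H X₁ ⟶ Y`, a cover of the pullback of `f` and `q` compares the
two. -/
theorem exists_linearMap_of_cover (ψ : TensorAut (H ⋙ ω) R)
    (hepi : ∀ Y : D, ∃ (X : C) (f : H.obj X ⟶ Y), Epi f)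
    (hψ : ∀ (X' X : C) (q : H.obj X' ⟶ H.obj X) v,
      ψ.app X (bc ω R q v) = bc ω R q (ψ.app X' v)) (Y : D) :
    ∃ l : R ⊗[K] ω.obj Y →ₗ[R] R ⊗[K] ω.obj Y,
      ∀ (X : C) (q : H.obj X ⟶ Y) (v : R ⊗[K] ω.obj (H.obj X)),
        l (bc ω R q v) = bc ω R q (ψ.app X v) := by
  obtain ⟨X, f, hf⟩ := hepi Y
  have hsurj := bc_surjective (F := ω) (R := R) f
  have hker : LinearMap.ker (bc ω R f) ≤ LinearMap.ker (bc ω R f ∘ₗ (ψ.app X).toLinearMap) := by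
    intro v hv
    obtain ⟨v, rfl⟩ := exists_bc_kernel_ι f v hv
    obtain ⟨X', p, hp⟩ := hepi (kernel f)
    obtain ⟨v, rfl⟩ := bc_surjective (F := ω) (R := R) p v
    rw [LinearMap.mem_ker, LinearMap.comp_apply, LinearEquiv.coe_coe, ← bc_comp]
    erw [hψ]
    rw [← bc_comp]
    simp [bc]
  let l : R ⊗[K] ω.obj Y →ₗ[R] R ⊗[K] ω.obj Y :=
    (LinearMap.ker (bc ω R f)).liftQ (bc ω R f ∘ₗ (ψ.app X).toLinearMap) hker ∘ₗ
      ((bc ω R f).quotKerEquivOfSurjective hsurj).symm.toLinearMap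
  have hl : ∀ v, l (bc ω R f v) = bc ω R f (ψ.app X v) := by
    intro v
    have h1 : ((bc ω R f).quotKerEquivOfSurjective hsurj).symm (bc ω R f v) =
        Submodule.Quotient.mk v := by
      rw [LinearEquiv.symm_apply_eq]
      rfl
    rw [LinearMap.comp_apply, LinearEquiv.coe_coe, h1]
    rfl
  refine ⟨l, fun X₁ q v => ?_⟩
  obtain ⟨X', p, hp⟩ := hepi (pullback f q)
  have hepi' : Epi (p ≫ pullback.snd f q) := epi_comp _ _
  obtain ⟨v, rfl⟩ := bc_surjective (F := ω) (R := R) (p ≫ pullback.snd f q) v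
  have h1 := hψ _ _ (p ≫ pullback.snd f q) v
  have h2 := hψ _ _ (p ≫ pullback.fst f q) v
  have h3 : (p ≫ pullback.snd f q) ≫ q = (p ≫ pullback.fst f q) ≫ f := by
    simp [pullback.condition]
  rw [← bc_comp, h3, bc_comp, hl]
  erw [h1, h2]
  rw [← bc_comp, ← bc_comp, h3]

/-- A tensor automorphism of `ω ∘ H` that commutes with all morphisms between objects in the image
of `H` extends to `ω`, provided that every object is a quotient of an object in the image of `H`. -/
theorem exists_extension (ψ : TensorAut (H ⋙ ω) R)
    (hepi : ∀ Y : D, ∃ (X : C) (f : H.obj X ⟶ Y), Epi f)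
    (hψ : ∀ (X' X : C) (q : H.obj X' ⟶ H.obj X) v,
      ψ.app X (bc ω R q v) = bc ω R q (ψ.app X' v)) :
    ∃ φ : TensorAut ω R, TensorAut.restrict H φ = ψ := by
  choose l hl using exists_linearMap_of_cover ψ hepi hψ
  refine ⟨TensorAut.ofMonoidal l ?_ ?_ ?_, ?_⟩
  · intro Y Y' f y
    obtain ⟨X, q, hq⟩ := hepi Y
    obtain ⟨v, hv⟩ := bc_surjective (F := ω) (R := R) q (1 ⊗ₜ y)
    have h1 : (1 : R) ⊗ₜ[K] (ω.map f).hom y = bc ω R f (1 ⊗ₜ y) := by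
      rw [bc, LinearMap.baseChange_tmul]
    rw [h1, ← hv, ← bc_comp, hl, hl, bc_comp]
  · intro Y Y' y y'
    obtain ⟨X, q, hq⟩ := hepi Y
    obtain ⟨X', q', hq'⟩ := hepi Y'
    obtain ⟨x, rfl⟩ := (ModuleCat.epi_iff_surjective (ω.map q)).1 inferInstance y
    obtain ⟨x', rfl⟩ := (ModuleCat.epi_iff_surjective (ω.map q')).1 inferInstance y'
    have hδ : ∀ v, bc ω R (δ H X X' ≫ (q ⊗ₘ q')) (bc ω R (μ H X X') v) =
        bc ω R (q ⊗ₘ q') v := fun v => by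
      rw [← bc_comp, Functor.Monoidal.μ_δ_assoc]
    -- The product of the two covers is a cover of `Y ⊗ Y'` by `H(X ⊗ X')`, so the defining property
    -- of `l` applies to it.
    have h1 : (1 : R) ⊗ₜ[K] tm ω ((ω.map q).hom x) ((ω.map q').hom x') =
        bc ω R (δ H X X' ≫ (q ⊗ₘ q'))
          (tensorator (H ⋙ ω) R X X' ((1 ⊗ₜ x) ⊗ₜ (1 ⊗ₜ x'))) := by
      rw [tensorator_comp_tmul, hδ, bc_tensorator, bc, bc, LinearMap.baseChange_tmul,
        LinearMap.baseChange_tmul, tensorator_one_tmul, mul_one]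
    have h2 : ∀ {X : C} {Y : D} (q : H.obj X ⟶ Y) (x : ω.obj (H.obj X)),
        (1 : R) ⊗ₜ[K] (ω.map q).hom x = bc ω R q (1 ⊗ₜ x) := fun q x => by
      rw [bc, LinearMap.baseChange_tmul]
    have h3 := LinearMap.congr_fun (ψ.tensor X X') ((1 ⊗ₜ x) ⊗ₜ (1 ⊗ₜ x'))
    rw [h1, hl, h2, h2, hl, hl, ← bc_tensorator]
    refine (congrArg _ h3).trans ?_
    refine (congrArg _ (tensorator_comp_tmul H ω _ _)).trans ?_
    exact hδ _
  · have h1 : (1 : R) ⊗ₜ[K] unitVec ω = bc ω R (η H) (1 ⊗ₜ unitVec (H ⋙ ω)) := by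
      rw [unitVec_comp, bc, LinearMap.baseChange_tmul]
      erw [← map_comp_apply]
      rw [Functor.Monoidal.ε_η]
      simp
    rw [h1, hl]
    exact congrArg _ ψ.unit
  · refine TensorAut.ext (funext fun X => LinearEquiv.ext fun v => ?_)
    have h := hl _ X (𝟙 _) v
    rw [bc_id, bc_id] at h
    exact h

end Extension

end TannakaSES

end

noncomputable section

namespace TannakaSES

/-! ### The kernel of the restriction -/

section Commutes

variable {K : Type u} [Field K] {C : Type u₁} [Category.{v₁} C] {F : C ⥤ ModuleCat.{u} K}
  [MonoidalCategory C] [F.Monoidal] {R : Type w} [CommRing R] [Algebra K R]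

/-- The tensor automorphism `ψ` of `F` commutes with the linear map `θ`, which need not come from a
morphism. -/
def TensorAut.Commutes (ψ : TensorAut F R) {X X' : C} (θ : F.obj X →ₗ[K] F.obj X') : Prop :=
  ∀ x, ψ.app X' (1 ⊗ₜ θ x) = θ.baseChange R (ψ.app X (1 ⊗ₜ x))

theorem TensorAut.Commutes.apply {ψ : TensorAut F R} {X X' : C} {θ : F.obj X →ₗ[K] F.obj X'}
    (h : ψ.Commutes θ) (v : R ⊗[K] F.obj X) :
    ψ.app X' (θ.baseChange R v) = θ.baseChange R (ψ.app X v) := by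
  have h1 : (ψ.app X').toLinearMap ∘ₗ θ.baseChange R = θ.baseChange R ∘ₗ (ψ.app X).toLinearMap :=
    hom_ext_one_tmul fun x => by
      rw [LinearMap.comp_apply, LinearMap.baseChange_tmul]
      exact h x
  exact LinearMap.congr_fun h1 v

theorem TensorAut.commutes_map (ψ : TensorAut F R) {X X' : C} (f : X ⟶ X') :
    ψ.Commutes (F.map f).hom := fun x => by
  have h := ψ.map_app f (1 ⊗ₜ x)
  rwa [bc, LinearMap.baseChange_tmul] at h

theorem TensorAut.Commutes.comp {ψ : TensorAut F R} {X X' X'' : C} {θ : F.obj X →ₗ[K] F.obj X'}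
    {θ' : F.obj X' →ₗ[K] F.obj X''} (h' : ψ.Commutes θ') (h : ψ.Commutes θ) :
    ψ.Commutes (θ' ∘ₗ θ) := fun x => by
  rw [LinearMap.comp_apply, h' (θ x), ← LinearMap.baseChange_tmul, h.apply, LinearMap.baseChange_comp]
  rfl

/-- Contraction of the second factor with a functional commutes with a tensor automorphism that is
trivial on the second factor. -/
theorem TensorAut.commutes_of_tm (ψ : TensorAut F R) {X a : C} (ha : ∀ v, ψ.app a v = v)
    {θ : F.obj (X ⊗ a) →ₗ[K] F.obj X} (l : F.obj a →ₗ[K] K)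
    (hθ : ∀ x z, θ (tm F x z) = l z • x) : ψ.Commutes θ := by
  intro w
  induction w using tm_induction F with
  | zero => simp
  | add a b ha hb => simp only [map_add, TensorProduct.tmul_add, ha, hb]
  | tmul x z =>
    have h := LinearMap.congr_fun (ψ.tensor X a) ((1 ⊗ₜ x) ⊗ₜ (1 ⊗ₜ z))
    rw [LinearMap.comp_apply, LinearMap.comp_apply, tensorator_one_tmul, mul_one,
      TensorProduct.map_tmul, LinearEquiv.coe_coe, LinearEquiv.coe_coe, LinearEquiv.coe_coe,
      ha] at h
    have key : ∀ v : R ⊗[K] F.obj X, θ.baseChange R (tensorator F R X a (v ⊗ₜ (1 ⊗ₜ z))) =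
        l z • v := by
      intro v
      induction v using TensorProduct.induction_on with
      | zero => simp
      | add a b ha hb => simp only [map_add, TensorProduct.add_tmul, smul_add, ha, hb]
      | tmul r y =>
        rw [tensorator_one_tmul, mul_one, LinearMap.baseChange_tmul, hθ, TensorProduct.tmul_smul]
    rw [h, key, hθ, TensorProduct.tmul_smul, ← algebraMap_smul R (l z) ((1 : R) ⊗ₜ[K] x),
      map_smul, algebraMap_smul]

end Commutes

section Monadic

variable {K : Type u} [Field K] {C : Type u₁} [Category.{v₁} C] [MonoidalCategory C]
  {E : Type u₂} [Category.{v₂} E] [MonoidalCategory E] {H : C ⥤ E} [H.Monoidal]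
  {ω : E ⥤ ModuleCat.{u} K} [ω.Monoidal] {F : C ⥤ ModuleCat.{u} K} [F.Monoidal]
  {R : Type w} [CommRing R] [Algebra K R]

/-- Transport of a linear map along an isomorphism `H ⋙ ω ≅ F`. -/
def conj (e : H ⋙ ω ≅ F) {X X' : C} (q : H.obj X ⟶ H.obj X') : F.obj X →ₗ[K] F.obj X' :=
  (e.inv.app X ≫ ω.map q ≫ e.hom.app X').hom

omit [MonoidalCategory C] [MonoidalCategory E] [H.Monoidal] [ω.Monoidal] [F.Monoidal] in
theorem conj_comp (e : H ⋙ ω ≅ F) {X X' X'' : C} (q : H.obj X ⟶ H.obj X')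
    (q' : H.obj X' ⟶ H.obj X'') : conj e (q ≫ q') = conj e q' ∘ₗ conj e q := by
  rw [conj, conj, conj, ← ModuleCat.hom_comp]
  simp

omit [MonoidalCategory C] [MonoidalCategory E] [H.Monoidal] [ω.Monoidal] [F.Monoidal] in
theorem conj_map (e : H ⋙ ω ≅ F) {X X' : C} (f : X ⟶ X') :
    conj e (H.map f) = (F.map f).hom := by
  rw [conj]
  have h := e.inv.naturality_assoc f (e.hom.app X')
  rw [Iso.inv_hom_id_app, Category.comp_id] at h
  rw [h]
  rfl

end Monadic

section Kernel

variable {K : Type u} [Field K] {A : TensorCat.{v₁, u, u₁} K} {C : TensorCat.{v₂, u, u₂} K}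
  {E : TensorCat.{v₃, u, u₃} K} {J : TensorFunctor A C} {H : TensorFunctor C E}
  {ω : E ⥤ ModuleCat.{u} K} [ω.Monoidal] {F : C ⥤ ModuleCat.{u} K} [F.Monoidal]
  {R : Type w} [CommRing R] [Algebra K R]

/-- The transpose of the projection map, solved for the counit: on `H X`, the counit is determined
by the one at the unit object. -/
theorem counit_eq {G : E ⥤ C} (adj : H.functor ⊣ G) [IsIso (projectionMap H adj)] (X : C) :
    adj.counit.app (H.functor.obj X) = H.functor.map (inv ((projectionMap H adj).app X)) ≫
      δ H.functor X (G.obj (𝟙_ E)) ≫ (H.functor.obj X ◁ adj.counit.app (𝟙_ E)) ≫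
        (ρ_ (H.functor.obj X)).hom := by
  have h : H.functor.map ((projectionMap H adj).app X) ≫ adj.counit.app (H.functor.obj X) =
      δ H.functor X (G.obj (𝟙_ E)) ≫ (H.functor.obj X ◁ adj.counit.app (𝟙_ E)) ≫
        (ρ_ (H.functor.obj X)).hom := by
    refine (adj.homEquiv_counit _ _ _).symm.trans ?_
    exact Equiv.symm_apply_apply _ _
  rw [← h, ← Functor.map_comp_assoc]
  simp

/-- Under the assumption A3 an element of the kernel of the restriction to `A` commutes with all
morphisms between objects in the image of `H`. -/
theorem commutes_conj (hA : AssumptionA3 J H) (e : H.functor ⋙ ω ≅ F)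
    (he : ∀ (X Y : C) (x : ω.obj (H.functor.obj X)) (y : ω.obj (H.functor.obj Y)),
      (e.hom.app (X ⊗ Y)).hom ((ω.map (μ H.functor X Y)).hom (tm ω x y)) =
        tm F ((e.hom.app X).hom x) ((e.hom.app Y).hom y))
    (ψ : TensorAut F R) (hψ : ∀ Z v, ψ.app (J.functor.obj Z) v = v) {X X' : C}
    (q : H.functor.obj X ⟶ H.functor.obj X') : ψ.Commutes (conj e q) := by
  obtain ⟨-, G, adj, -, ⟨Z, ⟨i⟩⟩, hp⟩ := hA
  have ha : ∀ v, ψ.app (G.obj (𝟙_ E)) v = v := ψ.app_eq_of_iso i.symm (hψ Z)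
  have hinv : ∀ {X : C} (x : F.obj X), (e.hom.app X).hom ((e.inv.app X).hom x) = x := fun x => by
    rw [← LinearMap.comp_apply, ← ModuleCat.hom_comp, Iso.inv_hom_id_app]
    rfl
  have hinv' : ∀ {X : C} (x : ω.obj (H.functor.obj X)),
      (e.inv.app X).hom ((e.hom.app X).hom x) = x := fun x => by
    rw [← LinearMap.comp_apply, ← ModuleCat.hom_comp, Iso.hom_inv_id_app]
    rfl
  -- The transpose `X ⟶ G(H X')` of `q`, read in `X' ⊗ G(𝟙)` through the projection isomorphism.
  obtain ⟨p, rfl⟩ : ∃ p : X ⟶ X' ⊗ G.obj (𝟙_ E), q = H.functor.map p ≫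
      δ H.functor X' (G.obj (𝟙_ E)) ≫ (H.functor.obj X' ◁ adj.counit.app (𝟙_ E)) ≫
        (ρ_ (H.functor.obj X')).hom := by
    refine ⟨adj.homEquiv _ _ q ≫ inv ((projectionMap H adj).app X'), ?_⟩
    rw [Functor.map_comp_assoc, ← counit_eq]
    refine Eq.trans ?_ (adj.homEquiv_counit _ _ _)
    exact (Equiv.symm_apply_apply _ _).symm
  rw [conj_comp, conj_map]
  refine TensorAut.Commutes.comp ?_ (ψ.commutes_map _)
  refine ψ.commutes_of_tm ha
    (unitFun ω ∘ₗ (ω.map (adj.counit.app (𝟙_ E))).hom ∘ₗ (e.inv.app _).hom) fun x z => ?_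
  have h1 : (e.inv.app (X' ⊗ G.obj (𝟙_ E))).hom (tm F x z) =
      (ω.map (μ H.functor X' (G.obj (𝟙_ E)))).hom
        (tm ω ((e.inv.app _).hom x) ((e.inv.app _).hom z)) := by
    rw [← hinv' ((ω.map _).hom _), he, hinv, hinv]
  have h2 : ∀ t, (ω.map (δ H.functor X' (G.obj (𝟙_ E)))).hom
      ((ω.map (μ H.functor X' (G.obj (𝟙_ E)))).hom t) = t := fun t => by
    rw [← map_comp_apply, Functor.Monoidal.μ_δ]
    simp
  simp only [conj, ModuleCat.hom_comp, LinearMap.comp_apply]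
  rw [h1, map_comp_apply, map_comp_apply, h2, map_whiskerLeft_tm,
    ← unitFun_smul_unitVec ω ((ω.map (adj.counit.app (𝟙_ E))).hom _), map_smul, map_smul,
    map_smul, map_rightUnitor_hom_tm, hinv, unitFun_smul_unitVec]

/-- Monadicity makes `G` faithful, so the counit `H(G Y) ⟶ Y` is an epimorphism. -/
theorem epi_counit_of_assumptionA3 (hA : AssumptionA3 J H) (Y : E) :
    ∃ (X : C) (f : H.functor.obj X ⟶ Y), Epi f := by
  obtain ⟨-, G, adj, hG, -⟩ := hA
  have h : ((Monad.comparison adj) ⋙ Monad.forget adj.toMonad).Faithful := inferInstance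
  have : G.Faithful := h
  exact ⟨G.obj Y, adj.counit.app Y, inferInstance⟩

end Kernel

end TannakaSES

end

noncomputable section

namespace TannakaSES

/-! ### The kernel of `P` lies in the image of `I`. -/

section KerLeIm

variable {K : Type u} [Field K] {A : TensorCat.{v₁, u, u₁} K} {C : TensorCat.{v₂, u, u₂} K}
  {D : TensorCat.{v₃, u, u₃} K} {J : TensorFunctor A C} {H : TensorFunctor C D}
  (ω : FiberFunctor D)

theorem kerLeIm_of_commutes
    (hepi : ∀ Y : D, ∃ (X : C) (f : H.functor.obj X ⟶ Y), Epi f)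
    (hcomm : ∀ (R : CommAlgCat.{max w u u₁ u₂ u₃} K) (ψ : TensorAut (H.functor ⋙ ω.functor) R),
      (∀ Z v, ψ.app (J.functor.obj Z) v = v) → ∀ (X X' : C)
        (q : H.functor.obj X ⟶ H.functor.obj X'), ψ.Commutes (ω.functor.map q).hom) :
    KerLeIm (homI.{max w u u₁} H ω) (homP.{max w u u₃} J H ω) := by
  intro R ψ hψ
  change TensorAut (H.functor ⋙ ω.functor) R at ψ
  have hψ1 : TensorAut.restrict J.functor ψ = 1 := hψ
  have hψ2 : ∀ Z v, ψ.app (J.functor.obj Z) v = v := fun Z v =>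
    LinearEquiv.congr_fun (congrFun (congrArg TensorAut.app hψ1) Z) v
  exact exists_extension ψ hepi fun X' X q v => (hcomm R ψ hψ2 X' X q).apply v

theorem kerLeIm_of_assumptionA3 (h : AssumptionA3 J H) :
    KerLeIm (homI.{max w u u₁} H ω) (homP.{max w u u₃} J H ω) := by
  refine kerLeIm_of_commutes.{w} ω (epi_counit_of_assumptionA3 h) fun R ψ hψ X X' q => ?_
  exact commutes_conj h (Iso.refl _) (fun _ _ _ _ => rfl) ψ hψ q

end KerLeIm

namespace TensorDiagram

variable {K : Type u} [Field K] {A : TensorCat.{v₁, u, u₁} K} {C : TensorCat.{v₂, u, u₂} K}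
  {D : TensorCat.{v₃, u, u₃} K} {J : TensorFunctor A C} {H : TensorFunctor C D}
  {I : Type u₄} [Category.{v₄} I] {Δ : TensorDiagram.{v₂, v₃, v₄, v₅, u, u₂, u₃, u₄, u₅} H I}

theorem IsColimit.epi (hΔ : Δ.IsColimit)
    (h : ∀ i (Y : Δ.obj i), ∃ (X : C) (f : (Δ.src i).functor.obj X ⟶ Y), Epi f) (Y : D) :
    ∃ (X : C) (f : H.functor.obj X ⟶ Y), Epi f := by
  obtain ⟨i, Y', ⟨e⟩⟩ := hΔ.essSurj Y
  obtain ⟨X, f, hf⟩ := h i Y'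
  have : Epi ((Δ.tgt i).functor.map f ≫ e.hom) := epi_comp _ _
  exact ⟨X, (Δ.compIso i).inv.app X ≫ (Δ.tgt i).functor.map f ≫ e.hom, epi_comp _ _⟩

/-- Morphisms between objects in the image of `H` come from morphisms between objects in the image of
some `Hᵢ`. -/
theorem IsColimit.exists_map_eq (hΔ : Δ.IsColimit) (i : I) {X X' : C}
    (q : H.functor.obj X ⟶ H.functor.obj X') :
    ∃ (j : I) (_ : i ⟶ j) (g : (Δ.src j).functor.obj X ⟶ (Δ.src j).functor.obj X'),
      q = (Δ.compIso j).inv.app X ≫ (Δ.tgt j).functor.map g ≫ (Δ.compIso j).hom.app X' := by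
  obtain ⟨j, t, g, hg⟩ := hΔ.full (i := i)
    ((Δ.compIso i).hom.app X ≫ q ≫ (Δ.compIso i).inv.app X')
  refine ⟨j, t, (Δ.srcIso t).inv.app X ≫ g ≫ (Δ.srcIso t).hom.app X', ?_⟩
  rw [Functor.map_comp, Functor.map_comp, Category.assoc, Category.assoc]
  erw [Δ.compIso_naturality t X']
  rw [reassoc_of% hg, Iso.inv_hom_id_app]
  have h := (Δ.compIso_naturality t X).symm
  rw [reassoc_of% h, ← Functor.map_comp_assoc, Iso.inv_hom_id_app,
    CategoryTheory.Functor.map_id]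
  erw [Category.id_comp, Category.comp_id, Iso.inv_hom_id_app_assoc]

theorem kerLeIm (ω : FiberFunctor D) (hΔ : Δ.IsColimit) (h : ∀ i, AssumptionA3 J (Δ.src i)) :
    KerLeIm (homI.{max w u u₁} H ω) (homP.{max w u u₃} J H ω) := by
  refine kerLeIm_of_commutes.{w} ω (hΔ.epi fun i => epi_counit_of_assumptionA3 (h i))
    fun R ψ hψ X X' q => ?_
  -- Essential surjectivity is applied to the unit only to obtain an index.
  obtain ⟨i, -⟩ := hΔ.essSurj (𝟙_ D)
  obtain ⟨j, -, g, rfl⟩ := hΔ.exists_map_eq i q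
  have h1 := commutes_conj (h j) (ω := (Δ.tgt j).functor ⋙ ω.functor)
    (Functor.isoWhiskerRight (Δ.compIso j) ω.functor) ?_ ψ hψ g
  · convert h1 using 1
    simp [conj]
  · intro X Y x y
    have := Δ.compIso_monoidal j
    have h2 := NatTrans.IsMonoidal.tensor (τ := (Δ.compIso j).hom) X Y
    have h3 := congrArg (fun f => (ω.functor.map f).hom (tm ω.functor x y)) h2
    simp only [map_comp_apply, map_tm] at h3
    rw [tm_comp]
    rw [Functor.LaxMonoidal.comp_μ, map_comp_apply] at h3
    exact h3

end TensorDiagram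

end TannakaSES

end

noncomputable section

namespace TannakaSES

/-! ### Subobjects of the objects of the subcategory -/

section Subobjects

variable {K : Type u} [Field K] {A : Type u₁} [Category.{v₁} A] [Abelian A] [MonoidalCategory A]
  {C : Type u₂} [Category.{v₂} C] [Abelian C] [MonoidalCategory C] (J : A ⥤ C) [J.Monoidal]
  [J.Full] [J.Additive] [PreservesFiniteLimits J] {F : C ⥤ ModuleCat.{u} K} [F.Monoidal]
  [F.Additive] [PreservesFiniteLimits F]

/-- If `Y ⊆ J(Z)` and `Y ⊗ J(a)` comes from `A`, where `a` is an object with a vector `𝟙 ⟶ J(a)`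
not killed by `F`, then `F(Y) ⊆ F(J(Z))` is the image of a morphism of `A`. -/
theorem exists_range_map_eq {Z a : A} {Y : C} (i : Y ⟶ J.obj Z) (p : 𝟙_ C ⟶ J.obj a)
    (hu : (F.map p).hom (unitVec F) ≠ 0) (hY : J.essImage (Y ⊗ J.obj a)) :
    ∃ (Z' : A) (s : Z' ⟶ Z),
      LinearMap.range (F.map (J.map s)).hom = LinearMap.range (F.map i).hom := by
  obtain ⟨V, ⟨e⟩⟩ := hY
  obtain ⟨k, hk⟩ := J.map_surjective (e.hom ≫ i ▷ J.obj a ≫ μ J Z a)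
  obtain ⟨l, hl⟩ := J.map_surjective ((ρ_ (J.obj Z)).inv ≫ J.obj Z ◁ p ≫ μ J Z a)
  -- With `u` the vector given by `p`, this is `(t, z) ↦ t - z ⊗ u` for `t ∈ F(Y ⊗ J a)`. Its
  -- kernel, formed in `A`, consists of the `z` with `z ⊗ u ∈ F(Y ⊗ J a)`, together with the witness
  -- `t`.
  let d : V ⊞ Z ⟶ Z ⊗ a := biprod.fst ≫ k - biprod.snd ≫ l
  refine ⟨kernel d, kernel.ι d ≫ biprod.snd, ?_⟩
  have hex := exact_map_kernel_ι (ω := J ⋙ F) d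
  have hμ : Function.Injective (F.map (μ J Z a)).hom :=
    Function.LeftInverse.injective (g := (F.map (δ J Z a)).hom) fun x => by
      rw [← map_comp_apply, Functor.Monoidal.μ_δ]; simp
  have hd : ∀ x, (F.map (J.map d)).hom x = (F.map (μ J Z a)).hom
      ((F.map (i ▷ J.obj a)).hom ((F.map e.hom).hom ((F.map (J.map biprod.fst)).hom x)) -
        tm F ((F.map (J.map biprod.snd)).hom x) ((F.map p).hom (unitVec F))) := by
    intro x
    rw [map_sub, ← map_whiskerLeft_tm, ← map_rightUnitor_inv, ← map_comp_apply F (_ ▷ _),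
      ← map_comp_apply F e.hom, ← map_comp_apply F (_ ◁ _), ← map_comp_apply F (ρ_ _).inv,
      ← hk, ← hl, ← map_comp_apply, ← map_comp_apply, ← J.map_comp, ← J.map_comp,
      J.map_sub, F.map_sub]
    rfl
  ext z
  rw [LinearMap.mem_range, LinearMap.mem_range]
  constructor
  · rintro ⟨w, rfl⟩
    obtain ⟨f, hf⟩ := Module.Projective.exists_dual_ne_zero K hu
    have h0 : (F.map (J.map d)).hom ((F.map (J.map (kernel.ι d))).hom w) = 0 :=
      (hex _).2 ⟨w, rfl⟩
    rw [hd] at h0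
    have h1 := sub_eq_zero.1 (hμ (h0.trans (map_zero _).symm))
    -- Contracting the second factor with a functional `f` nonzero on `u` turns `z ⊗ u = t` into
    -- `f(u) z ∈ F(Y)`.
    let θ : ∀ X : C, F.obj (X ⊗ J.obj a) →ₗ[K] F.obj X := fun X =>
      tmLift F (LinearMap.lsmul K (F.obj X) ∘ₗ f).flip
    have hθ : ∀ (X : C) (x : F.obj X) (z : F.obj (J.obj a)), θ X (tm F x z) = f z • x :=
      fun X x z => tmLift_tm F _ x z
    have hθi : ∀ t, θ _ ((F.map (i ▷ J.obj a)).hom t) = (F.map i).hom (θ _ t) := by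
      intro t
      induction t using tm_induction F with
      | zero => simp
      | add t t' ht ht' => simp only [map_add, ht, ht']
      | tmul y z => rw [map_whiskerRight_tm, hθ, hθ, map_smul]
    have h2 := congrArg (θ _) h1
    rw [hθi, hθ] at h2
    refine ⟨(f ((F.map p).hom (unitVec F)))⁻¹ • θ _ ((F.map e.hom).hom
      ((F.map (J.map biprod.fst)).hom ((F.map (J.map (kernel.ι d))).hom w))), ?_⟩
    rw [map_smul, h2, smul_smul, inv_mul_cancel₀ hf, one_smul, J.map_comp, map_comp_apply]
  · rintro ⟨y, rfl⟩
    have hbp : ∀ {P Q T : A} (f : P ⟶ Q) (f' : Q ⟶ T) (x : F.obj (J.obj P)),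
        (F.map (J.map f')).hom ((F.map (J.map f)).hom x) = (F.map (J.map (f ≫ f'))).hom x :=
      fun f f' x => by rw [J.map_comp, map_comp_apply]
    let x : F.obj (J.obj (V ⊞ Z)) :=
      (F.map (J.map biprod.inl)).hom ((F.map e.inv).hom (tm F y ((F.map p).hom (unitVec F)))) +
        (F.map (J.map biprod.inr)).hom ((F.map i).hom y)
    have hx1 : (F.map (J.map biprod.fst)).hom x =
        (F.map e.inv).hom (tm F y ((F.map p).hom (unitVec F))) := by
      rw [map_add, hbp, hbp, biprod.inl_fst, biprod.inr_fst]
      simp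
    have hx2 : (F.map (J.map biprod.snd)).hom x = (F.map i).hom y := by
      rw [map_add, hbp, hbp, biprod.inl_snd, biprod.inr_snd]
      simp
    obtain ⟨w, hw⟩ := (hex x).1 (by
      refine (hd x).trans ?_
      rw [hx1, hx2, map_hom_map_inv, map_whiskerRight_tm, sub_self, map_zero])
    refine ⟨w, ?_⟩
    rw [J.map_comp, map_comp_apply, ← hx2, ← hw]
    rfl

end Subobjects

/-! ### Subobjects of sums of the unit. -/

section Unit

variable {K : Type u} [Field K] {D : TensorCat.{v₃, u, u₃} K}

/-- The space `ω(𝟙)` is one-dimensional, so the nonzero injection `ω(f)` is bijective; the faithful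
functor `ω` reflects this. -/
theorem isIso_of_mono_unit (ω : FiberFunctor D) {S : D} [Simple S] (f : S ⟶ 𝟙_ D) [Mono f] :
    IsIso f := by
  have h : IsIso (ω.functor.map f) := by
    have hinj := (ModuleCat.mono_iff_injective (ω.functor.map f)).1 inferInstance
    have hne : ω.functor.map f ≠ 0 := fun h =>
      (Simple.mono_isIso_iff_nonzero (𝟙 S)).1 inferInstance (by
        have : f = 0 := ω.functor.map_injective (by rw [h, Functor.map_zero])
        rw [← cancel_mono f, this]; simp)
    have hsurj : Function.Surjective (ω.functor.map f).hom := by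
      obtain ⟨x, hx⟩ : ∃ x, (ω.functor.map f).hom x ≠ 0 := by
        by_contra! hx
        exact hne (ModuleCat.hom_ext (LinearMap.ext hx))
      intro y
      have hc := unitFun_smul_unitVec ω.functor ((ω.functor.map f).hom x)
      set c := unitFun ω.functor ((ω.functor.map f).hom x)
      have hc0 : c ≠ 0 := fun h => hx (by rw [← hc, h, zero_smul])
      refine ⟨(unitFun ω.functor y * c⁻¹) • x, ?_⟩
      rw [map_smul, ← hc, smul_smul, mul_assoc, inv_mul_cancel₀ hc0, mul_one,
        unitFun_smul_unitVec]
    have : Epi (ω.functor.map f) := (ModuleCat.epi_iff_surjective _).2 hsurj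
    exact isIso_of_mono_of_epi _
  exact isIso_of_reflects_iso f ω.functor

theorem exists_iso_biproduct_unit (ω : FiberFunctor D) (hD : IsSemisimple D) {Y : D} {m : ℕ}
    (i : Y ⟶ ⨁ fun _ : Fin m => 𝟙_ D) [Mono i] :
    ∃ r : ℕ, Nonempty (Y ≅ ⨁ fun _ : Fin r => 𝟙_ D) := by
  obtain ⟨r, S, hS, ⟨e⟩⟩ := hD Y
  have h : ∀ j, Nonempty (S j ≅ 𝟙_ D) := by
    intro j
    have := hS j
    have hmono : Mono (biproduct.ι S j ≫ e.inv ≫ i) := inferInstance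
    obtain ⟨k, hk⟩ : ∃ k, biproduct.ι S j ≫ e.inv ≫ i ≫ biproduct.π _ k ≠ 0 := by
      by_contra! hk
      refine (Simple.mono_isIso_iff_nonzero (𝟙 (S j))).1 inferInstance ?_
      rw [← cancel_mono (biproduct.ι S j ≫ e.inv ≫ i)]
      ext k
      simpa using hk k
    have := mono_of_nonzero_from_simple hk
    have := isIso_of_mono_unit ω (biproduct.ι S j ≫ e.inv ≫ i ≫ biproduct.π _ k)
    exact ⟨asIso (biproduct.ι S j ≫ e.inv ≫ i ≫ biproduct.π _ k)⟩
  exact ⟨r, ⟨e ≪≫ biproduct.mapIso fun j => (h j).some⟩⟩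

end Unit

section Monadic

variable {K : Type u} [Field K] {A : TensorCat.{v₁, u, u₁} K} {C : TensorCat.{v₂, u, u₂} K}
  {E : TensorCat.{v₃, u, u₃} K} {J : TensorFunctor A C} [J.functor.Full] {H : TensorFunctor C E}
  {ω : E ⥤ ModuleCat.{u} K} {F : C ⥤ ModuleCat.{u} K} [F.Monoidal] [F.Additive]
  [PreservesFiniteLimits F]

theorem exists_range_map_eq_of_assumptionA3 (hA : AssumptionA3 J H) (e : H.functor ⋙ ω ≅ F)
    {Z : A} {Y : C} (i : Y ⟶ J.functor.obj Z) {r : ℕ}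
    (f : H.functor.obj Y ≅ ⨁ fun _ : Fin r => 𝟙_ E) :
    ∃ (Z' : A) (s : Z' ⟶ Z),
      LinearMap.range (F.map (J.functor.map s)).hom = LinearMap.range (F.map i).hom := by
  obtain ⟨-, G, adj, -, ⟨a, ⟨c⟩⟩, hp⟩ := hA
  have : G.Additive := adj.right_adjoint_additive
  -- The vector is the transpose `𝟙 ⟶ G(𝟙)` of the isomorphism `H(𝟙) ≅ 𝟙`; it is not killed by `F`
  -- because applying `H` and then the counit recovers that isomorphism.
  refine exists_range_map_eq J.functor i (adj.homEquiv _ _ (η H.functor) ≫ c.inv) ?_ ?_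
  · intro h
    have h1 : (F.map (adj.homEquiv _ _ (η H.functor))).hom (unitVec F) = 0 := by
      rw [map_comp_apply] at h
      rw [← map_inv_map_hom F c.symm ((F.map _).hom _)]
      exact (congrArg _ h).trans (map_zero _)
    have h2 : (ω.map (H.functor.map (adj.homEquiv _ _ (η H.functor)))).hom
        ((e.inv.app (𝟙_ C)).hom (unitVec F)) = 0 := by
      have h3 := e.inv.naturality (adj.homEquiv _ _ (η H.functor))
      have h4 := LinearMap.congr_fun (congrArg ModuleCat.Hom.hom h3) (unitVec F)
      refine Eq.trans h4.symm ?_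
      rw [ModuleCat.hom_comp, LinearMap.comp_apply, h1, map_zero]
    have h3 : (ω.map (η H.functor)).hom ((e.inv.app (𝟙_ C)).hom (unitVec F)) = 0 := by
      rw [← (adj.homEquiv _ _).symm_apply_apply (η H.functor), adj.homEquiv_counit,
        map_comp_apply, h2, map_zero]
    have h4 : (e.inv.app (𝟙_ C)).hom (unitVec F) = 0 := by
      rw [← map_inv_map_hom ω (asIso (η H.functor)) ((e.inv.app (𝟙_ C)).hom (unitVec F))]
      exact (congrArg _ h3).trans (map_zero _)
    have h5 : unitVec F = 0 := by
      have h6 : (e.hom.app (𝟙_ C)).hom ((e.inv.app (𝟙_ C)).hom (unitVec F)) = unitVec F := by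
        rw [← LinearMap.comp_apply, ← ModuleCat.hom_comp, Iso.inv_hom_id_app]
        rfl
      rw [← h6, h4, map_zero]
    have h6 := unitFun_unitVec F
    rw [h5, map_zero] at h6
    exact zero_ne_one h6
  -- Since `H(Y) ≅ 𝟙ʳ`, this is the chain `J(aʳ) ≅ G(𝟙)ʳ ≅ G(H Y) ≅ Y ⊗ G(𝟙) ≅ Y ⊗ J(a)`.
  · have := (J.functor.mapBiproduct fun _ : Fin r => a) ≪≫
      biproduct.mapIso (fun _ => c) ≪≫ (G.mapBiproduct fun _ : Fin r => 𝟙_ E).symm ≪≫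
        G.mapIso f.symm ≪≫ (asIso ((projectionMap H adj).app Y)).symm ≪≫ whiskerLeftIso Y c.symm
    exact ⟨_, ⟨this⟩⟩

end Monadic

end TannakaSES

end

noncomputable section

namespace TannakaSES

/-! ### Descent of isomorphisms to a stage of a filtered diagram. -/

section Descent

namespace TensorDiagram

variable {K : Type u} [Field K] {C : TensorCat.{v₂, u, u₂} K}
  {D : TensorCat.{v₃, u, u₃} K} {H : TensorFunctor C D}
  {I : Type u₄} [Category.{v₄} I] {Δ : TensorDiagram.{v₂, v₃, v₄, v₅, u, u₂, u₃, u₄, u₅} H I}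

/-- The isomorphism `T(𝟙ʳ) ≅ 𝟙ʳ` for a tensor functor `T`. -/
def mapBiproductUnit {E : TensorCat.{v₁, u, u₁} K} {E' : TensorCat.{v₂, u, u₂} K}
    (T : TensorFunctor E E') (r : ℕ) :
    T.functor.obj (⨁ fun _ : Fin r => 𝟙_ E) ≅ ⨁ fun _ : Fin r => 𝟙_ E' :=
  (T.functor.mapBiproduct _) ≪≫ biproduct.mapIso fun _ => (Functor.Monoidal.εIso T.functor).symm

/-- The inclusion of the kernel becomes zero in `D`, hence already at some stage, and the transition
functors are exact. -/
theorem IsColimit.exists_mono (hΔ : Δ.IsColimit) {j : I} {X Y : Δ.obj j} (g : X ⟶ Y)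
    [IsIso ((Δ.tgt j).functor.map g)] : ∃ (k : I) (t : j ⟶ k), Mono ((Δ.map t).functor.map g) := by
  obtain ⟨k, t, h⟩ := hΔ.faithful (kernel.ι g) 0 (by
    rw [← cancel_mono ((Δ.tgt j).functor.map g), ← Functor.map_comp, kernel.condition]
    simp)
  refine ⟨k, t, ?_⟩
  have hex : (ShortComplex.mk (kernel.ι g) g (kernel.condition g)).Exact :=
    ShortComplex.exact_kernel g
  have hex2 := hex.map_of_mono_of_preservesKernel (Δ.map t).functor inferInstance inferInstance
  exact hex2.mono_g (h.trans (Functor.map_zero _ _ _))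

theorem IsColimit.exists_epi (hΔ : Δ.IsColimit) {j : I} {X Y : Δ.obj j} (g : X ⟶ Y)
    [IsIso ((Δ.tgt j).functor.map g)] : ∃ (k : I) (t : j ⟶ k), Epi ((Δ.map t).functor.map g) := by
  obtain ⟨k, t, h⟩ := hΔ.faithful (cokernel.π g) 0 (by
    rw [← cancel_epi ((Δ.tgt j).functor.map g), ← Functor.map_comp, cokernel.condition]
    simp)
  refine ⟨k, t, ?_⟩
  have hex : (ShortComplex.mk g (cokernel.π g) (cokernel.condition g)).Exact :=
    ShortComplex.exact_cokernel g
  have hex2 := hex.map_of_epi_of_preservesCokernel (Δ.map t).functor inferInstance inferInstance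
  exact hex2.epi_f (h.trans (Functor.map_zero _ _ _))

theorem isIso_tgt_map_map {j k : I} (t : j ⟶ k) {X Y : Δ.obj j} (g : X ⟶ Y)
    [IsIso ((Δ.tgt j).functor.map g)] :
    IsIso ((Δ.tgt k).functor.map ((Δ.map t).functor.map g)) :=
  (NatIso.isIso_map_iff (Δ.tgtIso t) g).2 inferInstance

/-- The morphism `Hⱼ(Y) ⟶ 𝟙ʳ` given by a morphism between the images of `Hᵢ(Y)` and `𝟙ʳ`. -/
def toUnits {i j : I} (t : i ⟶ j) {Y : C} {r : ℕ}
    (g : (Δ.map t).functor.obj ((Δ.src i).functor.obj Y) ⟶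
      (Δ.map t).functor.obj (⨁ fun _ : Fin r => 𝟙_ (Δ.obj i))) :
    (Δ.src j).functor.obj Y ⟶ ⨁ fun _ : Fin r => 𝟙_ (Δ.obj j) :=
  (Δ.srcIso t).inv.app Y ≫ g ≫ (mapBiproductUnit (Δ.map t) r).hom

/-- If `H(Y)` is a sum of copies of the unit, then so is some `Hⱼ(Y)`. -/
theorem IsColimit.exists_iso_units (hΔ : Δ.IsColimit) {Y : C} {r : ℕ}
    (f : H.functor.obj Y ≅ ⨁ fun _ : Fin r => 𝟙_ D) :
    ∃ j : I, Nonempty ((Δ.src j).functor.obj Y ≅ ⨁ fun _ : Fin r => 𝟙_ (Δ.obj j)) := by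
  obtain ⟨i, -⟩ := hΔ.essSurj (𝟙_ D)
  obtain ⟨j, t, g, hg⟩ := hΔ.full (X := (Δ.src i).functor.obj Y)
    (Y := ⨁ fun _ : Fin r => 𝟙_ (Δ.obj i))
    ((Δ.compIso i).hom.app Y ≫ f.hom ≫ (mapBiproductUnit (Δ.tgt i) r).inv)
  have h0 : IsIso ((Δ.tgt j).functor.map g) := by
    have h1 : IsIso ((Δ.tgt j).functor.map g ≫ (Δ.tgtIso t).hom.app _) := by
      rw [hg]; infer_instance
    exact IsIso.of_isIso_comp_right _ ((Δ.tgtIso t).hom.app _)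
  have h1 : IsIso ((Δ.tgt j).functor.map (toUnits t g)) := by
    rw [toUnits, Functor.map_comp, Functor.map_comp]; infer_instance
  -- The morphism becomes a monomorphism at stage `k` and an epimorphism at stage `l`, where
  -- exactness has kept it mono; `toUnits` brings it back to the form `Hₖ(Y) ⟶ 𝟙ʳ` each time.
  obtain ⟨k, t₁, h2⟩ := hΔ.exists_mono (toUnits t g)
  have h3 := isIso_tgt_map_map t₁ (toUnits t g)
  have h4 : IsIso ((Δ.tgt k).functor.map (toUnits t₁ ((Δ.map t₁).functor.map (toUnits t g)))) := by
    rw [toUnits, Functor.map_comp, Functor.map_comp]; infer_instance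
  have h5 : Mono (toUnits t₁ ((Δ.map t₁).functor.map (toUnits t g))) := by
    rw [toUnits]; infer_instance
  obtain ⟨l, t₂, h6⟩ := hΔ.exists_epi (toUnits t₁ ((Δ.map t₁).functor.map (toUnits t g)))
  have h7 : IsIso ((Δ.map t₂).functor.map
    (toUnits t₁ ((Δ.map t₁).functor.map (toUnits t g)))) := isIso_of_mono_of_epi _
  have h8 : IsIso (toUnits t₂ ((Δ.map t₂).functor.map
      (toUnits t₁ ((Δ.map t₁).functor.map (toUnits t g))))) := by
    rw [toUnits]; infer_instance
  exact ⟨l, ⟨asIso (toUnits t₂ ((Δ.map t₂).functor.map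
    (toUnits t₁ ((Δ.map t₁).functor.map (toUnits t g)))))⟩⟩

end TensorDiagram

end Descent

/-! ### The short exact sequence. -/

section Exactness

variable {K : Type u} [Field K] {A : TensorCat.{v₁, u, u₁} K} {C : TensorCat.{v₂, u, u₂} K}
  {D : TensorCat.{v₃, u, u₃} K} {J : TensorFunctor A C} {H : TensorFunctor C D}

theorem exists_iso_units_of_mono (ω : FiberFunctor D) (hD : IsSemisimple D)
    (h1 : AssumptionA1 J H) {Z : A} {Y : C} (i : Y ⟶ J.functor.obj Z) [Mono i] :
    ∃ r : ℕ, Nonempty (H.functor.obj Y ≅ ⨁ fun _ : Fin r => 𝟙_ D) := by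
  obtain ⟨m, ⟨e⟩⟩ := h1 Z
  exact exists_iso_biproduct_unit ω hD (H.functor.map i ≫ e.hom)

theorem kerLeIm_of_assumptions (ω : FiberFunctor D)
    (h3 : AssumptionA3 J H ∨
      AssumptionA3'.{v₁, v₂, v₃, v₄, v₅, u, u₁, u₂, u₃, u₄, u₅} J H) :
    KerLeIm (homI.{max w u u₁} H ω) (homP.{max w u u₃} J H ω) := by
  rcases h3 with h3 | ⟨I, _, _, Δ, hΔ, h3⟩
  · exact kerLeIm_of_assumptionA3.{w} ω h3
  · exact Δ.kerLeIm.{w} ω hΔ h3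

variable [J.functor.Full]

/-- For `Y ⊆ J(Z)`, `H(Y)` embeds in a sum of units and is therefore such a sum, so `Y ⊗ G(𝟙)` comes
from `A`. For a filtered diagram this is done at a stage where `Hⱼ(Y)` is a sum of units. -/
theorem subobjectsFrom_of_assumptions (ω : FiberFunctor D) (hD : IsSemisimple D)
    (h1 : AssumptionA1 J H)
    (h3 : AssumptionA3 J H ∨
      AssumptionA3'.{v₁, v₂, v₃, v₄, v₅, u, u₁, u₂, u₃, u₄, u₅} J H) :
    SubobjectsFrom J.functor (H.functor ⋙ ω.functor) := by
  intro Z Y i hi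
  obtain ⟨r, ⟨f⟩⟩ := exists_iso_units_of_mono ω hD h1 i
  rcases h3 with h3 | ⟨I, _, _, Δ, hΔ, h3⟩
  · exact exists_range_map_eq_of_assumptionA3 h3 (Iso.refl _) i f
  · obtain ⟨j, ⟨f'⟩⟩ := hΔ.exists_iso_units f
    exact exists_range_map_eq_of_assumptionA3 (h3 j) (ω := (Δ.tgt j).functor ⋙ ω.functor)
      (Functor.isoWhiskerRight (Δ.compIso j) ω.functor) i f'

theorem isShortExact_of_assumptions (ω : FiberFunctor D) (h1 : AssumptionA1 J H)
    (h2 : AssumptionA2 H) (h3 : AssumptionA3 J H ∨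
      AssumptionA3'.{v₁, v₂, v₃, v₄, v₅, u, u₁, u₂, u₃, u₄, u₅} J H) :
    IsShortExact (homI.{max w u u₁} H ω) (homP.{max w u u₃} J H ω) where
  injective := isInjective_of_assumptionA2.{w, v₂, v₃, u, u₁} ω h2
  exact R := by
    refine le_antisymm (kerLeIm_of_assumptions.{w} ω h3 R) ?_
    rintro _ ⟨φ, rfl⟩
    exact isTrivial_of_assumptionA1.{w} ω h1 R φ
  surjective := isSurjective_homP.{w} J H ω (subobjectsFrom_of_assumptions ω h2.1 h1 h3)

end Exactness

end TannakaSES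

end

theorem theoremA1 {K : Type u} [Field K]
    (A : TensorCat.{v₁, u, u₁} K) (C : TensorCat.{v₂, u, u₂} K) (D : TensorCat.{v₃, u, u₃} K)
    (J : TensorFunctor A C) [J.functor.Full] [J.functor.Faithful]
    (H : TensorFunctor C D) (ω : FiberFunctor D) :
    (J.functor.essImage.IsClosedUnderSubobjects → IsSurjective (homP.{max w u u₃} J H ω)) ∧
    (AssumptionA1 J H → IsTrivial (homI.{max w u u₁} H ω ≫ homP.{max w u u₃} J H ω)) ∧
    (AssumptionA2 H → IsInjective (homI.{max w u u₁} H ω)) ∧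
    (AssumptionA3 J H ∨ AssumptionA3'.{v₁, v₂, v₃, v₄, v₅, u, u₁, u₂, u₃, u₄, u₅} J H →
      KerLeIm (homI.{max w u u₁} H ω) (homP.{max w u u₃} J H ω)) ∧
    (AssumptionA1 J H → AssumptionA2 H →
      AssumptionA3 J H ∨ AssumptionA3'.{v₁, v₂, v₃, v₄, v₅, u, u₁, u₂, u₃, u₄, u₅} J H →
      IsShortExact (homI.{max w u u₁} H ω) (homP.{max w u u₃} J H ω)) := by
  exact ⟨fun _ => isSurjective_homP.{w} J H ω (subobjectsFrom_of_isClosedUnderSubobjects J _),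
    isTrivial_of_assumptionA1.{w} ω, isInjective_of_assumptionA2.{w, v₂, v₃, u, u₁} ω,
    kerLeIm_of_assumptions.{w} ω, isShortExact_of_assumptions.{w} ω⟩
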